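/- **Setting.** Let $d\ge 3$. The Kesten–McKay density is $\rho_d(x)=\bigl(1+\frac1{d-1}-\frac{x^2}{d}\bigr)^{-1}\frac{\sqrt{[4-x^2]_+}}{2\pi}$, its Stieltjes transform is $m_d(z)=\int_{\mathbb R}\frac{\rho_d(x)}{x-z}\,dx$, and $$P_\infty(z,w)=1+zw+\frac{d}{d-1}w^2+\sum_{k\ge2}\frac{(-2)^{k-1}(2k-3)!!}{k!}\,\frac{d}{(d-1)^k}\,w^{2k}.$$ **The expansion.** The polynomial $P$ is the output of the following expansion for the random $d$-regular graph on $N$ vertices, in which $G$ is the Green's function of the adjacency matrix $A$ normalized by $\sqrt{d-1}$ and $m=\frac1N\sum_iG_{ii}$. A *term* consists of a finite forest $T$, a real coefficient $a$, an integer $\mathfrak h\ge0$ (recording that $a$ has size $d^{-\mathfrak h/2}$), and a monomial $R=m^{p}\prod G_{xy}$ in symbols $G_{xy}$ indexed by vertices of $T$; it stands for $aN^{-\theta(T)}d^{-|E(T)|}\sum^*\mathbb E[A_TR\,(\cdots)]$, where $\theta(T)$ is the number of components of $T$, $A_T$ is the product of the entries of $A$ over the edges of $T$, and $\sum^*$ is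 over distinct indices. Let $\mathfrak o$ be the number of off-diagonal factors $G_{xy}$, $x\ne y$, of $R$. For vertices $i,j,k,l$ let $\xi_{ij}^{kl}=\Delta_{ij}+\Delta_{kl}-\Delta_{ik}-\Delta_{jl}$, where $\Delta_{ab}$ is the symmetric matrix with entries $1$ at $(a,b)$ and $(b,a)$. For a symmetric matrix $\xi$, let $D_\xi R=\sum_{n\ge1}(d-1)^{-n/2}R_n$, where $R_n$ is the coefficient of $t^n$ in $R$ after every factor $G$ is replaced by $\sum_{n\ge0}t^nG(-\xi G)^n$ and $m$ is kept fixed; each $R_n$ is split into monomials, and those of order $n$ have their $\mathfrak h$ raised by $n$. Fix $K\in\mathbb N$ and apply the following rules to a list of terms until it is empty. 1. A term with $\mathfrak h+\mathfrak o\ge K$, or with a factor $G_{xy}$ whose indices lie in different components of $T$, is discarded. 2. A term with $R=m^p$ is removed, and $a\,u^p$ is added to the output $S(u)$. 3. If $\mathfrak o\ge1$: for each edge $e=\{i,i'\}$ of $T$ take two new vertices $j_e,j'_e$. Replace $T$ by the forest with edges $\{i,j_e\},\{i',j'_e\}$ for all $e$, and $R$ by $D_\xi R$ with $\xi=\sum_e\xi_{ii'}^{j_ej'_e}$.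 4. If $\mathfrak o=0$ and $R=G_{ii}R'$ (any choice of a factor $G_{ii}$ is allowed): the term is replaced by the following terms, in which $j,k,l,m'$ are new vertices and $\deg$ is the degree in $T$. * $a\,mR'$ on $T$, with $\mathfrak h$ unchanged. * $a\frac{d}{\sqrt{d-1}}D_{\xi_{jk}^{lm'}}(G_{jk}R)$ on $T\cup\{j,l\}\cup\{k,m'\}$, without its monomial $-G_{jj}G_{kk}R$ of order $1$; the order-$n$ part has $\mathfrak h$ raised by $n-1$. * $-a\bigl(1-\frac{\deg(i)}d\bigr)\frac{d}{\sqrt{d-1}}\,m\,D_{\xi_{ik}^{lm'}}(G_{ik}R')$ on $T\cup\{i,l\}\cup\{k,m'\}$, without the monomial $-G_{ii}G_{kk}R'$ of order $1$ in the expansion of $D_{\xi_{ik}^{lm'}}(G_{ik}R')$; again $\mathfrak h$ is raised by $n-1$. * $-a\frac{\deg(i)}{d-1}m^2R$ on $T$, with $\mathfrak h$ raised by $2$. * $-\frac{a}{\sqrt{d-1}}\,mG_{ik}R'$ on $T$ for each neighbour $k$ of $i$ in $T$, with $\mathfrak h$ raised by $1$. The initial list consists of the monomials of $\frac{d}{\sqrt{d-1}}D_{\xi_{ij}^{kl}}(G_{ij})$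 on the forest with edges $\{i,k\},\{j,l\}$, those of order $n$ having $\mathfrak h=n-1$, except the leading one $-\frac d{d-1}G_{ii}G_{jj}$. If $S$ is an output, then $$P(z,u)=1+zu+\tfrac{d}{d-1}u^2-S(u)=1+zu+u^2+Q(u),\qquad Q(u)=\tfrac{1}{d-1}u^2-S(u),$$ is called a *polynomial constructed by the expansion to order $K$*. It depends on $d$ and $K$ but not on $N$. **Proposition.** Let $\mathfrak c>0$ and let $K$ be an integer with $\mathfrak cK\ge2$, so that $d^{-K/2}\le 1/N$ whenever $d\ge N^{\mathfrak c}$. For every $d\ge3$ the expansion to order $K$ terminates for suitable choices, that is, a constructed polynomial exists. Moreover: * There is a constant $B=B(\mathfrak c,K)$ such that for all $N$ and $d\ge 3$ with $N^{\mathfrak c}\le d\le N^{1/3-\mathfrak c}$, every polynomial $P$ constructed by the expansion to order $K$, and all $z$ in the upper half plane, $$|P(z,m_d(z))|\le B\,\frac dN .$$ * There are constants $B$ and $N_0$ depending only on $\mathfrak c,K$ such that for all $N\ge N_0$, all $d$ with $N^{\mathfrak c}\le d\le N^{1/3-\mathfrak c}$, every such $P$, all $z\in\mathbb C$ and all $j\ge0$,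 the coefficients of $w^j$ in $P(z,w)$ and in $P_\infty(z,w)$ differ by at most $B\,d/N$. -/

import Mathlib

noncomputable section

namespace RegularGraphExpansion

/-! ### The Kesten--McKay law -/

/-- The Kesten--McKay density `(1 + 1/(d-1) - x²/d)⁻¹ √([4 - x²]₊) / (2π)`. -/
def kestenMcKayDensity (d : ℕ) (x : ℝ) : ℝ :=
  (1 + 1 / ((d : ℝ) - 1) - x ^ 2 / (d : ℝ))⁻¹ * (Real.sqrt (max (4 - x ^ 2) 0) / (2 * Real.pi))

/-- The Stieltjes transform `m_d(z) = ∫ ρ_d(x) / (x - z) dx` of the Kesten--McKay law. -/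
def kestenMcKayStieltjes (d : ℕ) (z : ℂ) : ℂ :=
  ∫ x : ℝ, (kestenMcKayDensity d x : ℂ) / ((x : ℂ) - z)

/-- The power series
`P_∞(z, w) = 1 + z w + d/(d-1) w² + ∑_{k ≥ 2} (-2)^(k-1) (2k-3)!! / k! · d / (d-1)^k · w^(2k)`
in the variable `w`. -/
def limitSeries (d : ℕ) (z : ℂ) : PowerSeries ℂ :=
  PowerSeries.mk fun j =>
    if j = 0 then 1
    else if j = 1 then z
    else if j = 2 then (d : ℂ) / ((d : ℂ) - 1)
    else if Even j then
      (-2 : ℂ) ^ (j / 2 - 1) * (Nat.doubleFactorial (2 * (j / 2) - 3) : ℂ)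
        / (Nat.factorial (j / 2) : ℂ) * ((d : ℂ) / ((d : ℂ) - 1) ^ (j / 2))
    else 0

/-! ### Forests and switchings -/

/-- A forest on the vertices `0, …, size - 1`, given by the list of its edges.  The expansion below
starts from a forest and only ever attaches pendant edges at an existing vertex, adds new
disjoint edges, or replaces all edges of a forest by pendant edges at new vertices; so every
graph occurring in it is a forest. -/
structure Forest where
  size : ℕ
  edges : List (ℕ × ℕ)

/-- The simple graph of a forest. -/
def Forest.graph (T : Forest) : SimpleGraph ℕ :=
  SimpleGraph.fromRel fun x y => (x, y) ∈ T.edges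

/-- The list of neighbours of `i` in `T`. -/
def Forest.neighbors (T : Forest) (i : ℕ) : List ℕ :=
  T.edges.filterMap fun e =>
    if e.1 = i then some e.2 else if e.2 = i then some e.1 else none

/-- The degree of `i` in `T`. -/
def Forest.degree (T : Forest) (i : ℕ) : ℕ := (T.neighbors i).length

/-- The entries `(sign, row, column)` of the switching matrix
`ξ_{ij}^{kl} = Δ_{ij} + Δ_{kl} - Δ_{ik} - Δ_{jl}`, where `Δ_{ab}` has a `1` at the positions
`(a, b)` and `(b, a)`.  A sum of switching matrices is represented by concatenation. -/
def switching (i j k l : ℕ) : List (ℤ × ℕ × ℕ) :=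
  [(1, i, j), (1, j, i), (1, k, l), (1, l, k), (-1, i, k), (-1, k, i), (-1, j, l), (-1, l, j)]

/-- The matrix `ξ` of the simultaneous switching of all edges of `T`: the edge with
number `t` and end points `a, b` is switched with a new edge on the vertices
`size + 2t, size + 2t + 1`. -/
def Forest.fullSwitching (T : Forest) : List (ℤ × ℕ × ℕ) :=
  T.edges.zipIdx.flatMap fun p =>
    switching p.1.1 p.1.2 (T.size + 2 * p.2) (T.size + 2 * p.2 + 1)

/-- The forest `T⁺` obtained by switching all edges of `T`: each edge `{a, b}` of `T` is replaced
by the two edges `{a, j}` and `{b, j'}`, where `j, j'` are its new vertices. -/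
def Forest.fullSwitch (T : Forest) : Forest where
  size := T.size + 2 * T.edges.length
  edges := T.edges.zipIdx.flatMap fun p =>
    [(p.1.1, T.size + 2 * p.2), (p.1.2, T.size + 2 * p.2 + 1)]

/-! ### Taylor expansion of monomials in the Green's function entries

A product of Green's function entries `∏ G_{xy}` is represented by the list of its index
pairs `(x, y)`. -/

/-- The monomials, with their integer coefficients, of the entry `(x, y)` of `G (-ξ G)^n`. -/
def expandEntry (ξ : List (ℤ × ℕ × ℕ)) : ℕ → ℕ → ℕ → List (ℤ × List (ℕ × ℕ))
  | 0, x, y => [(1, [(x, y)])]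
  | n + 1, x, y =>
    ξ.flatMap fun e =>
      (expandEntry ξ n e.2.2 y).map fun p => (-(e.1 * p.1), (x, e.2.1) :: p.2)

/-- The monomials, with their integer coefficients, of the coefficient of `t^n` in the product of
the entries `es`, when `G` is replaced by `∑ t^n G (-ξ G)^n = (G⁻¹ + t ξ)⁻¹`.  If `∂_ξ` denotes
the derivative of `G = (H - z)⁻¹` when `H` moves in the direction `ξ`, this is `∂_ξ^n / n!` of
the product of the entries. -/
def expandEntries (ξ : List (ℤ × ℕ × ℕ)) : ℕ → List (ℕ × ℕ) → List (ℤ × List (ℕ × ℕ))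
  | n, [] => if n = 0 then [(1, [])] else []
  | n, e :: es =>
    (List.range (n + 1)).flatMap fun k =>
      (expandEntry ξ k e.1 e.2).flatMap fun p =>
        (expandEntries ξ (n - k) es).map fun q => (p.1 * q.1, p.2 ++ q.2)

/-! ### Terms of the expansion -/

/-- A term `coef · N^{-θ(T)} d^{-|E|} ∑*_i E[A_T R_i U_i]` of the expansion, where `T = forest`
and `R = m^mPow · ∏_{(x,y) ∈ entries} G_{xy}`.  The number `order` is the exponent `𝔥` such that
`coef` is of order `d^{-𝔥/2}`.  The coefficient `coef` includes the constant by which a sum with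
`U_i` has to be multiplied when it is rewritten as an expectation with `P^{q-1} \bar P^q`. -/
structure Term where
  forest : Forest
  coef : ℝ
  order : ℕ
  mPow : ℕ
  entries : List (ℕ × ℕ)

/-- The number `𝔬` of off-diagonal Green's function entries of a term. -/
def Term.offDiagCount (τ : Term) : ℕ := τ.entries.countP fun e => decide (e.1 ≠ e.2)

/-- The term contains a Green's function entry with indices in different connected components of
its forest. -/
def Term.HasCrossEntry (τ : Term) : Prop :=
  ∃ e ∈ τ.entries, ¬ τ.forest.graph.Reachable e.1 e.2

/-- The terms of Taylor order `1 ≤ n ≤ K` in the expansion of `coef · m^mPow · D_ξ (∏_{es} G_{xy})`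
on the forest `T`, the derivatives of `m` being neglected.  The one of Taylor order `n` carries
the factor `(d-1)^{-n/2}`; `order` is the order of the terms with `n = 1`. -/
def taylorTerms (K d : ℕ) (T : Forest) (ξ : List (ℤ × ℕ × ℕ)) (coef : ℝ) (order mPow : ℕ)
    (es : List (ℕ × ℕ)) : List Term :=
  (List.range K).flatMap fun n =>
    (expandEntries ξ (n + 1) es).map fun p =>
      { forest := T
        coef := coef * (p.1 : ℝ) / Real.sqrt ((d : ℝ) - 1) ^ (n + 1)
        order := order + n
        mPow := mPow
        entries := p.2 }

/-- Off-diagonal discrete integration by parts: all edges of the forest are switched. -/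
def Term.offDiagStep (K d : ℕ) (τ : Term) : List Term :=
  taylorTerms K d τ.forest.fullSwitch τ.forest.fullSwitching τ.coef (τ.order + 1) τ.mPow τ.entries

/-- The part of the diagonal integration by parts at `G_{ii}` coming from
`N^{-1} (d-1)^{-1/2} ∑_j (AG)_{jj} R`: with new vertices `j, k, l, m`, the forest
becomes `T ∪ {j, l} ∪ {k, m}`, and `D_{jk}^{lm} (G_{jk} R)` is expanded.  Here
`R = G_{ii} R'`, where `R'` has the entries `es`, and the leading monomial
`G_{jj} G_{kk} R` is left out. -/
def Term.diagStepFresh (K d : ℕ) (τ : Term) (i : ℕ) (es : List (ℕ × ℕ)) : List Term :=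
  let j := τ.forest.size
  let k := τ.forest.size + 1
  let l := τ.forest.size + 2
  let m := τ.forest.size + 3
  (taylorTerms K d ⟨τ.forest.size + 4, (j, l) :: (k, m) :: τ.forest.edges⟩ (switching j k l m)
      (τ.coef * ((d : ℝ) / Real.sqrt ((d : ℝ) - 1))) τ.order τ.mPow
      ((j, k) :: (i, i) :: es)).filter
    fun σ => decide (σ.entries ≠ (j, j) :: (k, k) :: (i, i) :: es)

/-- The part of the diagonal integration by parts at `G_{ii}` coming from the summation over
`k ∉ T` in `-(d-1)^{-1/2} (AG)_{ii} m R'`: with new vertices `k, l, m`, the forest becomes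
`T ∪ {i, l} ∪ {k, m}`, and `D_{ik}^{lm} (G_{ik} R')` is expanded.  The leading
monomial `G_{ii} G_{kk} R'` is left out.  The factor `1 - deg(i)/d` arises when `U` is rewritten
in terms of the former forest. -/
def Term.diagStepAttached (K d : ℕ) (τ : Term) (i : ℕ) (es : List (ℕ × ℕ)) : List Term :=
  let k := τ.forest.size
  let l := τ.forest.size + 1
  let m := τ.forest.size + 2
  (taylorTerms K d ⟨τ.forest.size + 3, (i, l) :: (k, m) :: τ.forest.edges⟩ (switching i k l m)
      (-(τ.coef * (1 - (τ.forest.degree i : ℝ) / (d : ℝ))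
        * ((d : ℝ) / Real.sqrt ((d : ℝ) - 1)))) τ.order (τ.mPow + 1)
      ((i, k) :: es)).filter
    fun σ => decide (σ.entries ≠ (i, i) :: (k, k) :: es)

/-- The difference of the two leading monomials left out above,
`-d/(d-1) (1 - (1 - deg(i)/d)) m² R = -deg(i)/(d-1) m² R`. -/
def Term.diagStepLeading (d : ℕ) (τ : Term) (i : ℕ) : Term :=
  { forest := τ.forest
    coef := -(τ.coef * ((τ.forest.degree i : ℝ) / ((d : ℝ) - 1)))
    order := τ.order + 2
    mPow := τ.mPow + 2
    entries := τ.entries }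

/-- The part of the diagonal integration by parts at `G_{ii}` coming from the neighbours `k` of
`i` in `T` in `-(d-1)^{-1/2} (AG)_{ii} m R'`. -/
def Term.diagStepNeighbors (d : ℕ) (τ : Term) (i : ℕ) (es : List (ℕ × ℕ)) : List Term :=
  (τ.forest.neighbors i).map fun k =>
    { forest := τ.forest
      coef := -(τ.coef / Real.sqrt ((d : ℝ) - 1))
      order := τ.order + 1
      mPow := τ.mPow + 1
      entries := (i, k) :: es }

/-- Diagonal discrete integration by parts at an entry `G_{ii}` of `R = G_{ii} R'`: the entry
is replaced by `m`, plus the correction terms. -/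
def Term.diagStep (K d : ℕ) (τ : Term) (i : ℕ) : List Term :=
  let es := τ.entries.erase (i, i)
  { τ with mPow := τ.mPow + 1, entries := es } ::
    τ.diagStepLeading d i ::
      (τ.diagStepNeighbors d i es ++ τ.diagStepFresh K d i es ++ τ.diagStepAttached K d i es)

/-- `Expands K d L S`: repeated integration by parts turns the sum of the terms in `L` into
`S(m)`, where terms with `𝔥 + 𝔬 ≥ K` and terms with an entry between different components
are discarded as negligible. -/
inductive Expands (K d : ℕ) : List Term → Polynomial ℝ → Prop
  | nil : Expands K d [] 0
  | discard {τ : Term} {L : List Term} {S : Polynomial ℝ}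
      (h : K ≤ τ.order + τ.offDiagCount) (hL : Expands K d L S) : Expands K d (τ :: L) S
  | cross {τ : Term} {L : List Term} {S : Polynomial ℝ}
      (h : τ.HasCrossEntry) (hL : Expands K d L S) : Expands K d (τ :: L) S
  | done {τ : Term} {L : List Term} {S : Polynomial ℝ}
      (h : τ.order + τ.offDiagCount < K) (he : τ.entries = []) (hL : Expands K d L S) :
      Expands K d (τ :: L) (Polynomial.C τ.coef * Polynomial.X ^ τ.mPow + S)
  | offDiag {τ : Term} {L : List Term} {S : Polynomial ℝ}
      (h : τ.order + τ.offDiagCount < K) (hc : ¬ τ.HasCrossEntry) (ho : 1 ≤ τ.offDiagCount)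
      (hL : Expands K d (τ.offDiagStep K d ++ L) S) : Expands K d (τ :: L) S
  | diag {τ : Term} {L : List Term} {S : Polynomial ℝ} (i : ℕ)
      (h : τ.order + τ.offDiagCount < K) (ho : τ.offDiagCount = 0) (hi : (i, i) ∈ τ.entries)
      (hL : Expands K d (τ.diagStep K d i ++ L) S) : Expands K d (τ :: L) S

/-! ### The polynomial -/

/-- The terms of `d (d-1)^{-1/2} N^{-2} d^{-2} ∑* E[A_{ik} A_{jl} D_{ij}^{kl}(G_{ij}) …]`, with
`(i, j, k, l) = (0, 1, 2, 3)`, to which one integration by parts reduces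
`(1 + z m) = N^{-1} (d-1)^{-1/2} ∑ A_{ij} G_{ij}`, apart from the leading term
`-d/(d-1) G_{ii} G_{jj}`, which equals `-d/(d-1) m²`. -/
def initialTerms (K d : ℕ) : List Term :=
  (taylorTerms K d ⟨4, [(0, 2), (1, 3)]⟩ (switching 0 1 2 3)
      ((d : ℝ) / Real.sqrt ((d : ℝ) - 1)) 0 0 [(0, 1)]).filter
    fun σ => decide (σ.entries ≠ [(0, 0), (1, 1)])

/-- `Q` is a polynomial constructed by the expansion up to order `K`.  The expansion leads to
`1 + z m = -d/(d-1) m² + S(m)`, and `1 + z u + u² + Q(u) = 1 + z u + d/(d-1) u² - S(u)`. -/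
def IsConstructed (K d : ℕ) (Q : Polynomial ℝ) : Prop :=
  ∃ S : Polynomial ℝ, Expands K d (initialTerms K d) S ∧
    Q = Polynomial.C (1 / ((d : ℝ) - 1)) * Polynomial.X ^ 2 - S

/-- `P(z, u) = 1 + z u + u² + Q(u)`, as a polynomial in `u`. -/
def selfConsistentPoly (Q : Polynomial ℝ) (z : ℂ) : Polynomial ℂ :=
  1 + Polynomial.C z * Polynomial.X + Polynomial.X ^ 2 + Q.map (algebraMap ℝ ℂ)

end RegularGraphExpansion

end

/-!
The expansion is tested on the infinite `d`-regular tree. Embed the components of a forest `T` into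
disjoint copies of this tree. At the spectral parameter `z = -s - 1/s` with `|s| < 1`, the Green's
function of the trees is `u (-t s)^n` for two vertices at distance `n` and zero for vertices in
different trees, where `t = (d-1)^{-1/2}` and `u = s / (1 - t² s²) = m_d(z)`
(`kestenMcKayStieltjes_eq`). Substituting these numbers for the symbols `G_{xy}` and `m` gives every
term a value, `Term.value`, and each rule of the expansion preserves the total value up to
`O(d^{-K/2})`:

* A term with an entry between different components has value zero, and a term of order
  `𝔥 + 𝔬 ≥ K` has value `O(d^{-K/2})`, since off-diagonal entries are `O(t)`.
* A switching turns a union of infinite trees into another one. By the Schur complement formula, the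
  Green's function on the vertices of a forest is the inverse of `u⁻¹` plus a sum over the edges
  (`schurOp_treeGreen`), and a switching changes this matrix exactly by `t ξ`. This is the resolvent
  identity `treeGreen_resolvent`, and its iteration is the Taylor expansion
  (`exists_valueSum_taylorTerms_bound`).
* In an off-diagonal step the zeroth order of the Taylor expansion vanishes, because the old vertices
  lie in different components of the switched forest. In a diagonal step the term
  `a m R'` already has the full value, and the other four kinds of terms cancel because of
  `u - s = t² s² u` (`Term.WellFormed.exists_diagStep_bound`).

The expansion terminates because `𝔥` grows, up to steps that are controlled by the number of entries
(`Term.rank`). As the shapes of the terms depend neither on `d` nor on the coefficients, well-founded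
induction along the same order gives bounds that are uniform in `d` and in all choices
(`Term.WellFormed.resolvable`). The value of the initial terms is `d/(d-1) (u² - u s)`, which equals
`1 + z u + d/(d-1) u²`; hence `S(u) = 1 + z u + d/(d-1) u² + O(d^{-K/2})`, and `d^{-K/2} ≤ 1/N` up to
a constant. This is the bound on `P(z, m_d(z))`.

For the coefficients, write `a = t²`. Then `s/u = 1 - a s²` is the solution `g` of `g = 1 - y g²` at
`y = a u²`, the generating function of the Catalan numbers at `-y`, so that
`d/(d-1) (u² - u s) = d/(d-1) u² (1 - g)` is the sum of the limiting series. So `S` is close to the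
truncated limiting series at all `u` in `(0, 1/2]`, and by interpolation their coefficients are close.
-/

noncomputable section

namespace RegularGraphExpansion

open Polynomial

/-! ### Termination of the expansion -/

theorem mem_taylorTerms {K d : ℕ} {T : Forest} {ξ : List (ℤ × ℕ × ℕ)} {a : ℝ} {o m : ℕ}
    {es : List (ℕ × ℕ)} {σ : Term} :
    σ ∈ taylorTerms K d T ξ a o m es ↔
      ∃ n < K, ∃ p ∈ expandEntries ξ (n + 1) es,
        σ = ⟨T, a * (p.1 : ℝ) / Real.sqrt ((d : ℝ) - 1) ^ (n + 1), o + n, m, p.2⟩ := by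
  simp only [taylorTerms, List.mem_flatMap, List.mem_range, List.mem_map]
  constructor
  · rintro ⟨n, hn, p, hp, rfl⟩
    exact ⟨n, hn, p, hp, rfl⟩
  · rintro ⟨n, hn, p, hp, rfl⟩
    exact ⟨n, hn, p, hp, rfl⟩

theorem expandEntries_zero (ξ : List (ℤ × ℕ × ℕ)) (es : List (ℕ × ℕ)) :
    expandEntries ξ 0 es = [(1, es)] := by
  induction es with
  | nil => simp [expandEntries]
  | cons e es ih => simp [expandEntries, expandEntry, ih]

/-- In the first order expansion of a product with an off-diagonal entry `G_{xy}` in front, the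
only monomial that can have no off-diagonal entry is the one in which `G_{xy}` is replaced by
`G_{xx} G_{yy}`. -/
theorem entries_eq_of_mem_expandEntries_one {ξ : List (ℤ × ℕ × ℕ)} {x y : ℕ}
    {es : List (ℕ × ℕ)} (hxy : x ≠ y) {p : ℤ × List (ℕ × ℕ)}
    (hp : p ∈ expandEntries ξ 1 ((x, y) :: es))
    (hd : p.2.countP (fun e => decide (e.1 ≠ e.2)) = 0) :
    p.2 = (x, x) :: (y, y) :: es := by
  simp only [expandEntries, List.mem_flatMap, List.mem_range, List.mem_map] at hp
  obtain ⟨k, hk, a, ha, b, hb, rfl⟩ := hp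
  have hk' : k = 0 ∨ k = 1 := by omega
  rcases hk' with rfl | rfl
  · simp only [expandEntry, List.mem_singleton] at ha
    subst ha
    simp [hxy] at hd
  · rw [Nat.sub_self, expandEntries_zero, List.mem_singleton] at hb
    subst hb
    simp only [expandEntry, List.mem_flatMap, List.map_cons, List.map_nil,
      List.mem_singleton] at ha
    obtain ⟨e, -, rfl⟩ := ha
    simp only [List.countP_eq_zero, List.cons_append, List.nil_append, List.mem_cons,
      forall_eq_or_imp, decide_eq_true_eq, not_not] at hd
    obtain ⟨h1, h2, -⟩ := hd
    simp [← h1, h2]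

/-- The quantity that decreases, lexicographically, along the expansion: integrations by parts
raise `𝔥`, except that a diagonal one may keep `𝔥` while it removes an entry or creates
off-diagonal entries, and in the latter case the next step raises `𝔥`. -/
def Term.rank (K : ℕ) (τ : Term) : ℕ ×ₗ ℕ :=
  toLex (K - τ.order, if τ.offDiagCount = 0 then τ.entries.length + 1 else 0)

theorem Term.rank_lt_of_order_lt {K : ℕ} {σ τ : Term} (h : τ.order < K)
    (h' : τ.order < σ.order) : σ.rank K < τ.rank K := by
  simp only [rank, Prod.Lex.toLex_lt_toLex]
  left
  omega

theorem Term.rank_lt_of_order_eq {K : ℕ} {σ τ : Term} (h : σ.order = τ.order)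
    (h0 : τ.offDiagCount = 0)
    (h' : σ.offDiagCount ≠ 0 ∨ σ.entries.length < τ.entries.length) : σ.rank K < τ.rank K := by
  simp only [rank, Prod.Lex.toLex_lt_toLex]
  right
  refine ⟨by rw [h], ?_⟩
  rw [if_pos h0]
  split_ifs <;> omega

theorem Term.rank_lt_of_mem_offDiagStep {K d : ℕ} {σ τ : Term} (h : τ.order < K)
    (hσ : σ ∈ τ.offDiagStep K d) : σ.rank K < τ.rank K := by
  obtain ⟨n, -, p, -, rfl⟩ := mem_taylorTerms.1 hσ
  exact rank_lt_of_order_lt h (by simp only; omega)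

/-- The common argument for the two expanded parts of a diagonal integration by parts. -/
theorem Term.rank_lt_of_mem_filter_taylorTerms {K d m x y : ℕ} {T : Forest}
    {ξ : List (ℤ × ℕ × ℕ)} {a : ℝ} {es : List (ℕ × ℕ)} {σ τ : Term} (h : τ.order < K)
    (h0 : τ.offDiagCount = 0) (hxy : x ≠ y)
    (hσ : σ ∈ (taylorTerms K d T ξ a τ.order m ((x, y) :: es)).filter
      fun σ => decide (σ.entries ≠ (x, x) :: (y, y) :: es)) :
    σ.rank K < τ.rank K := by
  obtain ⟨hσ, hne⟩ := List.mem_filter.1 hσ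
  obtain ⟨n, -, p, hp, rfl⟩ := mem_taylorTerms.1 hσ
  rcases Nat.eq_zero_or_pos n with rfl | hn
  · have hod : p.2.countP (fun e => decide (e.1 ≠ e.2)) ≠ 0 := fun h =>
      of_decide_eq_true hne (entries_eq_of_mem_expandEntries_one hxy hp h)
    exact rank_lt_of_order_eq rfl h0 (Or.inl hod)
  · exact rank_lt_of_order_lt h (by simp only; omega)

theorem Term.rank_lt_of_mem_diagStep {K d i : ℕ} {σ τ : Term} (h : τ.order < K)
    (h0 : τ.offDiagCount = 0) (hi : (i, i) ∈ τ.entries)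
    (hT : ∀ e ∈ τ.entries, e.1 < τ.forest.size ∧ e.2 < τ.forest.size)
    (hσ : σ ∈ τ.diagStep K d i) : σ.rank K < τ.rank K := by
  simp only [diagStep, List.mem_cons, List.mem_append] at hσ
  rcases hσ with rfl | rfl | (hσ | hσ) | hσ
  · refine rank_lt_of_order_eq rfl h0 (Or.inr ?_)
    have := List.length_pos_of_mem hi
    simp only [List.length_erase_of_mem hi]
    omega
  · exact rank_lt_of_order_lt h (by simp only [diagStepLeading]; omega)
  · simp only [diagStepNeighbors, List.mem_map] at hσ
    obtain ⟨k, -, rfl⟩ := hσ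
    exact rank_lt_of_order_lt h (by simp only; omega)
  · exact rank_lt_of_mem_filter_taylorTerms h h0 (by omega) hσ
  · have := (hT _ hi).1
    exact rank_lt_of_mem_filter_taylorTerms h h0 (by simp only at this; omega) hσ

/-! ### Well-formed terms -/

/-- Every edge `(a, b)` of the list has a second end point that differs from its first and occurs
in no later edge.  Such a list describes a forest, built from its tail by attaching the leaf `b` at
`a`; this is the form in which the acyclicity of the forests of the expansion is used. -/
def FreshEdges (es : List (ℕ × ℕ)) : Prop :=
  es.Pairwise (fun e e' => e'.1 ≠ e.2 ∧ e'.2 ≠ e.2) ∧ ∀ e ∈ es, e.1 ≠ e.2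

theorem freshEdges_cons {a b : ℕ} {es : List (ℕ × ℕ)} :
    FreshEdges ((a, b) :: es) ↔
      a ≠ b ∧ (∀ e ∈ es, e.1 ≠ b ∧ e.2 ≠ b) ∧ FreshEdges es := by
  simp only [FreshEdges, List.pairwise_cons, List.mem_cons, forall_eq_or_imp]
  tauto

/-- A term whose forest is given by a list of edges with fresh end points, and all of whose
indices are vertices of the forest. -/
structure Term.WellFormed (τ : Term) : Prop where
  fresh : FreshEdges τ.forest.edges
  edges_lt : ∀ e ∈ τ.forest.edges, e.1 < τ.forest.size ∧ e.2 < τ.forest.size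
  entries_lt : ∀ e ∈ τ.entries, e.1 < τ.forest.size ∧ e.2 < τ.forest.size

theorem lt_of_mem_expandEntry {ξ : List (ℤ × ℕ × ℕ)} {m : ℕ}
    (hξ : ∀ e ∈ ξ, e.2.1 < m ∧ e.2.2 < m) {n x y : ℕ} (hx : x < m) (hy : y < m)
    {p : ℤ × List (ℕ × ℕ)} (hp : p ∈ expandEntry ξ n x y) :
    ∀ e ∈ p.2, e.1 < m ∧ e.2 < m := by
  induction n generalizing x p with
  | zero =>
    simp only [expandEntry, List.mem_singleton] at hp
    subst hp
    simpa using ⟨hx, hy⟩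
  | succ n ih =>
    simp only [expandEntry, List.mem_flatMap, List.mem_map] at hp
    obtain ⟨e, he, b, hb, rfl⟩ := hp
    simp only [List.mem_cons, forall_eq_or_imp]
    exact ⟨⟨hx, (hξ e he).1⟩, ih (hξ e he).2 hb⟩

theorem lt_of_mem_expandEntries {ξ : List (ℤ × ℕ × ℕ)} {m : ℕ}
    (hξ : ∀ e ∈ ξ, e.2.1 < m ∧ e.2.2 < m) {n : ℕ} {es : List (ℕ × ℕ)}
    (hes : ∀ e ∈ es, e.1 < m ∧ e.2 < m)
    {p : ℤ × List (ℕ × ℕ)} (hp : p ∈ expandEntries ξ n es) :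
    ∀ e ∈ p.2, e.1 < m ∧ e.2 < m := by
  induction es generalizing n p with
  | nil =>
    simp only [expandEntries] at hp
    split_ifs at hp
    · simp only [List.mem_singleton] at hp
      subst hp
      simp
    · simp at hp
  | cons e es ih =>
    simp only [expandEntries, List.mem_flatMap, List.mem_range, List.mem_map] at hp
    obtain ⟨k, hk, a, ha, b, hb, rfl⟩ := hp
    simp only [List.mem_cons, forall_eq_or_imp] at hes
    intro f hf
    rcases List.mem_append.1 hf with hf | hf
    · exact lt_of_mem_expandEntry hξ hes.1.1 hes.1.2 ha f hf
    · exact ih hes.2 hb f hf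

theorem abs_le_one_of_mem_expandEntry {ξ : List (ℤ × ℕ × ℕ)} (hξ : ∀ e ∈ ξ, |e.1| ≤ 1)
    {n x y : ℕ} {p : ℤ × List (ℕ × ℕ)} (hp : p ∈ expandEntry ξ n x y) : |p.1| ≤ 1 := by
  induction n generalizing x p with
  | zero =>
    simp only [expandEntry, List.mem_singleton] at hp
    subst hp
    simp
  | succ n ih =>
    simp only [expandEntry, List.mem_flatMap, List.mem_map] at hp
    obtain ⟨e, he, b, hb, rfl⟩ := hp
    rw [abs_neg, abs_mul]
    exact mul_le_one₀ (hξ e he) (abs_nonneg _) (ih hb)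

theorem abs_le_one_of_mem_expandEntries {ξ : List (ℤ × ℕ × ℕ)} (hξ : ∀ e ∈ ξ, |e.1| ≤ 1)
    {n : ℕ} {es : List (ℕ × ℕ)} {p : ℤ × List (ℕ × ℕ)} (hp : p ∈ expandEntries ξ n es) :
    |p.1| ≤ 1 := by
  induction es generalizing n p with
  | nil =>
    simp only [expandEntries] at hp
    split_ifs at hp
    · simp only [List.mem_singleton] at hp
      subst hp
      simp
    · simp at hp
  | cons e es ih =>
    simp only [expandEntries, List.mem_flatMap, List.mem_range, List.mem_map] at hp
    obtain ⟨k, hk, a, ha, b, hb, rfl⟩ := hp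
    rw [abs_mul]
    exact mul_le_one₀ (abs_le_one_of_mem_expandEntry hξ ha) (abs_nonneg _) (ih hb)

theorem abs_le_one_of_mem_switching {i j k l : ℕ} : ∀ e ∈ switching i j k l, |e.1| ≤ 1 := by
  simp [switching]

theorem lt_of_mem_switching {i j k l m : ℕ} (hi : i < m) (hj : j < m) (hk : k < m) (hl : l < m) :
    ∀ e ∈ switching i j k l, e.2.1 < m ∧ e.2.2 < m := by
  simp [switching, *]

theorem Term.WellFormed.of_mem_taylorTerms {K d o m : ℕ} {T : Forest} {ξ : List (ℤ × ℕ × ℕ)}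
    {a : ℝ} {es : List (ℕ × ℕ)} {σ : Term} (hf : FreshEdges T.edges)
    (hT : ∀ e ∈ T.edges, e.1 < T.size ∧ e.2 < T.size)
    (hξ : ∀ e ∈ ξ, e.2.1 < T.size ∧ e.2.2 < T.size)
    (hes : ∀ e ∈ es, e.1 < T.size ∧ e.2 < T.size)
    (hσ : σ ∈ taylorTerms K d T ξ a o m es) : σ.WellFormed := by
  obtain ⟨n, -, p, hp, rfl⟩ := mem_taylorTerms.1 hσ
  exact ⟨hf, hT, lt_of_mem_expandEntries hξ hes hp⟩

/-! ### Simultaneous switchings, with the edges numbered from an arbitrary start -/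

/-- The edges `{a, j}`, `{b, j'}` for the edges `{a, b}` of `es`, where `j, j'` are the new vertices
`m + 2t, m + 2t + 1` for the edge with number `t`. -/
def pendantEdges (m s : ℕ) (es : List (ℕ × ℕ)) : List (ℕ × ℕ) :=
  (es.zipIdx s).flatMap fun p => [(p.1.1, m + 2 * p.2), (p.1.2, m + 2 * p.2 + 1)]

/-- The edges `{j, j'}` for the new vertices `j, j'` of `pendantEdges`. -/
def pairEdges (m s : ℕ) (es : List (ℕ × ℕ)) : List (ℕ × ℕ) :=
  (es.zipIdx s).map fun p => (m + 2 * p.2, m + 2 * p.2 + 1)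

/-- The entries of the matrix that switches the edges of `es` with those of `pairEdges`. -/
def switchingFrom (m s : ℕ) (es : List (ℕ × ℕ)) : List (ℤ × ℕ × ℕ) :=
  (es.zipIdx s).flatMap fun p => switching p.1.1 p.1.2 (m + 2 * p.2) (m + 2 * p.2 + 1)

theorem pendantEdges_cons (m s a b : ℕ) (es : List (ℕ × ℕ)) :
    pendantEdges m s ((a, b) :: es) =
      (a, m + 2 * s) :: (b, m + 2 * s + 1) :: pendantEdges m (s + 1) es := by
  simp [pendantEdges, List.zipIdx_cons]

theorem pairEdges_cons (m s a b : ℕ) (es : List (ℕ × ℕ)) :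
    pairEdges m s ((a, b) :: es) =
      (m + 2 * s, m + 2 * s + 1) :: pairEdges m (s + 1) es := by
  simp [pairEdges, List.zipIdx_cons]

theorem switchingFrom_cons (m s a b : ℕ) (es : List (ℕ × ℕ)) :
    switchingFrom m s ((a, b) :: es) =
      switching a b (m + 2 * s) (m + 2 * s + 1) ++ switchingFrom m (s + 1) es := by
  simp [switchingFrom, List.zipIdx_cons]

theorem bounds_of_mem_pendantEdges {m s : ℕ} {es : List (ℕ × ℕ)}
    (h : ∀ e ∈ es, e.1 < m ∧ e.2 < m) :
    ∀ e ∈ pendantEdges m s es, e.1 < m ∧ m + 2 * s ≤ e.2 ∧ e.2 < m + 2 * (s + es.length) := by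
  induction es generalizing s with
  | nil => simp [pendantEdges]
  | cons e es ih =>
    obtain ⟨a, b⟩ := e
    simp only [List.mem_cons, forall_eq_or_imp] at h
    simp only [pendantEdges_cons, List.mem_cons, forall_eq_or_imp, List.length_cons]
    refine ⟨by omega, by omega, fun e he => ?_⟩
    have := ih h.2 (s := s + 1) e he
    omega

theorem bounds_of_mem_pairEdges {m s : ℕ} {es : List (ℕ × ℕ)} :
    ∀ e ∈ pairEdges m s es, m + 2 * s ≤ e.1 ∧ m + 2 * s ≤ e.2 := by
  induction es generalizing s with
  | nil => simp [pairEdges]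
  | cons e es ih =>
    obtain ⟨a, b⟩ := e
    simp only [pairEdges_cons, List.mem_cons, forall_eq_or_imp]
    refine ⟨by omega, fun e he => ?_⟩
    have := ih (s := s + 1) e he
    omega

theorem bounds_of_mem_switchingFrom {m s : ℕ} {es : List (ℕ × ℕ)}
    (h : ∀ e ∈ es, e.1 < m ∧ e.2 < m) :
    ∀ e ∈ switchingFrom m s es, |e.1| ≤ 1 ∧ e.2.1 < m + 2 * (s + es.length) ∧
      e.2.2 < m + 2 * (s + es.length) := by
  induction es generalizing s with
  | nil => simp [switchingFrom]
  | cons e es ih =>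
    obtain ⟨a, b⟩ := e
    simp only [List.mem_cons, forall_eq_or_imp] at h
    intro e he
    rw [switchingFrom_cons] at he
    rcases List.mem_append.1 he with he | he
    · refine ⟨abs_le_one_of_mem_switching e he, ?_⟩
      simp only [List.length_cons]
      exact lt_of_mem_switching (by omega) (by omega) (by omega) (by omega) e he
    · have := ih h.2 (s := s + 1) e he
      simp only [List.length_cons]
      exact ⟨this.1, by omega, by omega⟩

theorem freshEdges_pendantEdges {m s : ℕ} {es : List (ℕ × ℕ)}
    (h : ∀ e ∈ es, e.1 < m ∧ e.2 < m) : FreshEdges (pendantEdges m s es) := by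
  induction es generalizing s with
  | nil => simp [pendantEdges, FreshEdges]
  | cons e es ih =>
    obtain ⟨a, b⟩ := e
    simp only [List.mem_cons, forall_eq_or_imp] at h
    have hb := bounds_of_mem_pendantEdges (s := s + 1) h.2
    rw [pendantEdges_cons, freshEdges_cons, freshEdges_cons]
    simp only [List.mem_cons, forall_eq_or_imp]
    refine ⟨by omega, ⟨by omega, fun e he => ?_⟩, by omega, fun e he => ?_, ih h.2⟩ <;>
    · have := hb e he
      omega

theorem freshEdges_pairEdges_append {m s : ℕ} {es fs : List (ℕ × ℕ)}
    (hf : FreshEdges fs) (h : ∀ e ∈ fs, e.1 < m ∧ e.2 < m) :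
    FreshEdges (pairEdges m s es ++ fs) := by
  induction es generalizing s with
  | nil => simpa [pairEdges] using hf
  | cons e es ih =>
    obtain ⟨a, b⟩ := e
    rw [pairEdges_cons, List.cons_append, freshEdges_cons]
    refine ⟨by omega, fun e he => ?_, ih⟩
    rcases List.mem_append.1 he with he | he
    · have := bounds_of_mem_pairEdges e he
      omega
    · have := h e he
      omega

/-- Attaching a pendant edge `{i, l}` and adding an isolated edge `{k, m}`, with new vertices. -/
theorem freshEdges_cons_cons {i l k m : ℕ} {es : List (ℕ × ℕ)} (hf : FreshEdges es) {n : ℕ}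
    (h : ∀ e ∈ es, e.1 < n ∧ e.2 < n) (hl : n ≤ l) (hm : n ≤ m) (hil : i ≠ l)
    (hkl : k ≠ l) (hkm : k ≠ m) (hlm : l ≠ m) :
    FreshEdges ((i, l) :: (k, m) :: es) := by
  rw [freshEdges_cons, freshEdges_cons]
  simp only [List.mem_cons, forall_eq_or_imp]
  refine ⟨hil, ⟨⟨hkl, hlm.symm⟩, fun e he => ?_⟩, hkm, fun e he => ?_, hf⟩ <;>
  · have := h e he
    omega

/-! ### The integrations by parts preserve well-formedness -/

theorem mem_edges_of_mem_neighbors {T : Forest} {i k : ℕ} (h : k ∈ T.neighbors i) :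
    (i, k) ∈ T.edges ∨ (k, i) ∈ T.edges := by
  simp only [Forest.neighbors, List.mem_filterMap] at h
  obtain ⟨e, he, h⟩ := h
  split_ifs at h with h1 h2
  · obtain rfl := h1
    simp only [Option.some.injEq] at h
    obtain rfl := h
    exact Or.inl he
  · obtain rfl := h2
    simp only [Option.some.injEq] at h
    obtain rfl := h
    exact Or.inr he

theorem Term.WellFormed.of_mem_offDiagStep {K d : ℕ} {σ τ : Term} (hτ : τ.WellFormed)
    (hσ : σ ∈ τ.offDiagStep K d) : σ.WellFormed := by
  refine of_mem_taylorTerms (freshEdges_pendantEdges (s := 0) hτ.edges_lt) (fun e he => ?_)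
    (fun e he => ?_) (fun e he => ?_) hσ
  · have := bounds_of_mem_pendantEdges (s := 0) hτ.edges_lt e he
    simp only [Forest.fullSwitch]
    omega
  · have := bounds_of_mem_switchingFrom (s := 0) hτ.edges_lt e he
    simp only [Forest.fullSwitch]
    omega
  · have := hτ.entries_lt e he
    simp only [Forest.fullSwitch]
    omega

theorem Term.WellFormed.of_mem_diagStep {K d i : ℕ} {σ τ : Term} (hτ : τ.WellFormed)
    (hi : (i, i) ∈ τ.entries) (hσ : σ ∈ τ.diagStep K d i) : σ.WellFormed := by
  have hi' := (hτ.entries_lt _ hi).1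
  simp only at hi'
  have hes : ∀ e ∈ τ.entries.erase (i, i), e.1 < τ.forest.size ∧ e.2 < τ.forest.size :=
    fun e he => hτ.entries_lt e (List.mem_of_mem_erase he)
  simp only [diagStep, List.mem_cons, List.mem_append] at hσ
  rcases hσ with rfl | rfl | (hσ | hσ) | hσ
  · exact ⟨hτ.fresh, hτ.edges_lt, hes⟩
  · exact ⟨hτ.fresh, hτ.edges_lt, hτ.entries_lt⟩
  · simp only [diagStepNeighbors, List.mem_map] at hσ
    obtain ⟨k, hk, rfl⟩ := hσ
    refine ⟨hτ.fresh, hτ.edges_lt, ?_⟩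
    simp only [List.mem_cons, forall_eq_or_imp]
    refine ⟨⟨hi', ?_⟩, hes⟩
    rcases mem_edges_of_mem_neighbors hk with h | h
    · exact (hτ.edges_lt _ h).2
    · exact (hτ.edges_lt _ h).1
  · refine of_mem_taylorTerms ?_ ?_ ?_ ?_ (List.mem_filter.1 hσ).1
    · exact freshEdges_cons_cons hτ.fresh hτ.edges_lt (by omega) (by omega) (by omega) (by omega)
        (by omega) (by omega)
    · simp only [List.mem_cons, forall_eq_or_imp]
      exact ⟨by omega, by omega, fun e he => by have := hτ.edges_lt e he; omega⟩
    · exact lt_of_mem_switching (by simp) (by simp) (by simp) (by simp)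
    · simp only [List.mem_cons, forall_eq_or_imp]
      exact ⟨by omega, by omega, fun e he => by have := hes e he; omega⟩
  · refine of_mem_taylorTerms ?_ ?_ ?_ ?_ (List.mem_filter.1 hσ).1
    · exact freshEdges_cons_cons hτ.fresh hτ.edges_lt (by omega) (by omega) (by omega) (by omega)
        (by omega) (by omega)
    · simp only [List.mem_cons, forall_eq_or_imp]
      exact ⟨by omega, by omega, fun e he => by have := hτ.edges_lt e he; omega⟩
    · exact lt_of_mem_switching (by simp only; omega) (by simp) (by simp) (by simp)
    · simp only [List.mem_cons, forall_eq_or_imp]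
      exact ⟨by omega, fun e he => by have := hes e he; omega⟩

theorem Term.WellFormed.of_mem_initialTerms {K d : ℕ} {σ : Term} (hσ : σ ∈ initialTerms K d) :
    σ.WellFormed := by
  refine of_mem_taylorTerms ?_ ?_ ?_ ?_ (List.mem_filter.1 hσ).1
  · simp [FreshEdges]
  · simp
  · exact lt_of_mem_switching (by simp) (by simp) (by simp) (by simp)
  · simp

/-- Some expansion of a list of well-formed terms terminates, since `Term.rank` decreases. -/
theorem exists_expands (K d : ℕ) (L : List Term) (hL : ∀ τ ∈ L, τ.WellFormed) :
    ∃ S, Expands K d L S := by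
  have key : ∀ τ : Term, τ.WellFormed → ∀ L : List Term, (∃ S, Expands K d L S) →
      ∃ S, Expands K d (τ :: L) S := by
    intro τ
    induction τ using (InvImage.wf (Term.rank K) wellFounded_lt).induction with
    | _ τ ih =>
    intro hτ L hL
    have append : ∀ X : List Term, (∀ σ ∈ X, σ.rank K < τ.rank K ∧ σ.WellFormed) →
        ∃ S, Expands K d (X ++ L) S := by
      intro X hX
      induction X with
      | nil => exact hL
      | cons σ X ihX =>
        simp only [List.mem_cons, forall_eq_or_imp] at hX
        exact ih σ hX.1.1 hX.1.2 _ (ihX hX.2)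
    obtain ⟨S, hS⟩ := hL
    by_cases h : K ≤ τ.order + τ.offDiagCount
    · exact ⟨S, .discard h hS⟩
    by_cases hc : τ.HasCrossEntry
    · exact ⟨S, .cross hc hS⟩
    rw [not_le] at h
    have hK : τ.order < K := by omega
    rcases Nat.eq_zero_or_pos τ.offDiagCount with ho | ho
    · rcases he : τ.entries with _ | ⟨e, es⟩
      · exact ⟨_, .done h he hS⟩
      · have hmem : e ∈ τ.entries := by simp [he]
        have hdiag : e.1 = e.2 := by
          have := List.countP_eq_zero.1 ho e hmem
          simpa using this
        obtain ⟨i, j⟩ := e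
        simp only at hdiag
        subst hdiag
        obtain ⟨S', hS'⟩ := append (τ.diagStep K d i) fun σ hσ =>
          ⟨Term.rank_lt_of_mem_diagStep hK ho hmem hτ.entries_lt hσ, hτ.of_mem_diagStep hmem hσ⟩
        exact ⟨S', .diag i h ho hmem hS'⟩
    · obtain ⟨S', hS'⟩ := append (τ.offDiagStep K d) fun σ hσ =>
        ⟨Term.rank_lt_of_mem_offDiagStep hK hσ, hτ.of_mem_offDiagStep hσ⟩
      exact ⟨S', .offDiag h hc ho hS'⟩
  induction L with
  | nil => exact ⟨0, .nil⟩
  | cons τ L ih =>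
    simp only [List.mem_cons, forall_eq_or_imp] at hL
    exact key τ hL.1 L (ih hL.2)

/-! ### The Green's function of the infinite tree -/

/-- The parameters of the infinite `d`-regular tree, at the spectral parameter `z = -s - 1/s`:
`t = (d-1)^{-1/2}`, `s` is the diagonal Green's function at the root of the tree
in which the root has degree `d - 1`, and `u = s / (1 - t² s²)` is the diagonal Green's function of
the `d`-regular tree itself. -/
structure TreeParams (t : ℝ) (s u : ℂ) : Prop where
  pos : 0 < t
  sq_le : t ^ 2 ≤ 1 / 2
  ne_zero : s ≠ 0
  norm_le : ‖s‖ ≤ 1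
  mul_eq : u * (1 - t ^ 2 * s ^ 2) = s

namespace TreeParams

variable {t : ℝ} {s u : ℂ}

theorem le_one (h : TreeParams t s u) : t ≤ 1 := by
  have := h.sq_le
  nlinarith [h.pos]

theorem diag_ne_zero (h : TreeParams t s u) : u ≠ 0 := by
  rintro rfl
  exact h.ne_zero (by simpa using h.mul_eq.symm)

theorem inv_eq (h : TreeParams t s u) : u⁻¹ = s⁻¹ - t ^ 2 * s := by
  have h1 := h.mul_eq
  have h2 := h.ne_zero
  have h3 := h.diag_ne_zero
  field_simp
  linear_combination -h1

theorem norm_diag_le (h : TreeParams t s u) : ‖u‖ ≤ 2 := by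
  have h1 : ‖((t : ℂ) ^ 2 * s ^ 2)‖ ≤ 1 / 2 := by
    rw [norm_mul, norm_pow, norm_pow, Complex.norm_real, Real.norm_eq_abs, sq_abs]
    have := pow_le_one₀ (norm_nonneg s) h.norm_le (n := 2)
    nlinarith [h.sq_le, sq_nonneg t, sq_nonneg ‖s‖]
  have h2 : 1 / 2 ≤ ‖1 - (t : ℂ) ^ 2 * s ^ 2‖ := by
    have := norm_sub_norm_le (1 : ℂ) ((t : ℂ) ^ 2 * s ^ 2)
    rw [norm_one] at this
    linarith
  have h3 : ‖u‖ * ‖1 - (t : ℂ) ^ 2 * s ^ 2‖ = ‖s‖ := by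
    rw [← norm_mul, h.mul_eq]
  nlinarith [h.norm_le, norm_nonneg u]

theorem norm_mul_le (h : TreeParams t s u) : ‖(t : ℂ) * s‖ ≤ t := by
  rw [norm_mul, Complex.norm_real, Real.norm_of_nonneg h.pos.le]
  exact mul_le_of_le_one_right h.pos.le h.norm_le

end TreeParams

/-- The Green's function of the infinite `d`-regular trees into which the components of a forest are
embedded, one tree for each component: it is `u (-t s)^n` at two vertices at distance `n` in the
forest, and zero at vertices of different components.  It is defined by recursion over the edges,
where `(a, b)` attaches the leaf `b` at `a`. -/
def treeGreen (t s u : ℂ) : List (ℕ × ℕ) → ℕ → ℕ → ℂ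
  | [], x, y => if x = y then u else 0
  | (a, b) :: es, x, y =>
    if x = b then if y = b then u else -(t * s) * treeGreen t s u es a y
    else if y = b then -(t * s) * treeGreen t s u es x a
    else treeGreen t s u es x y

section treeGreen

variable {t s u : ℂ}

theorem treeGreen_self (es : List (ℕ × ℕ)) (x : ℕ) : treeGreen t s u es x x = u := by
  induction es with
  | nil => simp [treeGreen]
  | cons e es ih =>
    obtain ⟨a, b⟩ := e
    by_cases hx : x = b <;> simp [treeGreen, hx, ih]

theorem treeGreen_cons_of_ne {a b x y : ℕ} (es : List (ℕ × ℕ)) (hx : x ≠ b) (hy : y ≠ b) :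
    treeGreen t s u ((a, b) :: es) x y = treeGreen t s u es x y := by
  simp [treeGreen, hx, hy]

theorem treeGreen_append_of_lt {fs es : List (ℕ × ℕ)} {m x y : ℕ} (h : ∀ e ∈ fs, m ≤ e.2)
    (hx : x < m) (hy : y < m) : treeGreen t s u (fs ++ es) x y = treeGreen t s u es x y := by
  induction fs with
  | nil => rfl
  | cons e fs ih =>
    obtain ⟨a, b⟩ := e
    simp only [List.mem_cons, forall_eq_or_imp] at h
    rw [List.cons_append, treeGreen_cons_of_ne _ (by omega) (by omega), ih h.2]

theorem treeGreen_eq_zero_of_lt {es : List (ℕ × ℕ)} {m x y : ℕ} (h : ∀ e ∈ es, m ≤ e.2)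
    (hx : x < m) (hy : y < m) (hxy : x ≠ y) : treeGreen t s u es x y = 0 := by
  have := treeGreen_append_of_lt (t := t) (s := s) (u := u) (es := []) h hx hy
  rw [List.append_nil] at this
  simp [this, treeGreen, hxy]

theorem treeGreen_eq_zero_of_fresh {es : List (ℕ × ℕ)} {x y : ℕ}
    (h : ∀ e ∈ es, e.1 ≠ x ∧ e.2 ≠ x) (hxy : x ≠ y) : treeGreen t s u es x y = 0 := by
  induction es generalizing y with
  | nil => simp [treeGreen, hxy]
  | cons e es ih =>
    obtain ⟨a, b⟩ := e
    simp only [List.mem_cons, forall_eq_or_imp] at h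
    rw [treeGreen, if_neg h.1.2.symm]
    split_ifs with hy
    · rw [ih h.2 h.1.1.symm, mul_zero]
    · exact ih h.2 hxy

theorem treeGreen_comm (es : List (ℕ × ℕ)) (x y : ℕ) :
    treeGreen t s u es x y = treeGreen t s u es y x := by
  induction es generalizing x y with
  | nil => simp [treeGreen, eq_comm]
  | cons e es ih =>
    obtain ⟨a, b⟩ := e
    simp only [treeGreen]
    split_ifs <;> first | rfl | rw [ih]

theorem treeGreen_of_mem {es : List (ℕ × ℕ)} (hf : FreshEdges es) {a b : ℕ} (h : (a, b) ∈ es) :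
    treeGreen t s u es a b = -(t * s) * u := by
  induction es with
  | nil => simp at h
  | cons e es ih =>
    obtain ⟨c, e⟩ := e
    rw [freshEdges_cons] at hf
    rcases List.mem_cons.1 h with h | h
    · simp only [Prod.mk.injEq] at h
      obtain ⟨rfl, rfl⟩ := h
      simp [treeGreen, hf.1, treeGreen_self]
    · have := hf.2.1 _ h
      rw [treeGreen_cons_of_ne _ this.1 this.2, ih hf.2.2 h]

theorem reachable_of_treeGreen_ne_zero {n : ℕ} {es : List (ℕ × ℕ)} {x y : ℕ}
    (h : treeGreen t s u es x y ≠ 0) : (Forest.mk n es).graph.Reachable x y := by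
  induction es generalizing x y with
  | nil =>
    have : x = y := by
      by_contra hxy
      simp [treeGreen, hxy] at h
    subst this
    rfl
  | cons e es ih =>
    obtain ⟨a, b⟩ := e
    have hle : (Forest.mk n es).graph ≤ (Forest.mk n ((a, b) :: es)).graph := by
      intro v w hvw
      simp only [Forest.graph, SimpleGraph.fromRel_adj, List.mem_cons] at hvw ⊢
      tauto
    have hab : (Forest.mk n ((a, b) :: es)).graph.Reachable a b := by
      by_cases hab : a = b
      · subst hab
        rfl
      · refine SimpleGraph.Adj.reachable ?_
        simp [Forest.graph, SimpleGraph.fromRel_adj, hab]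
    simp only [treeGreen] at h
    split_ifs at h with hx hy hy
    · subst hx hy
      rfl
    · subst hx
      exact hab.symm.trans ((ih (right_ne_zero_of_mul h)).mono hle)
    · subst hy
      exact ((ih (right_ne_zero_of_mul h)).mono hle).trans hab
    · exact (ih h).mono hle

end treeGreen

theorem TreeParams.norm_treeGreen_le {t : ℝ} {s u : ℂ} (h : TreeParams t s u)
    (es : List (ℕ × ℕ)) (x y : ℕ) : ‖treeGreen t s u es x y‖ ≤ 2 := by
  have h1 : ‖-((t : ℂ) * s)‖ ≤ 1 := by
    rw [norm_neg]
    exact h.norm_mul_le.trans h.le_one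
  induction es generalizing x y with
  | nil =>
    simp only [treeGreen]
    split_ifs
    · exact h.norm_diag_le
    · simp
  | cons e es ih =>
    obtain ⟨a, b⟩ := e
    simp only [treeGreen]
    split_ifs
    · exact h.norm_diag_le
    · rw [norm_mul]
      nlinarith [ih a y, norm_nonneg (treeGreen t s u es a y)]
    · rw [norm_mul]
      nlinarith [ih x a, norm_nonneg (treeGreen t s u es x a)]
    · exact ih x y

theorem TreeParams.norm_treeGreen_le_of_ne {t : ℝ} {s u : ℂ} (h : TreeParams t s u)
    (es : List (ℕ × ℕ)) {x y : ℕ} (hxy : x ≠ y) : ‖treeGreen t s u es x y‖ ≤ 2 * t := by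
  have h1 : ‖-((t : ℂ) * s)‖ ≤ t := by
    rw [norm_neg]
    exact h.norm_mul_le
  induction es with
  | nil =>
    simp only [treeGreen, if_neg hxy, norm_zero]
    linarith [h.pos]
  | cons e es ih =>
    obtain ⟨a, b⟩ := e
    simp only [treeGreen]
    split_ifs with hx hy
    · exact absurd (hx.trans hy.symm) hxy
    · rw [norm_mul]
      nlinarith [h.norm_treeGreen_le es a y, norm_nonneg (treeGreen t s u es a y), h.pos]
    · rw [norm_mul]
      nlinarith [h.norm_treeGreen_le es x a, norm_nonneg (treeGreen t s u es x a), h.pos]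
    · exact ih

/-! ### The resolvent identity for a switching -/

/-- The contribution of the edge `{a, b}` to `H - z` after the vertices outside of the forest
have been eliminated by the Schur complement formula: the off-diagonal entry `t` of the edge, and
`t² s` on the diagonal, since the edge takes the place of one of the eliminated subtrees. -/
def edgeOp (t s : ℂ) (e : ℕ × ℕ) : (ℕ → ℂ) →ₗ[ℂ] (ℕ → ℂ) where
  toFun f x := (if x = e.1 then t * f e.2 + t ^ 2 * s * f e.1 else 0) +
    (if x = e.2 then t * f e.1 + t ^ 2 * s * f e.2 else 0)
  map_add' f g := by
    ext x
    simp only [Pi.add_apply]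
    split_ifs <;> ring
  map_smul' c f := by
    ext x
    simp only [Pi.smul_apply, smul_eq_mul, RingHom.id_apply]
    split_ifs <;> ring

/-- The inverse of `treeGreen`: the Schur complement of `H - z` onto the vertices of the forest. -/
def schurOp (t s u : ℂ) (es : List (ℕ × ℕ)) : (ℕ → ℂ) →ₗ[ℂ] (ℕ → ℂ) :=
  u⁻¹ • LinearMap.id + (es.map (edgeOp t s)).sum

section schurOp

variable {t s u : ℂ}

theorem edgeOp_apply (e : ℕ × ℕ) (f : ℕ → ℂ) (x : ℕ) :
    edgeOp t s e f x = (if x = e.1 then t * f e.2 + t ^ 2 * s * f e.1 else 0) +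
      (if x = e.2 then t * f e.1 + t ^ 2 * s * f e.2 else 0) := rfl

theorem schurOp_nil (f : ℕ → ℂ) (x : ℕ) : schurOp t s u [] f x = u⁻¹ * f x := by
  simp [schurOp]

theorem schurOp_cons (e : ℕ × ℕ) (es : List (ℕ × ℕ)) (f : ℕ → ℂ) (x : ℕ) :
    schurOp t s u (e :: es) f x = edgeOp t s e f x + schurOp t s u es f x := by
  simp only [schurOp, List.map_cons, List.sum_cons, LinearMap.add_apply, Pi.add_apply]
  ring

theorem schurOp_apply_of_fresh {es : List (ℕ × ℕ)} {x : ℕ} (h : ∀ e ∈ es, e.1 ≠ x ∧ e.2 ≠ x)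
    (f : ℕ → ℂ) : schurOp t s u es f x = u⁻¹ * f x := by
  induction es with
  | nil => exact schurOp_nil f x
  | cons e es ih =>
    simp only [List.mem_cons, forall_eq_or_imp] at h
    rw [schurOp_cons, ih h.2, edgeOp_apply, if_neg h.1.1.symm, if_neg h.1.2.symm]
    ring

theorem schurOp_congr {es : List (ℕ × ℕ)} {f g : ℕ → ℂ} {x : ℕ}
    (h : ∀ e ∈ es, f e.1 = g e.1 ∧ f e.2 = g e.2) (hx : f x = g x) :
    schurOp t s u es f x = schurOp t s u es g x := by
  induction es with
  | nil => rw [schurOp_nil, schurOp_nil, hx]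
  | cons e es ih =>
    simp only [List.mem_cons, forall_eq_or_imp] at h
    rw [schurOp_cons, schurOp_cons, ih h.2, edgeOp_apply, edgeOp_apply, h.1.1, h.1.2]

end schurOp

section resolvent

variable {t : ℝ} {s u : ℂ}

theorem schurOp_treeGreen (h : TreeParams t s u) {es : List (ℕ × ℕ)} (hf : FreshEdges es)
    (x y : ℕ) :
    schurOp t s u es (fun v => treeGreen t s u es v y) x = if x = y then 1 else 0 := by
  have hu := h.inv_eq
  have hs := h.ne_zero
  have hu0 := h.diag_ne_zero
  have hss : s⁻¹ * s = 1 := inv_mul_cancel₀ hs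
  have huu : u⁻¹ * u = 1 := inv_mul_cancel₀ hu0
  induction es generalizing x y with
  | nil =>
    rw [schurOp_nil]
    simp only [treeGreen]
    split_ifs
    · exact huu
    · simp
  | cons e es ih =>
    obtain ⟨a, b⟩ := e
    rw [freshEdges_cons] at hf
    obtain ⟨hab, hb, hf⟩ := hf
    rw [schurOp_cons, edgeOp_apply]
    simp only
    by_cases hy : y = b
    · subst hy
      have hby : ∀ v, v ≠ y → treeGreen t s u ((a, y) :: es) v y =
          -(t * s) * treeGreen t s u es v a := fun v hv => by simp [treeGreen, hv]
      rw [hby a hab, treeGreen_self, treeGreen_self]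
      by_cases hx : x = y
      · subst hx
        rw [schurOp_apply_of_fresh hb, if_neg hab.symm, if_pos rfl, if_pos rfl, treeGreen_self]
        linear_combination huu
      · rw [schurOp_congr (f := fun v => treeGreen t s u ((a, y) :: es) v y)
          (g := -((t : ℂ) * s) • fun v => treeGreen t s u es v a)
          (fun e he => ⟨hby _ (hb e he).1, hby _ (hb e he).2⟩) (hby _ hx), map_smul, Pi.smul_apply,
          ih hf, if_neg hx, if_neg hx, smul_eq_mul]
        split_ifs
        · linear_combination (t : ℂ) * h.mul_eq
        · ring
    · have hby : ∀ v, v ≠ b → treeGreen t s u ((a, b) :: es) v y =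
          treeGreen t s u es v y := fun v hv => by simp [treeGreen, hv, hy]
      have hbb : treeGreen t s u ((a, b) :: es) b y = -(t * s) * treeGreen t s u es a y := by
        simp [treeGreen, hy]
      rw [hby a hab, hbb]
      by_cases hx : x = b
      · subst hx
        rw [schurOp_apply_of_fresh hb, if_neg hab.symm, if_pos rfl, if_neg (Ne.symm hy), hbb, hu]
        linear_combination (-(t : ℂ) * treeGreen t s u es a y) * hss
      · rw [schurOp_congr (f := fun v => treeGreen t s u ((a, b) :: es) v y)
          (g := fun v => treeGreen t s u es v y)
          (fun e he => ⟨hby _ (hb e he).1, hby _ (hb e he).2⟩) (hby _ hx), ih hf, if_neg hx]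
        split_ifs <;> ring

theorem eq_zero_of_schurOp_eq_zero (h : TreeParams t s u) {es : List (ℕ × ℕ)}
    (hf : FreshEdges es) {f : ℕ → ℂ} (hS : ∀ x, schurOp t s u es f x = 0) : ∀ x, f x = 0 := by
  have hu := h.inv_eq
  have hs := h.ne_zero
  have hu0 := h.diag_ne_zero
  have hss : s⁻¹ * s = 1 := inv_mul_cancel₀ hs
  induction es generalizing f with
  | nil =>
    intro x
    have := hS x
    rw [schurOp_nil] at this
    simpa [hu0] using this
  | cons e es ih =>
    obtain ⟨a, b⟩ := e
    rw [freshEdges_cons] at hf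
    obtain ⟨hab, hb, hf⟩ := hf
    -- the equation at the leaf `b` determines `f b`, and the others reduce to the smaller forest
    have hfb : f b = -(t * s) * f a := by
      have := hS b
      rw [schurOp_cons, edgeOp_apply, schurOp_apply_of_fresh hb] at this
      simp only [if_neg hab.symm, if_true, hu] at this
      linear_combination s * this - f b * hss
    have hz := ih hf (f := Function.update f b 0) fun x => by
      by_cases hx : x = b
      · subst hx
        rw [schurOp_apply_of_fresh hb]
        simp
      · rw [schurOp_congr (g := f)
          (fun e he => ⟨by simp [(hb e he).1], by simp [(hb e he).2]⟩) (by simp [hx])]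
        have := hS x
        rw [schurOp_cons, edgeOp_apply] at this
        simp only [if_neg hx, hfb] at this
        rw [← this]
        split_ifs <;> ring
    have hz' : ∀ x, x ≠ b → f x = 0 := fun x hx => by simpa [hx] using hz x
    intro x
    by_cases hx : x = b
    · rw [hx, hfb, hz' a hab, mul_zero]
    · exact hz' x hx

/-- The action of the matrix with the entries `ξ`. -/
def entryOp (ξ : List (ℤ × ℕ × ℕ)) (f : ℕ → ℂ) (x : ℕ) : ℂ :=
  (ξ.map fun e => if x = e.2.1 then (e.1 : ℂ) * f e.2.2 else 0).sum

/-- `G' = (G⁻¹ + t ξ)⁻¹` satisfies the resolvent identity `G' = G - t G ξ G'`. -/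
theorem treeGreen_resolvent (h : TreeParams t s u) {es es' : List (ℕ × ℕ)}
    {ξ : List (ℤ × ℕ × ℕ)} (hf : FreshEdges es) (hf' : FreshEdges es')
    (hξ : ∀ f x, schurOp t s u es' f x = schurOp t s u es f x + t * entryOp ξ f x) (x y : ℕ) :
    treeGreen t s u es' x y = treeGreen t s u es x y - t * (ξ.map fun e =>
      (e.1 : ℂ) * treeGreen t s u es x e.2.1 * treeGreen t s u es' e.2.2 y).sum := by
  set g' : ℕ → ℂ := fun v => treeGreen t s u es' v y
  set F : ℕ → ℂ := g' - (fun v => treeGreen t s u es v y) +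
    (t : ℂ) • (ξ.map fun e => ((e.1 : ℂ) * g' e.2.2) • fun v => treeGreen t s u es v e.2.1).sum
    with hF
  have hsum : ∀ (l : List (ℤ × ℕ × ℕ)) (v : ℕ),
      schurOp t s u es (l.map fun e => ((e.1 : ℂ) * g' e.2.2) •
        fun v => treeGreen t s u es v e.2.1).sum v = entryOp l g' v := by
    intro l v
    induction l with
    | nil => simp [entryOp]
    | cons e l ih =>
      simp only [entryOp, List.map_cons, List.sum_cons] at ih ⊢
      rw [map_add, Pi.add_apply, ih, map_smul, Pi.smul_apply, schurOp_treeGreen h hf, smul_eq_mul]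
      simp
  have hzero := eq_zero_of_schurOp_eq_zero h hf (f := F) fun v => by
    have h1 := hξ g' v
    rw [schurOp_treeGreen h hf'] at h1
    rw [hF, map_add, map_sub, map_smul, Pi.add_apply, Pi.sub_apply, Pi.smul_apply, hsum,
      schurOp_treeGreen h hf, smul_eq_mul, h1]
    ring
  have hx := hzero x
  have hs : ∀ l : List (ℤ × ℕ × ℕ), (l.map fun e => ((e.1 : ℂ) * g' e.2.2) •
      fun v => treeGreen t s u es v e.2.1).sum x = (l.map fun e =>
      (e.1 : ℂ) * treeGreen t s u es x e.2.1 * treeGreen t s u es' e.2.2 y).sum := by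
    intro l
    induction l with
    | nil => simp
    | cons e l ih =>
      simp only [List.map_cons, List.sum_cons, Pi.add_apply, ih, Pi.smul_apply, smul_eq_mul, g']
      ring
  simp only [hF, Pi.add_apply, Pi.sub_apply, Pi.smul_apply, smul_eq_mul, hs, g'] at hx
  linear_combination hx

end resolvent

theorem schurOp_switching (t s u : ℂ) (a b j k : ℕ) (es : List (ℕ × ℕ)) (f : ℕ → ℂ) (x : ℕ) :
    schurOp t s u ((a, b) :: (j, k) :: es) f x =
      schurOp t s u ((a, j) :: (b, k) :: es) f x + t * entryOp (switching a b j k) f x := by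
  obtain ⟨δ, hδ⟩ : ∃ δ : ℕ → ℂ, ∀ y c, (if x = y then c else 0) = δ y * c :=
    ⟨fun y => if x = y then 1 else 0, fun y c => by by_cases h : x = y <;> simp [h]⟩
  simp only [schurOp_cons, edgeOp_apply, entryOp, switching, List.map_cons, List.map_nil,
    List.sum_cons, List.sum_nil]
  simp only [hδ]
  push_cast
  ring

theorem entryOp_append (ξ η : List (ℤ × ℕ × ℕ)) (f : ℕ → ℂ) (x : ℕ) :
    entryOp (ξ ++ η) f x = entryOp ξ f x + entryOp η f x := by
  simp [entryOp]

theorem schurOp_append (t s u : ℂ) (es fs : List (ℕ × ℕ)) (f : ℕ → ℂ) (x : ℕ) :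
    schurOp t s u (es ++ fs) f x =
      (es.map fun e => edgeOp t s e f x).sum + schurOp t s u fs f x := by
  induction es with
  | nil => simp
  | cons e es ih => rw [List.cons_append, schurOp_cons, ih, List.map_cons, List.sum_cons, add_assoc]

theorem schurOp_switchingFrom (t s u : ℂ) (m k : ℕ) (es : List (ℕ × ℕ)) (f : ℕ → ℂ) (x : ℕ) :
    schurOp t s u (pairEdges m k es ++ es) f x =
      schurOp t s u (pendantEdges m k es) f x + t * entryOp (switchingFrom m k es) f x := by
  induction es generalizing k with
  | nil => simp [pairEdges, pendantEdges, switchingFrom, entryOp]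
  | cons e es ih =>
    obtain ⟨a, b⟩ := e
    have h1 := ih (k + 1)
    have h2 := schurOp_switching t s u a b (m + 2 * k) (m + 2 * k + 1) [] f x
    rw [schurOp_append] at h1
    simp only [schurOp_cons, schurOp_nil] at h2
    rw [pairEdges_cons, pendantEdges_cons, switchingFrom_cons, entryOp_append, List.cons_append,
      schurOp_cons, schurOp_append, schurOp_cons, schurOp_cons, schurOp_cons]
    linear_combination h1 + h2

/-! ### Taylor expansion with remainder -/

/-- The product of the entries `es` of `g`. -/
def entryProd (g : ℕ → ℕ → ℂ) (es : List (ℕ × ℕ)) : ℂ :=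
  (es.map fun e => g e.1 e.2).prod

/-- The value of a list of monomials with coefficients in the entries of `g`. -/
def monoSum (g : ℕ → ℕ → ℂ) (l : List (ℤ × List (ℕ × ℕ))) : ℂ :=
  (l.map fun p => (p.1 : ℂ) * entryProd g p.2).sum

theorem entryProd_cons (g : ℕ → ℕ → ℂ) (e : ℕ × ℕ) (es : List (ℕ × ℕ)) :
    entryProd g (e :: es) = g e.1 e.2 * entryProd g es := by
  simp [entryProd]

theorem entryProd_append (g : ℕ → ℕ → ℂ) (es fs : List (ℕ × ℕ)) :
    entryProd g (es ++ fs) = entryProd g es * entryProd g fs := by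
  simp [entryProd]

theorem entryProd_congr {g g' : ℕ → ℕ → ℂ} {es : List (ℕ × ℕ)}
    (h : ∀ e ∈ es, g e.1 e.2 = g' e.1 e.2) : entryProd g es = entryProd g' es := by
  rw [entryProd, entryProd, List.map_congr_left h]

theorem norm_entryProd_le {g : ℕ → ℕ → ℂ} (hg : ∀ x y, ‖g x y‖ ≤ 2) (es : List (ℕ × ℕ)) :
    ‖entryProd g es‖ ≤ 2 ^ es.length := by
  induction es with
  | nil => simp [entryProd]
  | cons e es ih =>
    rw [entryProd_cons, norm_mul, List.length_cons, pow_succ']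
    exact mul_le_mul (hg _ _) ih (norm_nonneg _) (by norm_num)

theorem monoSum_append (g : ℕ → ℕ → ℂ) (l l' : List (ℤ × List (ℕ × ℕ))) :
    monoSum g (l ++ l') = monoSum g l + monoSum g l' := by
  simp [monoSum]

theorem monoSum_flatMap {α : Type*} (g : ℕ → ℕ → ℂ) (l : List α)
    (f : α → List (ℤ × List (ℕ × ℕ))) :
    monoSum g (l.flatMap f) = (l.map fun a => monoSum g (f a)).sum := by
  induction l with
  | nil => simp [monoSum]
  | cons a l ih => rw [List.flatMap_cons, monoSum_append, ih, List.map_cons, List.sum_cons]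

theorem sum_map_range_eq (f : ℕ → ℂ) (n : ℕ) :
    ((List.range n).map f).sum = ∑ i ∈ Finset.range n, f i := by
  induction n with
  | zero => simp
  | succ n ih => rw [List.range_succ, List.map_append, List.sum_append, ih,
      Finset.sum_range_succ]; simp

theorem norm_sum_map_le {α : Type*} {l : List α} {f : α → ℂ} {B : ℝ} (h : ∀ a ∈ l, ‖f a‖ ≤ B) :
    ‖(l.map f).sum‖ ≤ l.length * B := by
  induction l with
  | nil => simp
  | cons a l ih =>
    simp only [List.mem_cons, forall_eq_or_imp] at h
    rw [List.map_cons, List.sum_cons, List.length_cons]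
    push_cast
    have := norm_add_le (f a) (l.map f).sum
    linarith [ih h.2, h.1]

theorem monoSum_expandEntry_succ (g : ℕ → ℕ → ℂ) (ξ : List (ℤ × ℕ × ℕ)) (n x y : ℕ) :
    monoSum g (expandEntry ξ (n + 1) x y) = -(ξ.map fun e =>
      (e.1 : ℂ) * g x e.2.1 * monoSum g (expandEntry ξ n e.2.2 y)).sum := by
  rw [expandEntry, monoSum_flatMap, ← neg_one_mul, ← List.sum_map_mul_left]
  congr 1
  refine List.map_congr_left fun e _ => ?_
  simp only [monoSum, List.map_map, Function.comp_def, entryProd_cons]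
  rw [← mul_assoc, ← List.sum_map_mul_left]
  congr 1
  refine List.map_congr_left fun p _ => ?_
  push_cast
  ring

theorem monoSum_expandEntries_cons (g : ℕ → ℕ → ℂ) (ξ : List (ℤ × ℕ × ℕ)) (n : ℕ) (e : ℕ × ℕ)
    (es : List (ℕ × ℕ)) :
    monoSum g (expandEntries ξ n (e :: es)) = ∑ k ∈ Finset.range (n + 1),
      monoSum g (expandEntry ξ k e.1 e.2) * monoSum g (expandEntries ξ (n - k) es) := by
  rw [expandEntries, monoSum_flatMap, sum_map_range_eq]
  refine Finset.sum_congr rfl fun k _ => ?_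
  rw [monoSum_flatMap]
  conv_rhs => rw [monoSum]
  rw [← List.sum_map_mul_right]
  congr 1
  refine List.map_congr_left fun p _ => ?_
  simp only [monoSum, List.map_map, Function.comp_def, entryProd_append]
  rw [← List.sum_map_mul_left]
  congr 1
  refine List.map_congr_left fun q _ => ?_
  push_cast
  ring

theorem norm_monoSum_expandEntry_le {g : ℕ → ℕ → ℂ} (hg : ∀ x y, ‖g x y‖ ≤ 2)
    {ξ : List (ℤ × ℕ × ℕ)} (hξ : ∀ e ∈ ξ, |e.1| ≤ 1) (n x y : ℕ) :
    ‖monoSum g (expandEntry ξ n x y)‖ ≤ 2 * (2 * ξ.length) ^ n := by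
  induction n generalizing x with
  | zero => simpa [monoSum, expandEntry, entryProd] using hg x y
  | succ n ih =>
    rw [monoSum_expandEntry_succ, norm_neg]
    have := norm_sum_map_le (l := ξ) (f := fun e =>
      (e.1 : ℂ) * g x e.2.1 * monoSum g (expandEntry ξ n e.2.2 y))
      (B := 2 * (2 * (2 * ξ.length) ^ n)) fun e he => by
        rw [norm_mul, norm_mul, Complex.norm_intCast]
        have h1 : |(e.1 : ℝ)| ≤ 1 := by exact_mod_cast hξ e he
        refine mul_le_mul ?_ (ih _) (norm_nonneg _) (by norm_num)
        nlinarith [hg x e.2.1, norm_nonneg (g x e.2.1)]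
    refine this.trans (le_of_eq ?_)
    ring

theorem norm_sub_sum_expandEntry_le {g g' : ℕ → ℕ → ℂ} {t : ℝ} (ht : 0 ≤ t)
    (hg : ∀ x y, ‖g x y‖ ≤ 2) (hg' : ∀ x y, ‖g' x y‖ ≤ 2)
    {ξ : List (ℤ × ℕ × ℕ)} (hξ : ∀ e ∈ ξ, |e.1| ≤ 1)
    (hr : ∀ x y, g' x y = g x y - t * (ξ.map fun e =>
      (e.1 : ℂ) * g x e.2.1 * g' e.2.2 y).sum) (k x y : ℕ) :
    ‖g' x y - ∑ n ∈ Finset.range k, (t : ℂ) ^ n * monoSum g (expandEntry ξ n x y)‖ ≤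
      2 * (2 * ξ.length) ^ k * t ^ k := by
  induction k generalizing x with
  | zero => simpa using hg' x y
  | succ k ih =>
    have hstep : g' x y - ∑ n ∈ Finset.range (k + 1),
        (t : ℂ) ^ n * monoSum g (expandEntry ξ n x y) = -(t * (ξ.map fun e =>
        (e.1 : ℂ) * g x e.2.1 * (g' e.2.2 y - ∑ n ∈ Finset.range k,
          (t : ℂ) ^ n * monoSum g (expandEntry ξ n e.2.2 y))).sum) := by
      rw [Finset.sum_range_succ', hr x y]
      have h0 : monoSum g (expandEntry ξ 0 x y) = g x y := by
        simp [monoSum, expandEntry, entryProd]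
      have hs : ∀ l : List (ℤ × ℕ × ℕ), (l.map fun e =>
          (e.1 : ℂ) * g x e.2.1 * (g' e.2.2 y - ∑ n ∈ Finset.range k,
          (t : ℂ) ^ n * monoSum g (expandEntry ξ n e.2.2 y))).sum =
          (l.map fun e => (e.1 : ℂ) * g x e.2.1 * g' e.2.2 y).sum -
          ∑ n ∈ Finset.range k, (t : ℂ) ^ n * (l.map fun e =>
            (e.1 : ℂ) * g x e.2.1 * monoSum g (expandEntry ξ n e.2.2 y)).sum := by
        intro l
        induction l with
        | nil => simp
        | cons e l ih =>
          rw [List.map_cons, List.sum_cons, ih]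
          have : ∀ n, (t : ℂ) ^ n * ((e.1 : ℂ) * g x e.2.1 * monoSum g (expandEntry ξ n e.2.2 y)) =
            (e.1 : ℂ) * g x e.2.1 * ((t : ℂ) ^ n * monoSum g (expandEntry ξ n e.2.2 y)) :=
            fun n => by ring
          simp only [List.map_cons, List.sum_cons, mul_sub, mul_add, Finset.sum_add_distrib,
            Finset.mul_sum, this]
          ring
      have h1 : ∑ n ∈ Finset.range k, (t : ℂ) ^ (n + 1) *
          monoSum g (expandEntry ξ (n + 1) x y) = -(t * ∑ n ∈ Finset.range k, (t : ℂ) ^ n *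
          (ξ.map fun e => (e.1 : ℂ) * g x e.2.1 * monoSum g (expandEntry ξ n e.2.2 y)).sum) := by
        rw [Finset.mul_sum, ← Finset.sum_neg_distrib]
        refine Finset.sum_congr rfl fun n _ => ?_
        rw [monoSum_expandEntry_succ]
        ring
      rw [hs, h0, h1]
      ring
    rw [hstep, norm_neg, norm_mul, Complex.norm_real, Real.norm_of_nonneg ht]
    have := norm_sum_map_le (l := ξ) (f := fun e =>
      (e.1 : ℂ) * g x e.2.1 * (g' e.2.2 y - ∑ n ∈ Finset.range k,
          (t : ℂ) ^ n * monoSum g (expandEntry ξ n e.2.2 y)))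
      (B := 2 * (2 * (2 * ξ.length) ^ k * t ^ k)) fun e he => by
        rw [norm_mul, norm_mul, Complex.norm_intCast]
        have h1 : |(e.1 : ℝ)| ≤ 1 := by exact_mod_cast hξ e he
        refine mul_le_mul ?_ (ih _) (norm_nonneg _) (by norm_num)
        nlinarith [hg x e.2.1, norm_nonneg (g x e.2.1)]
    refine (mul_le_mul_of_nonneg_left this ht).trans (le_of_eq ?_)
    ring

/-- Taylor's formula for a product of Green's function entries, with a remainder that is uniform in
the Green's functions. -/
theorem exists_taylor_bound {ξ : List (ℤ × ℕ × ℕ)} (hξ : ∀ e ∈ ξ, |e.1| ≤ 1)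
    (es : List (ℕ × ℕ)) (k : ℕ) :
    ∃ C : ℝ, 0 ≤ C ∧ ∀ (t : ℝ) (g g' : ℕ → ℕ → ℂ), 0 ≤ t →
      (∀ x y, ‖g x y‖ ≤ 2) → (∀ x y, ‖g' x y‖ ≤ 2) →
      (∀ x y, g' x y = g x y - t * (ξ.map fun e => (e.1 : ℂ) * g x e.2.1 * g' e.2.2 y).sum) →
      ‖entryProd g' es - ∑ n ∈ Finset.range k, (t : ℂ) ^ n * monoSum g (expandEntries ξ n es)‖ ≤
        C * t ^ k := by
  induction es generalizing k with
  | nil =>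
    refine ⟨1, zero_le_one, fun t g g' ht hg hg' hr => ?_⟩
    rcases k with _ | k
    · simp [entryProd]
    · rw [Finset.sum_range_succ', Finset.sum_eq_zero]
      · simp only [entryProd, monoSum, expandEntries, List.map_nil, List.prod_nil, pow_zero,
          if_true, List.map_cons, List.sum_cons, List.sum_nil]
        simpa using pow_nonneg ht _
      · intro n _
        simp [expandEntries, monoSum]
  | cons e es ih =>
    choose C hC0 hC using ih
    refine ⟨2 * (2 * ξ.length) ^ k * 2 ^ es.length +
      ∑ j ∈ Finset.range k, 2 * (2 * ξ.length) ^ j * C (k - j), ?_,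
      fun t g g' ht hg hg' hr => ?_⟩
    · have : ∀ j ∈ Finset.range k, 0 ≤ 2 * (2 * (ξ.length : ℝ)) ^ j * C (k - j) :=
        fun j _ => mul_nonneg (by positivity) (hC0 _)
      have := Finset.sum_nonneg this
      positivity
    · have hconv : ∑ n ∈ Finset.range k, (t : ℂ) ^ n * monoSum g (expandEntries ξ n (e :: es)) =
          ∑ j ∈ Finset.range k, ((t : ℂ) ^ j * monoSum g (expandEntry ξ j e.1 e.2)) *
            ∑ n ∈ Finset.range (k - j), (t : ℂ) ^ n * monoSum g (expandEntries ξ n es) := by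
        simp only [Finset.mul_sum]
        rw [← Finset.sum_range_diag_flip k fun j n =>
          ((t : ℂ) ^ j * monoSum g (expandEntry ξ j e.1 e.2)) *
            ((t : ℂ) ^ n * monoSum g (expandEntries ξ n es))]
        refine Finset.sum_congr rfl fun n _ => ?_
        rw [monoSum_expandEntries_cons, Finset.mul_sum]
        refine Finset.sum_congr rfl fun j hj => ?_
        have hj' : j ≤ n := Nat.lt_succ_iff.1 (Finset.mem_range.1 hj)
        have : (t : ℂ) ^ n = (t : ℂ) ^ j * (t : ℂ) ^ (n - j) := by
          rw [← pow_add, Nat.add_sub_cancel' hj']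
        rw [this]
        ring
      have hsplit : entryProd g' (e :: es) - ∑ n ∈ Finset.range k,
          (t : ℂ) ^ n * monoSum g (expandEntries ξ n (e :: es)) =
          (g' e.1 e.2 - ∑ j ∈ Finset.range k, (t : ℂ) ^ j * monoSum g (expandEntry ξ j e.1 e.2)) *
            entryProd g' es +
          ∑ j ∈ Finset.range k, ((t : ℂ) ^ j * monoSum g (expandEntry ξ j e.1 e.2)) *
            (entryProd g' es - ∑ n ∈ Finset.range (k - j),
              (t : ℂ) ^ n * monoSum g (expandEntries ξ n es)) := by
        rw [hconv, entryProd_cons]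
        simp only [mul_sub, Finset.sum_sub_distrib, ← Finset.sum_mul]
        ring
      rw [hsplit]
      refine (norm_add_le _ _).trans ?_
      rw [add_mul]
      refine add_le_add ?_ ?_
      · rw [norm_mul]
        have h1 := norm_sub_sum_expandEntry_le ht hg hg' hξ hr k e.1 e.2
        have h2 := norm_entryProd_le hg' es
        refine (mul_le_mul h1 h2 (norm_nonneg _) (by positivity)).trans (le_of_eq ?_)
        ring
      · rw [Finset.sum_mul]
        refine norm_sum_le_of_le _ fun j hj => ?_
        have hj' : j ≤ k := (Finset.mem_range.1 hj).le
        have h1 := norm_monoSum_expandEntry_le hg hξ j e.1 e.2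
        have h2 := hC (k - j) t g g' ht hg hg' hr
        have h3 : t ^ k = t ^ j * t ^ (k - j) := by rw [← pow_add, Nat.add_sub_cancel' hj']
        rw [norm_mul, norm_mul, norm_pow, Complex.norm_real, Real.norm_of_nonneg ht]
        refine (mul_le_mul (mul_le_mul_of_nonneg_left h1 (pow_nonneg ht j)) h2 (norm_nonneg _)
          (by positivity)).trans (le_of_eq ?_)
        rw [h3]
        ring

/-! ### The value of a term on the infinite tree -/

/-- The normalization `(d-1)^{-1/2}` of the adjacency matrix. -/
def hop (d : ℕ) : ℝ := (Real.sqrt ((d : ℝ) - 1))⁻¹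

section hop

variable {d : ℕ}

theorem hop_pos (hd : 3 ≤ d) : 0 < hop d := by
  have : (3 : ℝ) ≤ d := by exact_mod_cast hd
  exact inv_pos.2 (Real.sqrt_pos.2 (by linarith))

theorem hop_sq (hd : 3 ≤ d) : hop d ^ 2 = ((d : ℝ) - 1)⁻¹ := by
  have : (3 : ℝ) ≤ d := by exact_mod_cast hd
  rw [hop, inv_pow, Real.sq_sqrt (by linarith)]

theorem hop_sq_le (hd : 3 ≤ d) : hop d ^ 2 ≤ 1 / 2 := by
  have : (3 : ℝ) ≤ d := by exact_mod_cast hd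
  rw [hop_sq hd, one_div]
  exact inv_anti₀ (by norm_num) (by linarith)

theorem natCast_eq_hop (hd : 3 ≤ d) : (d : ℝ) = (1 + hop d ^ 2) / hop d ^ 2 := by
  have : (3 : ℝ) ≤ d := by exact_mod_cast hd
  rw [hop_sq hd]
  have : (d : ℝ) - 1 ≠ 0 := by linarith
  field_simp
  ring

theorem div_sqrt_eq_hop (hd : 3 ≤ d) :
    (d : ℝ) / Real.sqrt ((d : ℝ) - 1) = (1 + hop d ^ 2) / hop d := by
  have h0 := (hop_pos hd).ne'
  rw [div_eq_mul_inv, ← hop, natCast_eq_hop hd]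
  field_simp

end hop

/-- The value of a term when the Green's function is that of the infinite tree, so that `m` is its
diagonal entry `u`. -/
def Term.value (t s u : ℂ) (τ : Term) : ℂ :=
  (τ.coef : ℂ) * u ^ τ.mPow * entryProd (treeGreen t s u τ.forest.edges) τ.entries

/-- The sum of the values of a list of terms. -/
def valueSum (t s u : ℂ) (L : List Term) : ℂ := (L.map (Term.value t s u)).sum

theorem valueSum_cons (t s u : ℂ) (τ : Term) (L : List Term) :
    valueSum t s u (τ :: L) = τ.value t s u + valueSum t s u L := by simp [valueSum]

theorem valueSum_singleton (t s u : ℂ) (τ : Term) : valueSum t s u [τ] = τ.value t s u := by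
  simp [valueSum]

theorem valueSum_append (t s u : ℂ) (L L' : List Term) :
    valueSum t s u (L ++ L') = valueSum t s u L + valueSum t s u L' := by simp [valueSum]

theorem sum_map_taylorTerms (F : Term → ℂ) (K d : ℕ) (T : Forest) (ξ : List (ℤ × ℕ × ℕ)) (a : ℝ)
    (o m : ℕ) (es : List (ℕ × ℕ)) :
    ((taylorTerms K d T ξ a o m es).map F).sum = ∑ n ∈ Finset.range K,
      ((expandEntries ξ (n + 1) es).map fun p =>
        F ⟨T, a * (p.1 : ℝ) / Real.sqrt ((d : ℝ) - 1) ^ (n + 1), o + n, m, p.2⟩).sum := by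
  rw [taylorTerms, ← sum_map_range_eq]
  induction List.range K with
  | nil => simp
  | cons n l ih => simp [ih, Function.comp_def]

theorem valueSum_taylorTerms (s u : ℂ) (K d : ℕ) (T : Forest) (ξ : List (ℤ × ℕ × ℕ)) (a : ℝ)
    (o m : ℕ) (es : List (ℕ × ℕ)) :
    valueSum (hop d) s u (taylorTerms K d T ξ a o m es) = a * u ^ m * ∑ n ∈ Finset.range K,
      (hop d : ℂ) ^ (n + 1) *
        monoSum (treeGreen (hop d) s u T.edges) (expandEntries ξ (n + 1) es) := by
  rw [valueSum, sum_map_taylorTerms, Finset.mul_sum]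
  refine Finset.sum_congr rfl fun n _ => ?_
  rw [monoSum, ← List.sum_map_mul_left, ← List.sum_map_mul_left]
  congr 1
  refine List.map_congr_left fun p _ => ?_
  simp only [Term.value, hop]
  push_cast
  ring

/-- If the switching `ξ` turns the forest `T` into the forest with the edges `fs`, then the terms of
the Taylor expansion add up to the difference of the values on the two forests. -/
theorem exists_valueSum_taylorTerms_bound (K : ℕ) {T : Forest} {fs : List (ℕ × ℕ)}
    {ξ : List (ℤ × ℕ × ℕ)} (hξ : ∀ e ∈ ξ, |e.1| ≤ 1) (hT : FreshEdges T.edges)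
    (hfs : FreshEdges fs)
    (hsw : ∀ t s u f x, schurOp t s u fs f x = schurOp t s u T.edges f x + t * entryOp ξ f x)
    (m : ℕ) (es : List (ℕ × ℕ)) :
    ∃ C : ℝ, 0 ≤ C ∧ ∀ (d : ℕ) (s u : ℂ), TreeParams (hop d) s u → ∀ (a : ℝ) (o : ℕ),
      ‖valueSum (hop d) s u (taylorTerms K d T ξ a o m es) -
        a * u ^ m * (entryProd (treeGreen (hop d) s u fs) es -
          entryProd (treeGreen (hop d) s u T.edges) es)‖ ≤ C * |a| * hop d ^ (K + 1) := by
  obtain ⟨C, hC0, hC⟩ := exists_taylor_bound hξ es (K + 1)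
  refine ⟨2 ^ m * C, by positivity, fun d s u h a o => ?_⟩
  have h1 := hC (hop d) (treeGreen (hop d) s u T.edges) (treeGreen (hop d) s u fs) h.pos.le
    (h.norm_treeGreen_le _) (h.norm_treeGreen_le _)
    (treeGreen_resolvent h hT hfs (hsw _ _ _))
  have h0 : monoSum (treeGreen (hop d) s u T.edges) (expandEntries ξ 0 es) =
      entryProd (treeGreen (hop d) s u T.edges) es := by
    simp [expandEntries_zero, monoSum]
  rw [Finset.sum_range_succ', h0] at h1
  rw [valueSum_taylorTerms, ← mul_sub, norm_mul, norm_mul, norm_pow, Complex.norm_real,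
    Real.norm_eq_abs, norm_sub_rev]
  have h2 : ‖u‖ ^ m ≤ 2 ^ m := pow_le_pow_left₀ (norm_nonneg _) h.norm_diag_le m
  have h3 : |a| * ‖u‖ ^ m ≤ |a| * 2 ^ m := mul_le_mul_of_nonneg_left h2 (abs_nonneg a)
  refine (mul_le_mul h3 (le_trans (le_of_eq ?_) h1) (norm_nonneg _) (by positivity)).trans
    (le_of_eq ?_)
  · congr 1
    ring
  · ring

/-! ### Integration by parts preserves values up to the order of the expansion -/

/-- The term with the coefficient replaced by `a`. -/
def Term.withCoef (a : ℝ) (τ : Term) : Term := { τ with coef := a }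

theorem TreeParams.pow_succ_le {t : ℝ} {s u : ℂ} (h : TreeParams t s u) (k : ℕ) :
    t ^ (k + 1) ≤ t ^ k :=
  pow_le_pow_of_le_one h.pos.le h.le_one (Nat.le_succ k)

theorem norm_entryProd_treeGreen_le {t : ℝ} {s u : ℂ} (h : TreeParams t s u)
    (fs es : List (ℕ × ℕ)) :
    ‖entryProd (treeGreen t s u fs) es‖ ≤
      2 ^ es.length * t ^ es.countP fun e => decide (e.1 ≠ e.2) := by
  induction es with
  | nil => simp [entryProd]
  | cons e es ih =>
    have hp := h.pos
    rw [entryProd_cons, norm_mul, List.length_cons]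
    by_cases he : e.1 = e.2
    · rw [List.countP_cons_of_neg (by simpa using he), pow_succ', mul_assoc]
      exact mul_le_mul (h.norm_treeGreen_le fs _ _) ih (norm_nonneg _) (by norm_num)
    · rw [List.countP_cons_of_pos (by simpa using he)]
      refine (mul_le_mul (h.norm_treeGreen_le_of_ne fs he) ih (norm_nonneg _)
        (by positivity)).trans (le_of_eq ?_)
      ring

theorem Term.norm_value_le {t : ℝ} {s u : ℂ} (h : TreeParams t s u) (τ : Term) :
    ‖τ.value t s u‖ ≤ 2 ^ τ.mPow * 2 ^ τ.entries.length * |τ.coef| * t ^ τ.offDiagCount := by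
  rw [value, norm_mul, norm_mul, norm_pow, Complex.norm_real, Real.norm_eq_abs]
  have h1 : ‖u‖ ^ τ.mPow ≤ 2 ^ τ.mPow := pow_le_pow_left₀ (norm_nonneg _) h.norm_diag_le _
  refine (mul_le_mul (mul_le_mul_of_nonneg_left h1 (abs_nonneg _))
    (norm_entryProd_treeGreen_le h _ _) (norm_nonneg _) (by positivity)).trans (le_of_eq ?_)
  rw [offDiagCount]
  ring

theorem Term.HasCrossEntry.value_eq_zero {τ : Term} (h : τ.HasCrossEntry) (t s u : ℂ) :
    τ.value t s u = 0 := by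
  obtain ⟨e, he, hr⟩ := h
  have h0 : treeGreen t s u τ.forest.edges e.1 e.2 = 0 := by
    by_contra hne
    exact hr (reachable_of_treeGreen_ne_zero (n := τ.forest.size) hne)
  rw [value, entryProd, List.prod_eq_zero, mul_zero]
  rw [← h0]
  exact List.mem_map_of_mem he

theorem entryProd_pendantEdges_eq_zero {t s u : ℂ} {m k : ℕ} {fs es : List (ℕ × ℕ)}
    (hfs : ∀ e ∈ fs, e.1 < m ∧ e.2 < m) (hes : ∀ e ∈ es, e.1 < m ∧ e.2 < m)
    (ho : 1 ≤ es.countP fun e => decide (e.1 ≠ e.2)) :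
    entryProd (treeGreen t s u (pendantEdges m k fs)) es = 0 := by
  obtain ⟨e, he, hne⟩ := List.countP_pos_iff.1 ho
  refine List.prod_eq_zero (List.mem_map.2 ⟨e, he, ?_⟩)
  refine treeGreen_eq_zero_of_lt (m := m) (fun f hf => ?_) (hes e he).1 (hes e he).2
    (by simpa using hne)
  have := bounds_of_mem_pendantEdges hfs f hf
  omega

theorem Term.WellFormed.exists_offDiagStep_bound (K : ℕ) {τ : Term} (hτ : τ.WellFormed)
    (ho : 1 ≤ τ.offDiagCount) :
    ∃ C : ℝ, 0 ≤ C ∧ ∀ (d : ℕ) (s u : ℂ), TreeParams (hop d) s u → ∀ a : ℝ,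
      ‖valueSum (hop d) s u ((τ.withCoef a).offDiagStep K d) - (τ.withCoef a).value (hop d) s u‖ ≤
        C * |a| * hop d ^ K := by
  obtain ⟨C, hC0, hC⟩ := exists_valueSum_taylorTerms_bound K
    (T := τ.forest.fullSwitch) (fs := pairEdges τ.forest.size 0 τ.forest.edges ++ τ.forest.edges)
    (ξ := τ.forest.fullSwitching)
    (fun e he => (bounds_of_mem_switchingFrom (s := 0) hτ.edges_lt e he).1)
    (freshEdges_pendantEdges (s := 0) hτ.edges_lt)
    (freshEdges_pairEdges_append hτ.fresh hτ.edges_lt)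
    (fun t s u f x => schurOp_switchingFrom t s u _ 0 _ f x) τ.mPow τ.entries
  refine ⟨C, hC0, fun d s u h a => ?_⟩
  have h1 := hC d s u h a (τ.order + 1)
  have h2 : entryProd (treeGreen (hop d) s u τ.forest.fullSwitch.edges) τ.entries = 0 :=
    entryProd_pendantEdges_eq_zero (k := 0) hτ.edges_lt hτ.entries_lt ho
  have h3 : entryProd (treeGreen (hop d) s u
      (pairEdges τ.forest.size 0 τ.forest.edges ++ τ.forest.edges)) τ.entries =
      entryProd (treeGreen (hop d) s u τ.forest.edges) τ.entries := by
    refine entryProd_congr fun e he => treeGreen_append_of_lt (m := τ.forest.size) (fun f hf => ?_)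
      (hτ.entries_lt e he).1 (hτ.entries_lt e he).2
    have := bounds_of_mem_pairEdges f hf
    omega
  rw [h2, h3, sub_zero] at h1
  exact h1.trans (mul_le_mul_of_nonneg_left (h.pow_succ_le K) (by positivity))

theorem length_of_mem_expandEntry {ξ : List (ℤ × ℕ × ℕ)} {n x y : ℕ} {p : ℤ × List (ℕ × ℕ)}
    (hp : p ∈ expandEntry ξ n x y) : p.2.length = n + 1 := by
  induction n generalizing x p with
  | zero =>
    simp only [expandEntry, List.mem_singleton] at hp
    simp [hp]
  | succ n ih =>
    simp only [expandEntry, List.mem_flatMap, List.mem_map] at hp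
    obtain ⟨e, he, b, hb, rfl⟩ := hp
    simp [ih hb]

theorem length_of_mem_expandEntries {ξ : List (ℤ × ℕ × ℕ)} {n : ℕ} {es : List (ℕ × ℕ)}
    {p : ℤ × List (ℕ × ℕ)} (hp : p ∈ expandEntries ξ n es) : p.2.length = es.length + n := by
  induction es generalizing n p with
  | nil =>
    simp only [expandEntries] at hp
    split_ifs at hp with hn
    · simp only [List.mem_singleton] at hp
      simp [hp, hn]
    · simp at hp
  | cons e es ih =>
    simp only [expandEntries, List.mem_flatMap, List.mem_range, List.mem_map] at hp
    obtain ⟨k, hk, a, ha, b, hb, rfl⟩ := hp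
    simp only [List.length_append, length_of_mem_expandEntry ha, ih hb, List.length_cons]
    omega

/-- The monomial `G_{xx} G_{yy} R` has the coefficient `-1` in the first order expansion of
`G_{xy} R` under a switching that adds the edge `{x, y}`. -/
theorem leading_coefficient {x y l m : ℕ} (hxy : x ≠ y) (hxl : x ≠ l) (hxm : x ≠ m)
    (hyl : y ≠ l) (es : List (ℕ × ℕ)) :
    ((expandEntries (switching x y l m) 1 ((x, y) :: es)).map fun p =>
      if p.2 = (x, x) :: (y, y) :: es then (p.1 : ℂ) else 0).sum = -1 := by
  simp [expandEntries, List.range_succ, expandEntry, switching, expandEntries_zero, hxy,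
    hxy.symm, hxl.symm, hxm.symm, hyl.symm, Function.comp_def]

theorem valueSum_filter (t s u : ℂ) (L : List Term) (target : List (ℕ × ℕ)) :
    valueSum t s u (L.filter fun σ => decide (σ.entries ≠ target)) = valueSum t s u L -
      (L.map fun σ => if σ.entries = target then σ.value t s u else 0).sum := by
  induction L with
  | nil => simp [valueSum]
  | cons σ L ih =>
    by_cases h : σ.entries = target
    · rw [List.filter_cons_of_neg (by simpa using h), ih, valueSum_cons, List.map_cons,
        List.sum_cons, if_pos h]
      ring
    · rw [List.filter_cons_of_pos (by simpa using h), valueSum_cons, ih, valueSum_cons,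
        List.map_cons, List.sum_cons, if_neg h]
      ring

/-- Leaving out the leading monomial `-t G_{xx} G_{yy} R` of the expansion of `G_{xy} R`. -/
theorem valueSum_filter_taylorTerms (s u : ℂ) {K d x y l m : ℕ} (hK : 1 ≤ K) (hxy : x ≠ y)
    (hxl : x ≠ l) (hxm : x ≠ m) (hyl : y ≠ l) (T : Forest) (a : ℝ) (o k : ℕ)
    (es : List (ℕ × ℕ)) :
    valueSum (hop d) s u ((taylorTerms K d T (switching x y l m) a o k ((x, y) :: es)).filter
        fun σ => decide (σ.entries ≠ (x, x) :: (y, y) :: es)) =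
      valueSum (hop d) s u (taylorTerms K d T (switching x y l m) a o k ((x, y) :: es)) +
        a * u ^ k * (hop d * (u * u * entryProd (treeGreen (hop d) s u T.edges) es)) := by
  rw [valueSum_filter, sum_map_taylorTerms]
  have hn : ∀ n, ((expandEntries (switching x y l m) (n + 1) ((x, y) :: es)).map fun p =>
      if p.2 = (x, x) :: (y, y) :: es then Term.value (hop d) s u
        ⟨T, a * (p.1 : ℝ) / Real.sqrt ((d : ℝ) - 1) ^ (n + 1), o + n, k, p.2⟩ else 0).sum =
      a * u ^ k * hop d ^ (n + 1) * (u * u * entryProd (treeGreen (hop d) s u T.edges) es) *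
      ((expandEntries (switching x y l m) (n + 1) ((x, y) :: es)).map fun p =>
        if p.2 = (x, x) :: (y, y) :: es then (p.1 : ℂ) else 0).sum := by
    intro n
    rw [← List.sum_map_mul_left]
    congr 1
    refine List.map_congr_left fun p _ => ?_
    split_ifs with hp
    · simp only [Term.value, hop, hp, entryProd_cons, treeGreen_self]
      push_cast
      ring
    · simp
  obtain ⟨K, rfl⟩ : ∃ K', K = K' + 1 := ⟨K - 1, by omega⟩
  simp only [hn]
  rw [Finset.sum_range_succ', Finset.sum_eq_zero]
  · rw [leading_coefficient hxy hxl hxm hyl]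
    ring
  · intro n _
    rw [List.map_congr_left (g := fun _ => (0 : ℂ))]
    · simp
    · intro p hp
      have := length_of_mem_expandEntries hp
      rw [if_neg]
      intro h
      rw [h] at this
      simp at this

theorem valueSum_diagStepNeighbors (s u : ℂ) (d : ℕ) {τ : Term} (hf : FreshEdges τ.forest.edges)
    (i : ℕ) (es : List (ℕ × ℕ)) :
    valueSum (hop d) s u (τ.diagStepNeighbors d i es) = τ.forest.degree i *
      (τ.coef * hop d ^ 2 * s * u ^ (τ.mPow + 2) *
        entryProd (treeGreen (hop d) s u τ.forest.edges) es) := by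
  rw [valueSum, Term.diagStepNeighbors, Forest.degree, List.map_map, List.map_congr_left
    (g := fun _ => τ.coef * hop d ^ 2 * s * u ^ (τ.mPow + 2) *
        entryProd (treeGreen (hop d) s u τ.forest.edges) es)]
  · simp
  · intro k hk
    have hik : treeGreen (hop d) s u τ.forest.edges i k = -(hop d * s) * u := by
      rcases mem_edges_of_mem_neighbors hk with h | h
      · exact treeGreen_of_mem hf h
      · rw [treeGreen_comm]
        exact treeGreen_of_mem hf h
    simp only [Function.comp_apply, Term.value, entryProd_cons, hik, div_eq_mul_inv]
    rw [← hop]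
    push_cast
    ring

theorem Term.WellFormed.exists_diagStep_bound {K : ℕ} (hK : 1 ≤ K) {τ : Term}
    (hτ : τ.WellFormed) {i : ℕ} (hi : (i, i) ∈ τ.entries) :
    ∃ C : ℝ, 0 ≤ C ∧ ∀ (d : ℕ) (s u : ℂ), 3 ≤ d → TreeParams (hop d) s u → ∀ a : ℝ,
      ‖valueSum (hop d) s u ((τ.withCoef a).diagStep K d i) - (τ.withCoef a).value (hop d) s u‖ ≤
        C * |a| * hop d ^ K := by
  set n := τ.forest.size with hn
  set es := τ.entries.erase (i, i) with hes_def
  have hin : i < n := (hτ.entries_lt _ hi).1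
  have hes : ∀ e ∈ es, e.1 < n ∧ e.2 < n :=
    fun e he => hτ.entries_lt e (List.mem_of_mem_erase he)
  obtain ⟨C₁, hC₁0, hC₁⟩ := exists_valueSum_taylorTerms_bound K
    (T := ⟨n + 4, (n, n + 2) :: (n + 1, n + 3) :: τ.forest.edges⟩)
    (fs := (n, n + 1) :: (n + 2, n + 3) :: τ.forest.edges)
    (ξ := switching n (n + 1) (n + 2) (n + 3))
    abs_le_one_of_mem_switching
    (freshEdges_cons_cons hτ.fresh hτ.edges_lt (by omega) (by omega) (by omega) (by omega)
      (by omega) (by omega))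
    (freshEdges_cons_cons hτ.fresh hτ.edges_lt (by omega) (by omega) (by omega) (by omega)
      (by omega) (by omega))
    (fun t s u f x => schurOp_switching t s u _ _ _ _ _ f x) τ.mPow ((n, n + 1) :: (i, i) :: es)
  obtain ⟨C₂, hC₂0, hC₂⟩ := exists_valueSum_taylorTerms_bound K
    (T := ⟨n + 3, (i, n + 1) :: (n, n + 2) :: τ.forest.edges⟩)
    (fs := (i, n) :: (n + 1, n + 2) :: τ.forest.edges)
    (ξ := switching i n (n + 1) (n + 2))
    abs_le_one_of_mem_switching
    (freshEdges_cons_cons hτ.fresh hτ.edges_lt (by omega) (by omega) (by omega) (by omega)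
      (by omega) (by omega))
    (freshEdges_cons_cons hτ.fresh hτ.edges_lt (by omega) (by omega) (by omega) (by omega)
      (by omega) (by omega))
    (fun t s u f x => schurOp_switching t s u _ _ _ _ _ f x) (τ.mPow + 1) ((i, n) :: es)
  set D : ℝ := ((τ.forest.degree i : ℕ) : ℝ) with hD
  have hD0 : 0 ≤ D := Nat.cast_nonneg _
  have hDc : (τ.forest.degree i : ℂ) = (D : ℂ) := by simp [hD]
  refine ⟨C₁ * 2 + C₂ * ((1 + D) * 2), by positivity, fun d s u hd h a => ?_⟩
  have hp := h.pos
  have ht0 : (hop d : ℂ) ≠ 0 := by exact_mod_cast hp.ne'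
  have ht1 : (1 : ℂ) + (hop d : ℂ) ^ 2 ≠ 0 := by
    have : (0 : ℝ) < 1 + hop d ^ 2 := by positivity
    exact_mod_cast this.ne'
  set g := treeGreen (hop d) s u τ.forest.edges with hg
  set R := entryProd g es with hR
  -- the entries other than the new ones do not see the new edges
  have hcongr : ∀ e f : ℕ × ℕ, n ≤ e.2 → n ≤ f.2 →
      entryProd (treeGreen (hop d) s u (e :: f :: τ.forest.edges)) es = R := by
    intro e f he hf
    refine entryProd_congr fun v hv => treeGreen_append_of_lt (fs := [e, f]) (m := n) ?_
      (hes v hv).1 (hes v hv).2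
    simp [he, hf]
  have hfresh : ∀ e ∈ τ.forest.edges, e.1 ≠ n ∧ e.2 ≠ n := fun e he => by
    have := hτ.edges_lt e he
    omega
  have hperm : entryProd g τ.entries = u * R := by
    rw [entryProd, ((List.perm_cons_erase hi).map _).prod_eq, List.map_cons, List.prod_cons, hg,
      treeGreen_self, hR, entryProd]
  have hv1 : valueSum (hop d) s u [{ τ.withCoef a with mPow := τ.mPow + 1, entries := es }] =
      (τ.withCoef a).value (hop d) s u := by
    simp only [valueSum, List.map_cons, List.map_nil, List.sum_cons, List.sum_nil, add_zero, value,
      withCoef]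
    rw [← hg, hperm]
    ring
  have hv2 : ((τ.withCoef a).diagStepLeading d i).value (hop d) s u =
      -(a * (D * hop d ^ 2)) * u ^ (τ.mPow + 2) * (u * R) := by
    simp only [diagStepLeading, value, withCoef]
    rw [← hg, hperm, div_eq_mul_inv, ← hop_sq hd]
    push_cast
    rw [hDc]
  have hv3 := valueSum_diagStepNeighbors s u d (τ := τ.withCoef a) hτ.fresh i es
  -- the two expanded parts, with their leading monomials
  set A : ℝ := (1 + hop d ^ 2) / hop d with hA
  have hdA : (d : ℝ) / Real.sqrt ((d : ℝ) - 1) = A := div_sqrt_eq_hop hd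
  have h4 := hC₁ d s u h (a * A) τ.order
  have h5 := hC₂ d s u h (-(a * (1 - D / d) * A)) τ.order
  have hv4 : valueSum (hop d) s u ((τ.withCoef a).diagStepFresh K d i es) = _ :=
    valueSum_filter_taylorTerms s u hK (by omega) (by omega) (by omega) (by omega) _ _ _ _
      ((i, i) :: es)
  have hv5 : valueSum (hop d) s u ((τ.withCoef a).diagStepAttached K d i es) = _ :=
    valueSum_filter_taylorTerms s u hK (by simp only [withCoef]; omega)
      (by simp only [withCoef]; omega) (by simp only [withCoef]; omega) (by omega) _ _ _ _ es
  simp only [withCoef] at hv4 hv5 hv3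
  rw [hdA, ← hn] at hv4 hv5
  have e1 : treeGreen (hop d) s u ((n, n + 1) :: (n + 2, n + 3) :: τ.forest.edges) n (n + 1) =
      -(hop d * s) * u := by
    simp [treeGreen, treeGreen_self]
  have e2 : treeGreen (hop d) s u ((n, n + 2) :: (n + 1, n + 3) :: τ.forest.edges) n (n + 1) =
      0 := by
    rw [treeGreen_cons_of_ne _ (by omega) (by omega), treeGreen_cons_of_ne _ (by omega) (by omega),
      treeGreen_eq_zero_of_fresh hfresh (by omega)]
  have e3 : treeGreen (hop d) s u ((i, n) :: (n + 1, n + 2) :: τ.forest.edges) i n =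
      -(hop d * s) * u := treeGreen_of_mem (freshEdges_cons_cons hτ.fresh hτ.edges_lt (by omega)
        (by omega) (by omega) (by omega) (by omega) (by omega)) (by simp)
  have e4 : treeGreen (hop d) s u ((i, n + 1) :: (n, n + 2) :: τ.forest.edges) i n = 0 := by
    rw [treeGreen_cons_of_ne _ (by omega) (by omega), treeGreen_cons_of_ne _ (by omega) (by omega),
      treeGreen_comm, treeGreen_eq_zero_of_fresh hfresh (by omega)]
  simp only [entryProd_cons, e1, e2, treeGreen_self, hcongr (n, n + 1) (n + 2, n + 3) (by simp)
    (by simp), zero_mul, sub_zero] at h4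
  simp only [entryProd_cons, e3, e4, hcongr (i, n) (n + 1, n + 2) (by simp)
    (by simp), zero_mul, sub_zero] at h5
  simp only [entryProd_cons, treeGreen_self, hcongr (n, n + 2) (n + 1, n + 3) (by simp)
    (by simp)] at hv4
  simp only [hcongr (i, n + 1) (n, n + 2) (by simp) (by simp)] at hv5
  set V₄ := valueSum (hop d) s u (taylorTerms K d _ (switching n (n + 1) (n + 2) (n + 3)) (a * A)
    τ.order τ.mPow ((n, n + 1) :: (i, i) :: es))
  set V₅ := valueSum (hop d) s u (taylorTerms K d _ (switching i n (n + 1) (n + 2))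
    (-(a * (1 - D / d) * A)) τ.order (τ.mPow + 1) ((i, n) :: es))
  have hdiff : valueSum (hop d) s u ((τ.withCoef a).diagStep K d i) -
      (τ.withCoef a).value (hop d) s u =
      (V₄ - ((a * A : ℝ) : ℂ) * u ^ τ.mPow * (-(hop d * s) * u * (u * R))) +
      (V₅ - ((-(a * (1 - D / d) * A) : ℝ) : ℂ) * u ^ (τ.mPow + 1) * (-(hop d * s) * u * R)) := by
    have hlist : (τ.withCoef a).diagStep K d i =
      [{ τ.withCoef a with mPow := τ.mPow + 1, entries := es }] ++
        ((τ.withCoef a).diagStepLeading d i ::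
        ((τ.withCoef a).diagStepNeighbors d i es ++ (τ.withCoef a).diagStepFresh K d i es ++
          (τ.withCoef a).diagStepAttached K d i es)) := rfl
    rw [hlist, valueSum_append, hv1, valueSum_cons, valueSum_append, valueSum_append, hv2]
    simp only [withCoef]
    rw [hv3, hv4, hv5]
    have hdd : (1 : ℝ) - D / d = 1 - D * hop d ^ 2 / (1 + hop d ^ 2) := by
      rw [natCast_eq_hop hd]
      field_simp
    rw [hdd, hA]
    rw [hDc]
    push_cast
    field_simp
    ring
  have hAb : |A| * hop d ^ (K + 1) ≤ 2 * hop d ^ K := by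
    have h0 : 0 ≤ A := by positivity
    have : A * hop d ^ (K + 1) = (1 + hop d ^ 2) * hop d ^ K := by
      rw [hA]
      field_simp
      ring
    rw [abs_of_nonneg h0, this]
    have := h.sq_le
    exact mul_le_mul_of_nonneg_right (by linarith) (by positivity)
  have hDb : |1 - D / d| ≤ 1 + D := by
    have hd' : (3 : ℝ) ≤ d := by exact_mod_cast hd
    have h1 : 0 ≤ D / d := by positivity
    have h2 : D / d ≤ D := div_le_self hD0 (by linarith)
    rw [abs_le]
    constructor <;> linarith
  rw [hdiff]
  refine (norm_add_le _ _).trans ((add_le_add h4 h5).trans ?_)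
  rw [abs_neg, abs_mul, abs_mul, abs_mul]
  calc C₁ * (|a| * |A|) * hop d ^ (K + 1) + C₂ * (|a| * |1 - D / d| * |A|) * hop d ^ (K + 1)
      = C₁ * |a| * (|A| * hop d ^ (K + 1)) +
        C₂ * |a| * (|1 - D / d| * (|A| * hop d ^ (K + 1))) := by ring
    _ ≤ C₁ * |a| * (2 * hop d ^ K) + C₂ * |a| * ((1 + D) * (2 * hop d ^ K)) := by
        gcongr
    _ = _ := by ring

/-! ### Bounds that are uniform over all choices in the expansion -/

/-- In an expansion of `X ++ L` to `S`, the part of `S` that the terms in `X` lead to has degree at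
most `D`, and it agrees with their value on the infinite tree up to `C M (d-1)^{-K/2}` whenever the
coefficients of the terms of order `𝔥` are at most `M (d-1)^{-𝔥/2}`. -/
def Resolved (K d : ℕ) (X L : List Term) (S : ℝ[X]) (C : ℝ) (D : ℕ) : Prop :=
  ∃ S₁ S₂ : ℝ[X], S = S₁ + S₂ ∧ Expands K d L S₂ ∧ S₁.natDegree ≤ D ∧
    ∀ (s u : ℂ) (M : ℝ), TreeParams (hop d) s u → 0 ≤ M →
      (∀ σ ∈ X, |σ.coef| ≤ M * hop d ^ σ.order) →
      ‖aeval u S₁ - valueSum (hop d) s u X‖ ≤ C * M * hop d ^ K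

theorem Resolved.mono {K d : ℕ} {X L : List Term} {S : ℝ[X]} {C C' : ℝ} {D D' : ℕ}
    (h : Resolved K d X L S C D) (hC : C ≤ C') (hD : D ≤ D') : Resolved K d X L S C' D' := by
  obtain ⟨S₁, S₂, hS, hL, hd, hb⟩ := h
  refine ⟨S₁, S₂, hS, hL, hd.trans hD, fun s u M ht hM hX => (hb s u M ht hM hX).trans ?_⟩
  have := ht.pos
  gcongr

/-- The bounds of `Resolved` hold uniformly in `d`, for all choices in the expansion and for all
coefficients of the terms `Y`. -/
def Resolvable (K : ℕ) (Y : List Term) : Prop :=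
  ∃ (C : ℝ) (D : ℕ), 0 ≤ C ∧ ∀ (d : ℕ) (X L : List Term) (S : ℝ[X]), 3 ≤ d →
    X.map (Term.withCoef 0) = Y.map (Term.withCoef 0) → Expands K d (X ++ L) S →
    Resolved K d X L S C D

theorem resolvable_nil (K : ℕ) : Resolvable K [] := by
  refine ⟨0, 0, le_rfl, fun d X L S _ hX hS => ?_⟩
  obtain rfl : X = [] := by simpa using hX
  exact ⟨0, S, by simp, hS, by simp, fun s u M _ _ _ => by simp [valueSum]⟩

theorem Resolvable.cons {K : ℕ} {τ : Term} {Y : List Term} (hτ : Resolvable K [τ])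
    (hY : Resolvable K Y) : Resolvable K (τ :: Y) := by
  obtain ⟨C₁, D₁, hC₁, h₁⟩ := hτ
  obtain ⟨C₂, D₂, hC₂, h₂⟩ := hY
  refine ⟨C₁ + C₂, max D₁ D₂, by positivity, fun d X L S hd hX hS => ?_⟩
  rcases X with _ | ⟨σ, X⟩
  · simp at hX
  rw [List.map_cons, List.map_cons, List.cons.injEq] at hX
  obtain ⟨S₁, S', rfl, hS', hd₁, hb₁⟩ := h₁ d [σ] (X ++ L) S hd (by simp [hX.1]) hS
  obtain ⟨S₂, S₃, rfl, hS₃, hd₂, hb₂⟩ := h₂ d X L S' hd hX.2 hS'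
  refine ⟨S₁ + S₂, S₃, by rw [add_assoc], hS₃, (natDegree_add_le _ _).trans (max_le_max hd₁ hd₂),
    fun s u M ht hM hc => ?_⟩
  simp only [List.mem_cons, forall_eq_or_imp] at hc
  have e₁ := hb₁ s u M ht hM (by simpa using hc.1)
  have e₂ := hb₂ s u M ht hM hc.2
  have hsplit : aeval u (S₁ + S₂) - valueSum (hop d) s u (σ :: X) =
      (aeval u S₁ - valueSum (hop d) s u [σ]) + (aeval u S₂ - valueSum (hop d) s u X) := by
    rw [map_add, valueSum_cons, valueSum_singleton]
    ring
  rw [hsplit]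
  refine (norm_add_le _ _).trans ((add_le_add e₁ e₂).trans (le_of_eq ?_))
  ring

theorem resolvable_of_forall {K : ℕ} {Y : List Term} (h : ∀ τ ∈ Y, Resolvable K [τ]) :
    Resolvable K Y := by
  induction Y with
  | nil => exact resolvable_nil K
  | cons τ Y ih =>
    simp only [List.mem_cons, forall_eq_or_imp] at h
    exact h.1.cons (ih h.2)

/-- A step of the expansion that preserves the value resolves a term, if the resulting terms are
resolved. -/
theorem Resolved.of_step {K d : ℕ} {τ : Term} {X L : List Term} {S : ℝ[X]} {A C C' : ℝ} {D : ℕ}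
    (hC : 0 ≤ C') (hA : 0 ≤ A) (h : Resolved K d X L S C D)
    (hX : ∀ M : ℝ, 0 ≤ M → |τ.coef| ≤ M * hop d ^ τ.order →
      ∀ σ ∈ X, |σ.coef| ≤ A * M * hop d ^ σ.order)
    (hv : ∀ s u : ℂ, TreeParams (hop d) s u →
      ‖valueSum (hop d) s u X - τ.value (hop d) s u‖ ≤ C' * |τ.coef| * hop d ^ K) :
    Resolved K d [τ] L S (C * A + C') D := by
  obtain ⟨S₁, S₂, hS, hL, hD, hb⟩ := h
  refine ⟨S₁, S₂, hS, hL, hD, fun s u M ht hM hc => ?_⟩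
  have hp := ht.pos
  have hc' : |τ.coef| ≤ M * hop d ^ τ.order := by simpa using hc
  have e₁ := hb s u (A * M) ht (by positivity) (hX M hM hc')
  have e₂ := hv s u ht
  have e₃ : |τ.coef| ≤ M :=
    hc'.trans (mul_le_of_le_one_right hM (pow_le_one₀ hp.le ht.le_one))
  have hsplit : aeval u S₁ - valueSum (hop d) s u [τ] =
      (aeval u S₁ - valueSum (hop d) s u X) +
        (valueSum (hop d) s u X - τ.value (hop d) s u) := by
    rw [valueSum_singleton]
    ring
  rw [hsplit]
  refine (norm_add_le _ _).trans ((add_le_add e₁ e₂).trans ?_)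
  calc C * (A * M) * hop d ^ K + C' * |τ.coef| * hop d ^ K
      ≤ C * (A * M) * hop d ^ K + C' * M * hop d ^ K := by gcongr
    _ = _ := by ring

theorem taylorTerms_map_withCoef (K d d' : ℕ) (T : Forest) (ξ : List (ℤ × ℕ × ℕ)) (a a' : ℝ)
    (o m : ℕ) (es : List (ℕ × ℕ)) :
    (taylorTerms K d T ξ a o m es).map (Term.withCoef 0) =
      (taylorTerms K d' T ξ a' o m es).map (Term.withCoef 0) := by
  simp [taylorTerms, List.map_flatMap, Term.withCoef, Function.comp_def]

theorem filter_map_withCoef (L : List Term) (target : List (ℕ × ℕ)) :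
    (L.filter fun σ => decide (σ.entries ≠ target)).map (Term.withCoef 0) =
      (L.map (Term.withCoef 0)).filter fun σ => decide (σ.entries ≠ target) := by
  rw [List.filter_map]
  rfl

theorem offDiagStep_map_withCoef (K d d' : ℕ) (τ : Term) (a a' : ℝ) :
    ((τ.withCoef a).offDiagStep K d).map (Term.withCoef 0) =
      ((τ.withCoef a').offDiagStep K d').map (Term.withCoef 0) :=
  taylorTerms_map_withCoef _ _ _ _ _ _ _ _ _ _

theorem diagStep_map_withCoef (K d d' i : ℕ) (τ : Term) (a a' : ℝ) :
    ((τ.withCoef a).diagStep K d i).map (Term.withCoef 0) =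
      ((τ.withCoef a').diagStep K d' i).map (Term.withCoef 0) := by
  have h1 : ∀ es, ((τ.withCoef a).diagStepNeighbors d i es).map (Term.withCoef 0) =
      ((τ.withCoef a').diagStepNeighbors d' i es).map (Term.withCoef 0) := fun es => by
    simp [Term.diagStepNeighbors, Term.withCoef, Function.comp_def]
  have h2 : ∀ es, ((τ.withCoef a).diagStepFresh K d i es).map (Term.withCoef 0) =
      ((τ.withCoef a').diagStepFresh K d' i es).map (Term.withCoef 0) := fun es => by
    rw [Term.diagStepFresh, Term.diagStepFresh, filter_map_withCoef, filter_map_withCoef]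
    exact congrArg _ (taylorTerms_map_withCoef _ _ _ _ _ _ _ _ _ _)
  have h3 : ∀ es, ((τ.withCoef a).diagStepAttached K d i es).map (Term.withCoef 0) =
      ((τ.withCoef a').diagStepAttached K d' i es).map (Term.withCoef 0) := fun es => by
    rw [Term.diagStepAttached, Term.diagStepAttached, filter_map_withCoef, filter_map_withCoef]
    exact congrArg _ (taylorTerms_map_withCoef _ _ _ _ _ _ _ _ _ _)
  simp only [Term.diagStep, List.map_cons, List.map_append, h1, h2, h3]
  rfl

/-! ### Sizes of the coefficients -/

theorem abs_coef_le_of_mem_taylorTerms {K d : ℕ} {T : Forest} {ξ : List (ℤ × ℕ × ℕ)}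
    (hξ : ∀ e ∈ ξ, |e.1| ≤ 1) (hd : 3 ≤ d) {a B : ℝ} {o m : ℕ} {es : List (ℕ × ℕ)}
    (ha : |a| * hop d ≤ B * hop d ^ o) {σ : Term} (hσ : σ ∈ taylorTerms K d T ξ a o m es) :
    |σ.coef| ≤ B * hop d ^ σ.order := by
  obtain ⟨n, -, p, hp, rfl⟩ := mem_taylorTerms.1 hσ
  have h1 : |(p.1 : ℝ)| ≤ 1 := by exact_mod_cast abs_le_one_of_mem_expandEntries hξ hp
  have h0 := hop_pos hd
  simp only
  rw [div_eq_mul_inv, ← inv_pow, ← hop, abs_mul, abs_mul, abs_of_pos (pow_pos h0 _)]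
  calc |a| * |(p.1 : ℝ)| * hop d ^ (n + 1) ≤ |a| * 1 * hop d ^ (n + 1) := by gcongr
    _ = |a| * hop d * hop d ^ n := by ring
    _ ≤ B * hop d ^ o * hop d ^ n := by gcongr
    _ = B * hop d ^ (o + n) := by ring

theorem Term.WellFormed.abs_coef_le_of_mem_offDiagStep {K d : ℕ} {τ σ : Term} (hτ : τ.WellFormed)
    (hd : 3 ≤ d) {M : ℝ} (hc : |τ.coef| ≤ M * hop d ^ τ.order) (hσ : σ ∈ τ.offDiagStep K d) :
    |σ.coef| ≤ M * hop d ^ σ.order := by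
  refine abs_coef_le_of_mem_taylorTerms
    (fun e he => (bounds_of_mem_switchingFrom (s := 0) hτ.edges_lt e he).1) hd ?_ hσ
  rw [pow_succ, ← mul_assoc]
  exact mul_le_mul_of_nonneg_right hc (hop_pos hd).le

theorem div_sqrt_mul_hop_le {d : ℕ} (hd : 3 ≤ d) :
    |(d : ℝ) / Real.sqrt ((d : ℝ) - 1)| * hop d ≤ 2 := by
  have h0 := hop_pos hd
  have h1 := hop_sq_le hd
  rw [div_sqrt_eq_hop hd, abs_of_pos (by positivity), div_mul_cancel₀ _ h0.ne']
  linarith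

theorem Term.abs_coef_le_of_mem_diagStep {K d i : ℕ} {τ σ : Term} (hd : 3 ≤ d) {M : ℝ}
    (hM : 0 ≤ M) (hc : |τ.coef| ≤ M * hop d ^ τ.order) (hσ : σ ∈ τ.diagStep K d i) :
    |σ.coef| ≤ 2 * (1 + τ.forest.degree i) * M * hop d ^ σ.order := by
  have h0 := hop_pos hd
  have h2 := div_sqrt_mul_hop_le hd
  set D : ℝ := (τ.forest.degree i : ℝ) with hD
  have hD0 : 0 ≤ D := Nat.cast_nonneg _
  have hd' : (3 : ℝ) ≤ d := by exact_mod_cast hd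
  have hA : M ≤ 2 * (1 + D) * M := by nlinarith
  simp only [diagStep, List.mem_cons, List.mem_append] at hσ
  rcases hσ with rfl | rfl | (hσ | hσ) | hσ
  · refine hc.trans ?_
    simp only
    gcongr
  · simp only [diagStepLeading]
    rw [abs_neg, abs_mul, div_eq_mul_inv, ← hop_sq hd, ← hD,
      abs_of_nonneg (a := D * hop d ^ 2) (by positivity)]
    calc |τ.coef| * (D * hop d ^ 2) ≤ M * hop d ^ τ.order * (D * hop d ^ 2) := by gcongr
      _ = (D * M) * hop d ^ (τ.order + 2) := by ring
      _ ≤ 2 * (1 + D) * M * hop d ^ (τ.order + 2) := by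
          gcongr
          linarith
  · simp only [diagStepNeighbors, List.mem_map] at hσ
    obtain ⟨k, -, rfl⟩ := hσ
    simp only
    rw [abs_neg, div_eq_mul_inv, ← hop, abs_mul, abs_of_pos h0]
    calc |τ.coef| * hop d ≤ M * hop d ^ τ.order * hop d := by gcongr
      _ = M * hop d ^ (τ.order + 1) := by ring
      _ ≤ _ := by gcongr
  · refine abs_coef_le_of_mem_taylorTerms abs_le_one_of_mem_switching hd ?_
      (List.mem_filter.1 hσ).1
    rw [abs_mul, mul_assoc]
    calc |τ.coef| * (|(d : ℝ) / Real.sqrt ((d : ℝ) - 1)| * hop d)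
        ≤ M * hop d ^ τ.order * 2 := by gcongr
      _ = 2 * (1 + 0) * M * hop d ^ τ.order := by ring
      _ ≤ _ := by gcongr
  · refine abs_coef_le_of_mem_taylorTerms abs_le_one_of_mem_switching hd ?_
      (List.mem_filter.1 hσ).1
    have hDb : |1 - D / d| ≤ 1 + D := by
      have h1 : 0 ≤ D / d := by positivity
      have h2 : D / d ≤ D := div_le_self hD0 (by linarith)
      rw [abs_le]
      constructor <;> linarith
    rw [abs_neg, abs_mul, abs_mul, mul_assoc]
    calc |τ.coef| * |1 - D / d| * (|(d : ℝ) / Real.sqrt ((d : ℝ) - 1)| * hop d)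
        ≤ M * hop d ^ τ.order * (1 + D) * 2 := by gcongr
      _ = _ := by ring

theorem Term.withCoef_wellFormed {τ : Term} (h : τ.WellFormed) (a : ℝ) :
    (τ.withCoef a).WellFormed := ⟨h.fresh, h.edges_lt, h.entries_lt⟩

/-! ### The uniform bound for all outcomes -/

/-- The parts of an expansion can be bounded uniformly over all its choices, by induction along the
order in which the expansion terminates. -/
theorem Term.WellFormed.resolvable (K : ℕ) {τ : Term} (hτ : τ.WellFormed) :
    Resolvable K [τ] := by
  induction τ using (InvImage.wf (Term.rank K) wellFounded_lt).induction with
  | _ τ ih =>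
  -- the integrations by parts
  have hoff : ∃ (C : ℝ) (D : ℕ), 0 ≤ C ∧ (τ.order + τ.offDiagCount < K → 1 ≤ τ.offDiagCount →
      ∀ (d : ℕ) (a : ℝ) (L : List Term) (S : ℝ[X]), 3 ≤ d →
        Expands K d ((τ.withCoef a).offDiagStep K d ++ L) S →
        Resolved K d [τ.withCoef a] L S C D) := by
    by_cases hK : τ.order + τ.offDiagCount < K ∧ 1 ≤ τ.offDiagCount
    · obtain ⟨C₁, D, hC₁, h₁⟩ := resolvable_of_forall (K := K) (Y := τ.offDiagStep K 3)
        fun σ hσ => ih σ (Term.rank_lt_of_mem_offDiagStep (by omega) hσ)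
          (hτ.of_mem_offDiagStep hσ)
      obtain ⟨C₂, hC₂, h₂⟩ := hτ.exists_offDiagStep_bound K hK.2
      refine ⟨C₁ * 1 + C₂, D, by positivity, fun _ _ d a L S hd hS => ?_⟩
      refine Resolved.of_step hC₂ zero_le_one
        (h₁ d _ L S hd (offDiagStep_map_withCoef K d 3 τ a τ.coef) hS) (fun M _ hc σ hσ => ?_)
        (fun s u ht => h₂ d s u ht a)
      rw [one_mul]
      exact (withCoef_wellFormed hτ a).abs_coef_le_of_mem_offDiagStep hd hc hσ
    · exact ⟨0, 0, le_rfl, fun h1 h2 => absurd ⟨h1, h2⟩ hK⟩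
  have hdiag : ∀ i, ∃ (C : ℝ) (D : ℕ), 0 ≤ C ∧ (τ.order + τ.offDiagCount < K →
      τ.offDiagCount = 0 → (i, i) ∈ τ.entries →
      ∀ (d : ℕ) (a : ℝ) (L : List Term) (S : ℝ[X]), 3 ≤ d →
        Expands K d ((τ.withCoef a).diagStep K d i ++ L) S →
        Resolved K d [τ.withCoef a] L S C D) := by
    intro i
    by_cases hK : τ.order + τ.offDiagCount < K ∧ τ.offDiagCount = 0 ∧ (i, i) ∈ τ.entries
    · obtain ⟨C₁, D, hC₁, h₁⟩ := resolvable_of_forall (K := K) (Y := τ.diagStep K 3 i)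
        fun σ hσ => ih σ (Term.rank_lt_of_mem_diagStep (by omega) hK.2.1 hK.2.2 hτ.entries_lt hσ)
          (hτ.of_mem_diagStep hK.2.2 hσ)
      obtain ⟨C₂, hC₂, h₂⟩ := hτ.exists_diagStep_bound (K := K) (by omega) hK.2.2
      refine ⟨C₁ * (2 * (1 + τ.forest.degree i)) + C₂, D, by positivity,
        fun _ _ _ d a L S hd hS => ?_⟩
      exact Resolved.of_step hC₂ (by positivity)
        (h₁ d _ L S hd (diagStep_map_withCoef K d 3 i τ a τ.coef) hS)
        (fun M hM hc σ hσ => Term.abs_coef_le_of_mem_diagStep (τ := τ.withCoef a) hd hM hc hσ)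
        (fun s u ht => h₂ d s u hd ht a)
    · exact ⟨0, 0, le_rfl, fun h1 h2 h3 => absurd ⟨h1, h2, h3⟩ hK⟩
  obtain ⟨C₁, D₁, hC₁, h₁⟩ := hoff
  choose C₂ D₂ hC₂ h₂ using hdiag
  set C₀ : ℝ := 2 ^ τ.mPow * 2 ^ τ.entries.length with hC₀
  set C₃ : ℝ := ∑ i ∈ Finset.range τ.forest.size, C₂ i with hC₃
  have hC₃0 : 0 ≤ C₃ := Finset.sum_nonneg fun i _ => hC₂ i
  have hC₀0 : 0 ≤ C₀ := by positivity
  refine ⟨C₀ + C₁ + C₃, τ.mPow + D₁ + ∑ i ∈ Finset.range τ.forest.size, D₂ i, by positivity,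
    fun d X L S hd hX hS => ?_⟩
  obtain ⟨σ, rfl⟩ : ∃ σ, X = [σ] := by
    rw [← List.length_eq_one_iff]
    simpa using congrArg List.length hX
  obtain ⟨a, rfl⟩ : ∃ a, σ = τ.withCoef a := by
    refine ⟨σ.coef, ?_⟩
    simp only [List.map_cons, List.map_nil, List.cons.injEq, and_true, withCoef,
      Term.mk.injEq, true_and] at hX
    obtain ⟨h1, h2, h3, h4⟩ := hX
    cases σ
    simp_all [withCoef]
  rw [List.singleton_append] at hS
  cases hS with
  | discard h hL =>
    refine Resolved.mono (C := C₀) (D := 0) ⟨0, S, by simp, hL, by simp,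
      fun s u M ht hM hc => ?_⟩ (by linarith) (by omega)
    have hp := ht.pos
    have hc' : |a| ≤ M * hop d ^ τ.order := by simpa [withCoef] using hc
    have hval := Term.norm_value_le ht (τ.withCoef a)
    rw [map_zero, zero_sub, norm_neg, valueSum_singleton]
    refine hval.trans ?_
    calc C₀ * |a| * hop d ^ τ.offDiagCount
        ≤ C₀ * (M * hop d ^ τ.order) * hop d ^ τ.offDiagCount := by gcongr
      _ = C₀ * M * hop d ^ (τ.order + τ.offDiagCount) := by ring
      _ ≤ C₀ * M * hop d ^ K := by
          refine mul_le_mul_of_nonneg_left (pow_le_pow_of_le_one hp.le ht.le_one h) ?_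
          positivity
  | cross h hL =>
    refine Resolved.mono (C := 0) (D := 0) ⟨0, S, by simp, hL, by simp,
      fun s u M ht hM hc => ?_⟩ (by linarith) (by omega)
    rw [valueSum_singleton, h.value_eq_zero]
    simp
  | @done _ _ S' h he hL =>
    refine Resolved.mono (C := 0) (D := τ.mPow) ⟨_, S', rfl, hL, natDegree_C_mul_X_pow_le _ _,
      fun s u M ht hM hc => ?_⟩ (by linarith) (by omega)
    rw [valueSum_singleton, value, he]
    simp [entryProd]
  | offDiag h hc ho hL =>
    exact (h₁ h ho d a L S hd hL).mono (by linarith) (by omega)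
  | diag i h ho hi hL =>
    have hmem : i ∈ Finset.range τ.forest.size := Finset.mem_range.2 (hτ.entries_lt _ hi).1
    have e1 : C₂ i ≤ C₃ := Finset.single_le_sum (fun j _ => hC₂ j) hmem
    have e2 : D₂ i ≤ ∑ j ∈ Finset.range τ.forest.size, D₂ j :=
      Finset.single_le_sum (fun j _ => Nat.zero_le _) hmem
    exact (h₂ i h ho hi d a L S hd hL).mono (by linarith) (by omega)

/-- Every outcome `S` of the expansion approximates `d/(d-1) (u² - u s)`, the value of the initial
terms, at `u = s / (1 - s²/(d-1))`. -/
theorem exists_expands_initialTerms_bound {K : ℕ} (hK : 1 ≤ K) :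
    ∃ (C : ℝ) (D : ℕ), 0 ≤ C ∧ ∀ (d : ℕ) (S : ℝ[X]), 3 ≤ d →
      Expands K d (initialTerms K d) S → S.natDegree ≤ D ∧
      ∀ s u : ℂ, TreeParams (hop d) s u →
        ‖aeval u S - (1 + hop d ^ 2) * (u ^ 2 - u * s)‖ ≤ C * hop d ^ K := by
  obtain ⟨C₁, D, hC₁, h₁⟩ := resolvable_of_forall (K := K) (Y := initialTerms K 3)
    fun σ hσ => (Term.WellFormed.of_mem_initialTerms hσ).resolvable K
  obtain ⟨C₂, hC₂, h₂⟩ := exists_valueSum_taylorTerms_bound K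
    (T := ⟨4, [(0, 2), (1, 3)]⟩) (fs := [(0, 1), (2, 3)]) (ξ := switching 0 1 2 3)
    abs_le_one_of_mem_switching (by simp [FreshEdges]) (by simp [FreshEdges])
    (fun t s u f x => schurOp_switching t s u _ _ _ _ [] f x) 0 [(0, 1)]
  refine ⟨C₁ * 2 + C₂ * 2, D, by positivity, fun d S hd hS => ?_⟩
  have hp := hop_pos hd
  have hmap : (initialTerms K d).map (Term.withCoef 0) =
      (initialTerms K 3).map (Term.withCoef 0) := by
    rw [initialTerms, initialTerms, filter_map_withCoef, filter_map_withCoef]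
    exact congrArg _ (taylorTerms_map_withCoef _ _ _ _ _ _ _ _ _ _)
  obtain ⟨S₁, S₂, rfl, hS₂, hD, hb⟩ := h₁ d (initialTerms K d) [] S hd hmap
    (by rwa [List.append_nil])
  cases hS₂
  rw [add_zero]
  refine ⟨hD, fun s u ht => ?_⟩
  have e₁ := hb s u 2 ht (by norm_num) fun σ hσ => by
    refine abs_coef_le_of_mem_taylorTerms abs_le_one_of_mem_switching hd ?_
      (List.mem_filter.1 hσ).1
    simpa using div_sqrt_mul_hop_le hd
  have e₂ := h₂ d s u ht ((d : ℝ) / Real.sqrt ((d : ℝ) - 1)) 0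
  have g₁ : treeGreen (hop d) s u [(0, 1), (2, 3)] 0 1 = -(hop d * s) * u := by
    simp [treeGreen]
  have g₂ : treeGreen (hop d) s u [(0, 2), (1, 3)] 0 1 = 0 := by
    simp [treeGreen]
  simp only [entryProd_cons, g₁, g₂, zero_mul, sub_zero] at e₂
  have hv : valueSum (hop d) s u (initialTerms K d) = _ :=
    valueSum_filter_taylorTerms s u hK (by norm_num) (by norm_num) (by norm_num) (by norm_num) _ _
      _ _ []
  rw [hv] at e₁
  set V := valueSum (hop d) s u (taylorTerms K d ⟨4, [(0, 2), (1, 3)]⟩ (switching 0 1 2 3)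
      ((d : ℝ) / Real.sqrt ((d : ℝ) - 1)) 0 0 [(0, 1)])
  set A : ℝ := (d : ℝ) / Real.sqrt ((d : ℝ) - 1) with hA
  have hAt : (A : ℂ) * hop d = 1 + hop d ^ 2 := by
    have : A * hop d = 1 + hop d ^ 2 := by
      rw [hA, div_sqrt_eq_hop hd]
      field_simp
    exact_mod_cast this
  have hAb : |A| * hop d ^ (K + 1) ≤ 2 * hop d ^ K := by
    rw [pow_succ', ← mul_assoc]
    exact mul_le_mul_of_nonneg_right (div_sqrt_mul_hop_le hd) (by positivity)
  simp only [entryProd, List.map_nil, List.prod_nil] at e₁ e₂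
  have hsplit : aeval u S₁ - (1 + (hop d : ℂ) ^ 2) * (u ^ 2 - u * s) =
      (aeval u S₁ - (V + A * u ^ 0 * (hop d * (u * u * 1)))) +
        (V - A * u ^ 0 * (-(hop d * s) * u * 1)) := by
    rw [← hAt]
    ring
  rw [hsplit]
  refine (norm_add_le _ _).trans ((add_le_add e₁ e₂).trans ?_)
  calc C₁ * 2 * hop d ^ K + C₂ * |A| * hop d ^ (K + 1)
      = C₁ * 2 * hop d ^ K + C₂ * (|A| * hop d ^ (K + 1)) := by ring
    _ ≤ C₁ * 2 * hop d ^ K + C₂ * (2 * hop d ^ K) := by gcongr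
    _ = _ := by ring

/-! ### The Stieltjes transform of the Kesten--McKay law -/

/-- On the unit circle, `kernelAux t s w + kernelAux t s w⁻¹` is, up to a constant, the integrand of
the Stieltjes transform of the Kesten--McKay law in the variable `x = w + w⁻¹`
(`kernelAux_add_inv`).  The function is a sum of terms `f w` and `w / (w - p) * f w` with `f` analytic
and `|p| < 1`, so that Cauchy's formula gives its average over the circle. -/
def kernelAux (t s w : ℂ) : ℂ :=
  (2 / (1 + s * w) - 1) * (2 - (1 - t ^ 2) / (1 - t ^ 2 * w ^ 2)) -
    (1 - t ^ 2) / 2 * (((w - 0) / (w - t)) • (2 / (1 + s * w) - 1) +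
      ((w - 0) / (w - -t)) • (2 / (1 + s * w) - 1))

theorem one_add_mul_ne_zero {a w : ℂ} (ha : ‖a‖ < 1) (hw : ‖w‖ ≤ 1) : 1 + a * w ≠ 0 := by
  intro h
  have h1 : ‖a * w‖ = 1 := by
    rw [show a * w = -1 by linear_combination h, norm_neg, norm_one]
  rw [norm_mul] at h1
  nlinarith [norm_nonneg a, norm_nonneg w]

theorem sub_ne_zero_of_norm_eq_one {a w : ℂ} (ha : ‖a‖ < 1) (hw : ‖w‖ = 1) : w - a ≠ 0 := by
  intro h
  rw [sub_eq_zero.1 h] at hw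
  linarith

theorem circleAverage_kernelAux {t s : ℂ} (ht : ‖t‖ < 1) (hs : ‖s‖ < 1) :
    CircleIntegrable (kernelAux t s) 0 1 ∧
    Real.circleAverage (kernelAux t s) 0 1 = 2 - 2 * (1 - t ^ 2) / (1 - t ^ 2 * s ^ 2) := by
  have ht' : ‖-t‖ < 1 := by rwa [norm_neg]
  have hcl : closure (Metric.ball (0 : ℂ) |1|) ⊆ Metric.closedBall 0 1 := by
    rw [abs_one]
    exact Metric.closure_ball_subset_closedBall
  have h1 : ∀ w ∈ Metric.closedBall (0 : ℂ) 1, 1 + s * w ≠ 0 := fun w hw =>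
    one_add_mul_ne_zero hs (by simpa using hw)
  have h2 : ∀ w ∈ Metric.closedBall (0 : ℂ) 1, 1 - t ^ 2 * w ^ 2 ≠ 0 := fun w hw => by
    have hw' : ‖w‖ ≤ 1 := by simpa using hw
    have e1 := one_add_mul_ne_zero ht hw'
    have e2 := one_add_mul_ne_zero ht' hw'
    have := mul_ne_zero e1 e2
    convert this using 1
    ring
  have hf : DiffContOnCl ℂ (fun w : ℂ => 2 / (1 + s * w) - 1) (Metric.ball 0 |1|) := by
    refine DifferentiableOn.diffContOnCl fun w hw => ?_
    have := h1 w (hcl hw)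
    exact DifferentiableAt.differentiableWithinAt (by fun_prop (disch := assumption))
  have hg : DiffContOnCl ℂ (fun w : ℂ => (2 / (1 + s * w) - 1) *
      (2 - (1 - t ^ 2) / (1 - t ^ 2 * w ^ 2))) (Metric.ball 0 |1|) := by
    refine DifferentiableOn.diffContOnCl fun w hw => ?_
    have e1 := h1 w (hcl hw)
    have e2 := h2 w (hcl hw)
    exact DifferentiableAt.differentiableWithinAt (by fun_prop (disch := assumption))
  have hsph : Metric.sphere (0 : ℂ) |1| ⊆ Metric.closedBall 0 1 := by
    rw [abs_one]
    exact Metric.sphere_subset_closedBall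
  have ig : CircleIntegrable (fun w : ℂ => (2 / (1 + s * w) - 1) *
      (2 - (1 - t ^ 2) / (1 - t ^ 2 * w ^ 2))) 0 1 := by
    refine ContinuousOn.circleIntegrable' fun w hw => ?_
    have e1 := h1 w (hsph hw)
    have e2 := h2 w (hsph hw)
    exact ContinuousAt.continuousWithinAt (by fun_prop (disch := assumption))
  have ip : ∀ a : ℂ, ‖a‖ < 1 → CircleIntegrable
      (fun w : ℂ => ((w - 0) / (w - a)) • (2 / (1 + s * w) - 1)) 0 1 := by
    intro a ha
    refine ContinuousOn.circleIntegrable' fun w hw => ?_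
    have e1 := h1 w (hsph hw)
    have e2 : w - a ≠ 0 := sub_ne_zero_of_norm_eq_one ha (by simpa using hw)
    exact ContinuousAt.continuousWithinAt (by fun_prop (disch := assumption))
  have ip2 : CircleIntegrable (fun w : ℂ => ((1 - t ^ 2) / 2) •
      (((w - 0) / (w - t)) • (2 / (1 + s * w) - 1) +
      ((w - 0) / (w - -t)) • (2 / (1 + s * w) - 1))) 0 1 :=
    ((ip t ht).add (ip (-t) ht')).const_smul (a := (1 - t ^ 2) / 2)
  have hp : ∀ a : ℂ, ‖a‖ < 1 → Real.circleAverage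
      (fun w : ℂ => ((w - 0) / (w - a)) • (2 / (1 + s * w) - 1)) 0 1 = 2 / (1 + s * a) - 1 :=
    fun a ha => hf.circleAverage_smul_div (by simpa using ha)
  refine ⟨ig.sub ip2, ?_⟩
  have hk : kernelAux t s = fun w => (2 / (1 + s * w) - 1) *
      (2 - (1 - t ^ 2) / (1 - t ^ 2 * w ^ 2)) - ((1 - t ^ 2) / 2) •
      (((w - 0) / (w - t)) • (2 / (1 + s * w) - 1) +
      ((w - 0) / (w - -t)) • (2 / (1 + s * w) - 1)) := rfl
  rw [hk, Real.circleAverage_fun_sub ig ip2, hg.circleAverage, Real.circleAverage_fun_smul,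
    Real.circleAverage_fun_add (ip t ht) (ip (-t) ht'), hp t ht, hp (-t) ht']
  have e1 : 1 + s * t ≠ 0 := one_add_mul_ne_zero hs ht.le
  have e2 : 1 + s * -t ≠ 0 := one_add_mul_ne_zero hs ht'.le
  have e3 : 1 - t ^ 2 * s ^ 2 = (1 + s * t) * (1 + s * -t) := by ring
  have e4 : 2 / (1 + s * t) + 2 / (1 + s * -t) = 4 / ((1 + s * t) * (1 + s * -t)) := by
    rw [div_add_div _ _ e1 e2]
    congr 1
    ring
  rw [e3, smul_eq_mul]
  linear_combination (-(1 - t ^ 2) / 2) * e4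

theorem integral_zero_two_pi_eq {X : ℝ → ℂ}
    (hX : IntervalIntegrable X MeasureTheory.volume 0 (2 * Real.pi)) :
    ∫ θ in 0..2 * Real.pi, X θ = ∫ θ in 0..Real.pi, (X θ + X (2 * Real.pi - θ)) := by
  have hp := Real.pi_pos
  have h1 : IntervalIntegrable X MeasureTheory.volume 0 Real.pi := hX.mono_set (by
    rw [Set.uIcc_of_le (by linarith), Set.uIcc_of_le (by linarith)]
    exact Set.Icc_subset_Icc_right (by linarith))
  have h2 : IntervalIntegrable X MeasureTheory.volume Real.pi (2 * Real.pi) := hX.mono_set (by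
    rw [Set.uIcc_of_le (by linarith), Set.uIcc_of_le (by linarith)]
    exact Set.Icc_subset_Icc_left (by linarith))
  have h3 : IntervalIntegrable (fun θ => X (2 * Real.pi - θ)) MeasureTheory.volume 0 Real.pi := by
    have := h2.symm.comp_sub_left (2 * Real.pi)
    simpa [two_mul] using this
  rw [intervalIntegral.integral_add h1 h3, ← intervalIntegral.integral_add_adjacent_intervals h1 h2,
    intervalIntegral.integral_comp_sub_left]
  congr 2 <;> ring

/-- The Kesten--McKay integrand in terms of `w = e^{iθ}`, where `x = w + w⁻¹`. -/
theorem kernelAux_add_inv {t s w : ℂ} (ht0 : t ≠ 0) (hs0 : s ≠ 0) (ht : ‖t‖ < 1) (hs : ‖s‖ < 1)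
    (ht2 : 1 + t ^ 2 ≠ 0) (hw : ‖w‖ = 1) :
    -(w - w⁻¹) ^ 2 * (1 + t ^ 2 - (w + w⁻¹) ^ 2 / ((1 + t ^ 2) / t ^ 2))⁻¹ /
        (w + w⁻¹ - (-s - s⁻¹)) =
      s / (2 * t ^ 2 * (1 - s ^ 2)) * (kernelAux t s w + kernelAux t s w⁻¹) := by
  have hw0 : w ≠ 0 := by
    rintro rfl
    simp at hw
  have ht' : ‖-t‖ < 1 := by rwa [norm_neg]
  have hs' : ‖-s‖ < 1 := by rwa [norm_neg]
  have e1 := one_add_mul_ne_zero hs hw.le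
  have e2 : w + s ≠ 0 := by
    have := sub_ne_zero_of_norm_eq_one hs' hw
    rwa [sub_neg_eq_add] at this
  have e3 := one_add_mul_ne_zero ht hw.le
  have e4 : 1 - t * w ≠ 0 := by
    have := one_add_mul_ne_zero ht' hw.le
    rwa [neg_mul, ← sub_eq_add_neg] at this
  have e5 := sub_ne_zero_of_norm_eq_one ht hw
  have e6 : w + t ≠ 0 := by
    have := sub_ne_zero_of_norm_eq_one ht' hw
    rwa [sub_neg_eq_add] at this
  have e7 : 1 - s ^ 2 ≠ 0 := by
    have a2 : 1 + s ≠ 0 := by simpa using one_add_mul_ne_zero (w := 1) hs (by simp)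
    have a3 : 1 + -s ≠ 0 := by simpa using one_add_mul_ne_zero (w := 1) hs' (by simp)
    have := mul_ne_zero a2 a3
    convert this using 1
    ring
  have k1 : (1 + t ^ 2 - (w + w⁻¹) ^ 2 / ((1 + t ^ 2) / t ^ 2))⁻¹ =
      (1 + t ^ 2) * w ^ 2 / ((1 - t * w) * (1 + t * w) * ((w - t) * (w + t))) := by
    rw [inv_eq_iff_eq_inv, inv_div]
    field_simp
    ring
  have k2 : w + w⁻¹ - (-s - s⁻¹) = (1 + s * w) * (w + s) / (s * w) := by
    field_simp
    ring
  have k3 : kernelAux t s w = (2 / (1 + s * w) - 1) * (2 - (1 - t ^ 2) /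
      ((1 - t * w) * (1 + t * w)) - (1 - t ^ 2) * w ^ 2 / ((w - t) * (w + t))) := by
    rw [kernelAux, show 1 - t ^ 2 * w ^ 2 = (1 - t * w) * (1 + t * w) by ring]
    simp only [sub_zero, sub_neg_eq_add, smul_eq_mul]
    field_simp
    ring
  have k4 : kernelAux t s w⁻¹ = (2 * w / (w + s) - 1) * (2 - (1 - t ^ 2) /
      ((1 - t * w) * (1 + t * w)) - (1 - t ^ 2) * w ^ 2 / ((w - t) * (w + t))) := by
    have a1 : 1 + s * w⁻¹ = (w + s) / w := by field_simp
    have a2 : 1 - t ^ 2 * w⁻¹ ^ 2 = (w - t) * (w + t) / w ^ 2 := by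
      field_simp
      ring
    have a3 : w⁻¹ - t = (1 - t * w) / w := by field_simp
    have a4 : w⁻¹ + t = (1 + t * w) / w := by field_simp
    rw [kernelAux]
    simp only [sub_zero, sub_neg_eq_add, smul_eq_mul]
    have a5 : w⁻¹ / ((1 - t * w) / w) + w⁻¹ / ((1 + t * w) / w) =
        2 / ((1 - t * w) * (1 + t * w)) := by
      rw [div_div_eq_mul_div, div_div_eq_mul_div, inv_mul_cancel₀ hw0, div_add_div _ _ e4 e3]
      congr 1
      ring
    rw [a1, a2, a3, a4, div_div_eq_mul_div, div_div_eq_mul_div (1 - t ^ 2)]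
    linear_combination (-(1 - t ^ 2) / 2 * (2 * w / (w + s) - 1)) * a5
  have k5 : 2 - (1 - t ^ 2) / ((1 - t * w) * (1 + t * w)) -
      (1 - t ^ 2) * w ^ 2 / ((w - t) * (w + t)) =
      -(t ^ 2 * (1 + t ^ 2) * (w ^ 2 - 1) ^ 2) /
        ((1 - t * w) * (1 + t * w) * ((w - t) * (w + t))) := by
    field_simp
    ring
  have k6 : 2 / (1 + s * w) - 1 + (2 * w / (w + s) - 1) =
      2 * w * (1 - s ^ 2) / ((1 + s * w) * (w + s)) := by
    field_simp
    ring
  rw [k3, k4, ← add_mul, k5, k6, k1, k2]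
  field_simp

/-- At `z = -s - 1/s`, the Stieltjes transform of the Kesten--McKay law is `s / (1 - s²/(d-1))`. -/
theorem kestenMcKayStieltjes_eq {d : ℕ} (hd : 3 ≤ d) {s : ℂ} (hs0 : s ≠ 0) (hs : ‖s‖ < 1) :
    kestenMcKayStieltjes d (-s - s⁻¹) = s / (1 - hop d ^ 2 * s ^ 2) := by
  have hd' : (3 : ℝ) ≤ d := by exact_mod_cast hd
  have hp := hop_pos hd
  have hsq := hop_sq_le hd
  have ht0 : (hop d : ℂ) ≠ 0 := by exact_mod_cast hp.ne'
  have ht1 : ‖(hop d : ℂ)‖ < 1 := by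
    rw [Complex.norm_real, Real.norm_of_nonneg hp.le]
    nlinarith
  have ht2 : (1 : ℂ) + (hop d : ℂ) ^ 2 ≠ 0 := by
    have : (0 : ℝ) < 1 + hop d ^ 2 := by positivity
    exact_mod_cast this.ne'
  have hpi := Real.pi_pos
  have hpic : (Real.pi : ℂ) ≠ 0 := by exact_mod_cast hpi.ne'
  have hs2 : 1 - s ^ 2 ≠ 0 := by
    have hs' : ‖-s‖ < 1 := by rwa [norm_neg]
    have := one_add_mul_ne_zero hs' hs.le
    convert this using 1
    ring
  have hts : 1 - (hop d : ℂ) ^ 2 * s ^ 2 ≠ 0 := by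
    have h1 : ‖-((hop d : ℂ) ^ 2 * s)‖ < 1 := by
      rw [norm_neg, norm_mul, norm_pow]
      nlinarith [norm_nonneg s, norm_nonneg (hop d : ℂ)]
    have := one_add_mul_ne_zero h1 hs.le
    convert this using 1
    ring
  set z : ℂ := -s - s⁻¹ with hz
  set g : ℝ → ℂ := fun x => (kestenMcKayDensity d x : ℂ) / ((x : ℂ) - z) with hg
  have hsupp : ∫ x : ℝ, g x = ∫ x in (-2 : ℝ)..2, g x := by
    refine (intervalIntegral.integral_eq_integral_of_support_subset fun x hx => ?_).symm
    by_contra hx2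
    refine hx ?_
    have : 4 - x ^ 2 ≤ 0 := by
      by_contra h
      have h' := abs_lt_of_sq_lt_sq (show x ^ 2 < 2 ^ 2 by linarith) (by norm_num)
      rw [abs_lt] at h'
      exact hx2 ⟨h'.1, h'.2.le⟩
    simp [hg, kestenMcKayDensity, max_eq_right this]
  have hcirc : ∀ θ : ℝ, ‖Complex.exp (θ * Complex.I)‖ = 1 := Complex.norm_exp_ofReal_mul_I
  have hcos : ∀ θ : ℝ, ((2 * Real.cos θ : ℝ) : ℂ) =
      Complex.exp (θ * Complex.I) + (Complex.exp (θ * Complex.I))⁻¹ := fun θ => by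
    rw [← Complex.exp_neg]
    push_cast
    rw [Complex.cos]
    ring_nf
  have hsin : ∀ θ : ℝ, (((2 * Real.sin θ) ^ 2 : ℝ) : ℂ) =
      -(Complex.exp (θ * Complex.I) - (Complex.exp (θ * Complex.I))⁻¹) ^ 2 := fun θ => by
    rw [← Complex.exp_neg]
    push_cast
    rw [Complex.sin, ← neg_mul]
    linear_combination ((Complex.exp (-(θ : ℂ) * Complex.I) - Complex.exp (θ * Complex.I)) ^ 2) *
      Complex.I_sq
  have hden : ∀ θ : ℝ, ((2 * Real.cos θ : ℝ) : ℂ) - z ≠ 0 := fun θ => by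
    have h1 := one_add_mul_ne_zero hs (hcirc θ).le
    have h2 : 1 + s * (Complex.exp (θ * Complex.I))⁻¹ ≠ 0 :=
      one_add_mul_ne_zero hs (by rw [norm_inv, hcirc, inv_one])
    have h3 := Complex.exp_ne_zero (θ * Complex.I)
    have h4 := mul_ne_zero h1 h2
    rw [hcos, hz]
    intro h5
    refine h4 ?_
    have h6 : s * s⁻¹ = 1 := mul_inv_cancel₀ hs0
    have h7 : Complex.exp (θ * Complex.I) * (Complex.exp (θ * Complex.I))⁻¹ = 1 :=
      mul_inv_cancel₀ h3
    linear_combination s * h5 + s ^ 2 * h7 - h6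
  have hdens : ∀ x : ℝ, x ^ 2 ≤ 4 → 1 + 1 / ((d : ℝ) - 1) - x ^ 2 / (d : ℝ) ≠ 0 := fun x hx => by
    have h1 : 0 < 1 / ((d : ℝ) - 1) := by
      have : 0 < (d : ℝ) - 1 := by linarith
      positivity
    have h2 : 1 / ((d : ℝ) - 1) * ((d : ℝ) - 1) = 1 := by
      have : (d : ℝ) - 1 ≠ 0 := by linarith
      field_simp
    have h3 : x ^ 2 / (d : ℝ) ≤ 4 / d := by gcongr
    have h4 : 4 / (d : ℝ) * d = 4 := by field_simp
    have h5 : 4 / (d : ℝ) < 1 + 1 / ((d : ℝ) - 1) := by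
      rw [div_lt_iff₀ (by linarith)]
      nlinarith
    linarith
  have hcos2 : ∀ θ : ℝ, (2 * Real.cos θ) ^ 2 ≤ 4 := fun θ => by
    nlinarith [Real.cos_sq_le_one θ]
  have hcont : ContinuousOn g ((fun θ : ℝ => 2 * Real.cos θ) '' Set.uIcc 0 Real.pi) := by
    rintro _ ⟨θ, -, rfl⟩
    have h1 := hden θ
    have h2 := hdens _ (hcos2 θ)
    refine ContinuousAt.continuousWithinAt ?_
    simp only [hg, kestenMcKayDensity]
    refine ContinuousAt.div (Complex.continuous_ofReal.continuousAt.comp ?_)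
      (by fun_prop) h1
    fun_prop (disch := assumption)
  have hsub := intervalIntegral.integral_deriv_smul_comp' (a := 0) (b := Real.pi)
    (f := fun θ : ℝ => 2 * Real.cos θ) (f' := fun θ : ℝ => 2 * -Real.sin θ) (g := g)
    (fun θ _ => (Real.hasDerivAt_cos θ).const_mul 2) (by fun_prop) hcont
  simp only [Real.cos_zero, Real.cos_pi, mul_one, mul_neg] at hsub
  -- the integrand after the substitution
  set c : ℂ := s / (4 * Real.pi * hop d ^ 2 * (1 - s ^ 2)) with hc
  set X : ℝ → ℂ := fun θ => kernelAux (hop d) s (circleMap 0 1 θ) with hX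
  have hpoint : ∀ θ ∈ Set.uIcc 0 Real.pi,
      (-(2 * Real.sin θ)) • (g ∘ fun θ : ℝ => 2 * Real.cos θ) θ =
        -c * (X θ + X (2 * Real.pi - θ)) := by
    intro θ hθ
    rw [Set.uIcc_of_le hpi.le] at hθ
    have hsin0 : 0 ≤ Real.sin θ := Real.sin_nonneg_of_mem_Icc hθ
    have hw1 : circleMap 0 1 θ = Complex.exp (θ * Complex.I) := by simp [circleMap]
    have hw2 : circleMap 0 1 (2 * Real.pi - θ) = (Complex.exp (θ * Complex.I))⁻¹ := by
      rw [← Complex.exp_neg]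
      simp only [circleMap, zero_add, Complex.ofReal_one, one_mul]
      push_cast
      rw [sub_mul, sub_eq_add_neg, Complex.exp_add, Complex.exp_two_pi_mul_I, one_mul]
    have hker := kernelAux_add_inv ht0 hs0 ht1 hs ht2 (hcirc θ)
    have hsqrt : Real.sqrt (max (4 - (2 * Real.cos θ) ^ 2) 0) = 2 * Real.sin θ := by
      have h1 : 4 - (2 * Real.cos θ) ^ 2 = (2 * Real.sin θ) ^ 2 := by
        nlinarith [Real.sin_sq_add_cos_sq θ]
      rw [h1, max_eq_left (sq_nonneg _), Real.sqrt_sq (by linarith)]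
    have hfac : ((1 + 1 / ((d : ℝ) - 1) - (2 * Real.cos θ) ^ 2 / (d : ℝ) : ℝ) : ℂ) =
        1 + (hop d : ℂ) ^ 2 - (Complex.exp (θ * Complex.I) + (Complex.exp (θ * Complex.I))⁻¹) ^ 2 /
          ((1 + (hop d : ℂ) ^ 2) / (hop d : ℂ) ^ 2) := by
      rw [one_div, ← hop_sq hd, natCast_eq_hop hd, ← hcos]
      push_cast
      ring
    simp only [hX, hw1, hw2]
    have hval : (-(2 * Real.sin θ)) • (g ∘ fun θ : ℝ => 2 * Real.cos θ) θ =
        -(1 / (2 * Real.pi)) * ((((2 * Real.sin θ) ^ 2 : ℝ) : ℂ) *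
        ((1 + 1 / ((d : ℝ) - 1) - (2 * Real.cos θ) ^ 2 / (d : ℝ) : ℝ) : ℂ)⁻¹ /
          (((2 * Real.cos θ : ℝ) : ℂ) - z)) := by
      simp only [Function.comp_apply, hg, kestenMcKayDensity, hsqrt, Complex.real_smul]
      rw [Complex.ofReal_mul (_)⁻¹, Complex.ofReal_inv]
      push_cast
      field_simp
    rw [hval, hsin, hfac, hcos, hz, hker, hc]
    field_simp
    ring
  rw [intervalIntegral.integral_congr hpoint, intervalIntegral.integral_const_mul,
    intervalIntegral.integral_symm (-2) 2] at hsub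
  obtain ⟨hint, havg⟩ := circleAverage_kernelAux ht1 hs
  rw [← integral_zero_two_pi_eq hint] at hsub
  rw [Real.circleAverage_def, Complex.real_smul] at havg
  have h2 : ∫ θ in 0..2 * Real.pi, X θ = 2 * Real.pi *
      (2 - 2 * (1 - (hop d : ℂ) ^ 2) / (1 - (hop d : ℂ) ^ 2 * s ^ 2)) := by
    rw [← havg]
    push_cast
    field_simp
    rfl
  rw [kestenMcKayStieltjes, hsupp]
  rw [h2, hc] at hsub
  have h3 := neg_injective (hsub.symm.trans (neg_mul _ _))
  have h4 : 2 - 2 * (1 - (hop d : ℂ) ^ 2) / (1 - (hop d : ℂ) ^ 2 * s ^ 2) =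
      2 * hop d ^ 2 * (1 - s ^ 2) / (1 - (hop d : ℂ) ^ 2 * s ^ 2) := by
    rw [eq_div_iff hts, sub_mul, div_mul_cancel₀ _ hts]
    ring
  rw [h3, h4]
  field_simp
  norm_num

theorem exists_eq_neg_sub_inv {z : ℂ} (hz : 0 < z.im) :
    ∃ s : ℂ, s ≠ 0 ∧ ‖s‖ < 1 ∧ z = -s - s⁻¹ := by
  obtain ⟨r, hr⟩ := IsAlgClosed.exists_pow_nat_eq (z ^ 2 - 4) (n := 2) (by norm_num)
  have hprod : ((-z + r) / 2) * ((-z - r) / 2) = 1 := by linear_combination -hr / 4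
  set s : ℂ := (-z + r) / 2 with hs
  have hs0 : s ≠ 0 := left_ne_zero_of_mul_eq_one hprod
  have hinv : s⁻¹ = (-z - r) / 2 := inv_eq_of_mul_eq_one_right hprod
  have hzs : z = -s - s⁻¹ := by
    rw [hinv, hs]
    ring
  rcases lt_trichotomy ‖s‖ 1 with h | h | h
  · exact ⟨s, hs0, h, hzs⟩
  · exfalso
    rw [Complex.inv_def, Complex.normSq_eq_norm_sq, h] at hzs
    have := congrArg Complex.im hzs
    simp at this
    linarith
  · refine ⟨s⁻¹, inv_ne_zero hs0, ?_, ?_⟩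
    · rw [norm_inv]
      exact inv_lt_one_of_one_lt₀ h
    · rw [inv_inv, hzs]
      ring

/-! ### The coefficients of the limiting series -/

theorem two_pow_mul_doubleFactorial (n : ℕ) :
    2 ^ (n + 1) * Nat.doubleFactorial (2 * n + 1) = Nat.factorial (n + 2) * catalan (n + 1) := by
  have h1 := Nat.factorial_eq_mul_doubleFactorial (2 * n + 1)
  have h2 := Nat.doubleFactorial_two_mul (n + 1)
  have h3 := succ_mul_catalan_eq_centralBinom (n + 1)
  have h4 := Nat.centralBinom_eq_two_mul_choose (n + 1)
  have h5 := Nat.choose_mul_factorial_mul_factorial (n := 2 * (n + 1)) (k := n + 1) (by omega)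
  have h6 : 2 * (n + 1) - (n + 1) = n + 1 := by omega
  rw [h6, ← h4, ← h3] at h5
  rw [show 2 * n + 1 + 1 = 2 * (n + 1) by ring, h2] at h1
  rw [h1] at h5
  have h7 : Nat.factorial (n + 2) = (n + 2) * Nat.factorial (n + 1) := Nat.factorial_succ (n + 1)
  have h8 := Nat.factorial_pos (n + 1)
  refine Nat.eq_of_mul_eq_mul_right h8 ?_
  rw [h7]
  linarith

theorem catalan_le_four_pow (n : ℕ) : catalan n ≤ 4 ^ n := by
  have h1 := succ_mul_catalan_eq_centralBinom n
  have h3 : Nat.centralBinom n ≤ 4 ^ n := by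
    rw [Nat.centralBinom_eq_two_mul_choose, show 4 ^ n = 2 ^ (2 * n) by rw [pow_mul]; norm_num]
    exact Nat.choose_le_two_pow _ _
  nlinarith

/-- The coefficient of `u^j` in `1 + z u + d/(d-1) u² - P_∞(z, u)`, in terms of Catalan numbers. -/
def limitCoeff (d j : ℕ) : ℝ :=
  if Even j ∧ 4 ≤ j then
    (1 + hop d ^ 2) * (-1) ^ (j / 2) * catalan (j / 2 - 1) * (hop d ^ 2) ^ (j / 2 - 1)
  else 0

theorem coeff_sub_coeff_limitSeries {d : ℕ} (hd : 3 ≤ d) (S : ℝ[X]) (z : ℂ) (j : ℕ) :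
    (selfConsistentPoly (C (1 / ((d : ℝ) - 1)) * X ^ 2 - S) z).coeff j -
      PowerSeries.coeff j (limitSeries d z) = ((limitCoeff d j - S.coeff j : ℝ) : ℂ) := by
  have hd' : (3 : ℝ) ≤ d := by exact_mod_cast hd
  have hdc : (d : ℂ) - 1 ≠ 0 := by
    have : (d : ℝ) - 1 ≠ 0 := by linarith
    exact_mod_cast this
  have hsqc : (hop d : ℂ) ^ 2 = ((d : ℂ) - 1)⁻¹ := by
    rw [← Complex.ofReal_pow, hop_sq hd]
    push_cast
    rfl
  simp only [selfConsistentPoly, limitSeries, PowerSeries.coeff_mk, Polynomial.map_sub,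
    Polynomial.map_mul, Polynomial.map_C, Polynomial.map_pow, Polynomial.map_X, coeff_add, coeff_sub,
    coeff_one, coeff_C_mul, coeff_X_pow, coeff_X, coeff_map, limitCoeff]
  rcases Nat.lt_or_ge j 4 with hj | hj
  · interval_cases j
    · simp
    · simp
    · simp
      field_simp
      ring
    · have : ¬ Even 3 := by decide
      simp [this]
  · simp only [show ¬ j = 0 by omega, show ¬ j = 1 by omega, show ¬ 1 = j by omega,
      show ¬ j = 2 by omega, if_false]
    by_cases he : Even j
    · obtain ⟨n, rfl⟩ : ∃ n, j = 2 * (n + 2) := by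
        obtain ⟨k, rfl⟩ := he
        exact ⟨k - 2, by omega⟩
      rw [if_pos he, if_pos ⟨he, hj⟩]
      have h1 : 2 * (n + 2) / 2 = n + 2 := by omega
      have h2 : 2 * (n + 2) - 3 = 2 * n + 1 := by omega
      have h3 : n + 2 - 1 = n + 1 := by omega
      rw [h1, h2, h3]
      have hc : (2 : ℂ) ^ (n + 1) * (Nat.doubleFactorial (2 * n + 1) : ℂ) =
          (Nat.factorial (n + 2) : ℂ) * (catalan (n + 1) : ℂ) := by
        exact_mod_cast two_pow_mul_doubleFactorial n
      have hf : (Nat.factorial (n + 2) : ℂ) ≠ 0 := by exact_mod_cast (Nat.factorial_pos _).ne'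
      have hdd : (d : ℂ) / ((d : ℂ) - 1) ^ (n + 2) =
          (1 + (hop d : ℂ) ^ 2) * ((hop d : ℂ) ^ 2) ^ (n + 1) := by
        have h1d : 1 + ((d : ℂ) - 1)⁻¹ = d / ((d : ℂ) - 1) := by
          rw [eq_div_iff hdc, add_mul, inv_mul_cancel₀ hdc]
          ring
        rw [hsqc, h1d, inv_pow, ← div_eq_mul_inv, div_div, ← pow_succ']
      have hq : (-2 : ℂ) ^ (n + 1) * (Nat.doubleFactorial (2 * n + 1) : ℂ) /
          (Nat.factorial (n + 2) : ℂ) = -(-1) ^ (n + 2) * catalan (n + 1) := by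
        rw [div_eq_iff hf, neg_pow]
        linear_combination ((-1 : ℂ) ^ (n + 1)) * hc
      rw [hdd, hq]
      push_cast
      simp only [Complex.coe_algebraMap]
      ring
    · rw [if_neg he, if_neg (fun h => he h.1)]
      simp

/-! ### Recovering the coefficients from values on the tree -/

/-- The truncation `∑_{n ≤ J} C_n x^n` of the generating function of the Catalan numbers. -/
def catalanPoly (J : ℕ) : ℝ[X] := ∑ n ∈ Finset.range (J + 1), C (catalan n : ℝ) * X ^ n

theorem coeff_catalanPoly (J n : ℕ) :
    (catalanPoly J).coeff n = if n ≤ J then (catalan n : ℝ) else 0 := by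
  simp only [catalanPoly, finsetSum_coeff, coeff_C_mul, coeff_X_pow, mul_ite, mul_one, mul_zero]
  rw [Finset.sum_ite_eq]
  simp

/-- The truncation satisfies the quadratic equation of the generating function up to a multiple of
`x^(J+1)`. -/
theorem exists_catalanPoly_eq (J : ℕ) :
    ∃ R : ℝ[X], 1 + X * catalanPoly J ^ 2 - catalanPoly J = X ^ (J + 1) * R := by
  suffices h : X ^ (J + 1) ∣ 1 + X * catalanPoly J ^ 2 - catalanPoly J by
    obtain ⟨R, hR⟩ := h
    exact ⟨R, hR⟩
  rw [X_pow_dvd_iff]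
  intro k hk
  rcases k with _ | k
  · simp [coeff_catalanPoly]
  · rw [coeff_sub, coeff_add, coeff_X_mul, sq, coeff_mul, coeff_catalanPoly, if_pos (by omega),
      catalan_succ', coeff_one, if_neg (by omega), zero_add, sub_eq_zero]
    push_cast
    refine Finset.sum_congr rfl fun p hp => ?_
    have := Finset.HasAntidiagonal.mem_antidiagonal.1 hp
    rw [coeff_catalanPoly, coeff_catalanPoly, if_pos (by omega), if_pos (by omega)]

theorem abs_eval_catalanPoly_le {J : ℕ} {x : ℝ} (hx : |x| ≤ 1 / 8) :
    |(catalanPoly J).eval x| ≤ 2 := by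
  rw [catalanPoly, eval_finsetSum]
  refine (Finset.abs_sum_le_sum_abs _ _).trans ?_
  refine (Finset.sum_le_sum fun n _ => ?_).trans (sum_geometric_two_le (J + 1))
  rw [eval_mul, eval_C, eval_pow, eval_X, abs_mul, abs_pow, Nat.abs_cast]
  have h1 : (catalan n : ℝ) ≤ 4 ^ n := by exact_mod_cast catalan_le_four_pow n
  have h2 : |x| ^ n ≤ (1 / 8) ^ n := pow_le_pow_left₀ (abs_nonneg x) hx n
  calc (catalan n : ℝ) * |x| ^ n ≤ 4 ^ n * (1 / 8) ^ n := by gcongr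
    _ = (1 / 2) ^ n := by
        rw [← mul_pow]
        norm_num

/-- The truncated generating function is close to the solution of the quadratic equation. -/
theorem exists_abs_eval_catalanPoly_sub_le (J : ℕ) :
    ∃ B : ℝ, 0 ≤ B ∧ ∀ x g : ℝ, |x| ≤ 1 / 8 → |g| ≤ 1 → g = 1 + x * g ^ 2 →
      |(catalanPoly J).eval x - g| ≤ B * |x| ^ (J + 1) := by
  obtain ⟨R, hR⟩ := exists_catalanPoly_eq J
  obtain ⟨B, hB⟩ := (isCompact_Icc (a := (-1 : ℝ)) (b := 1)).exists_bound_of_continuousOn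
    (f := fun x => R.eval x) R.continuous.continuousOn
  have hB0 : 0 ≤ B := (norm_nonneg _).trans (hB 0 (by norm_num))
  refine ⟨2 * B, by positivity, fun x g hx hg hq => ?_⟩
  set h := (catalanPoly J).eval x with hh
  have hh2 : |h| ≤ 2 := abs_eval_catalanPoly_le hx
  have hR' := congrArg (Polynomial.eval x) hR
  simp only [eval_sub, eval_add, eval_one, eval_mul, eval_X, eval_pow] at hR'
  rw [← hh] at hR'
  have hx' := abs_le.1 hx
  have hb : |R.eval x| ≤ B := hB x ⟨by linarith, by linarith⟩
  have h1 : (h - g) * (1 - x * (h + g)) = -(x ^ (J + 1) * R.eval x) := by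
    rw [← hR']
    linear_combination (-1 : ℝ) * hq
  have h2 : 1 / 2 ≤ |1 - x * (h + g)| := by
    have h3 : |x * (h + g)| ≤ 1 / 8 * 3 := by
      rw [abs_mul]
      exact mul_le_mul hx ((abs_add_le h g).trans (by linarith)) (abs_nonneg _) (by norm_num)
    have h4 := abs_sub_abs_le_abs_sub (1 : ℝ) (x * (h + g))
    rw [abs_one] at h4
    linarith
  have h5 : |h - g| * |1 - x * (h + g)| ≤ |x| ^ (J + 1) * B := by
    rw [← abs_mul, h1, abs_neg, abs_mul, abs_pow]
    gcongr
  nlinarith [abs_nonneg (h - g)]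

/-- The coefficients of a polynomial of bounded degree are bounded by its values at finitely many
points. -/
theorem exists_coeff_bound (D : ℕ) : ∃ B : ℝ, 0 ≤ B ∧ ∀ (p : ℝ[X]) (ε : ℝ), p.natDegree ≤ D →
    (∀ x : ℝ, 0 < x → x ≤ 1 / 2 → |p.eval x| ≤ ε) → ∀ j, |p.coeff j| ≤ B * ε := by
  set v : ℕ → ℝ := fun i => 1 / (2 * ((i : ℝ) + 1)) with hv
  have hpos : ∀ i, 0 < v i := fun i => by positivity
  have hle : ∀ i, v i ≤ 1 / 2 := fun i => by
    have : (0 : ℝ) ≤ i := Nat.cast_nonneg i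
    exact one_div_le_one_div_of_le (by norm_num) (by linarith)
  have hinj : Set.InjOn v (Finset.range (D + 1)) := by
    intro i _ k _ h
    have h' := inv_injective (by simpa only [hv, one_div] using h)
    have : (i : ℝ) = k := by linarith
    exact_mod_cast this
  refine ⟨∑ i ∈ Finset.range (D + 1), ∑ j ∈ Finset.range (D + 1),
    |(Lagrange.basis (Finset.range (D + 1)) v i).coeff j|, by positivity,
    fun p ε hp hε j => ?_⟩
  have hε0 : 0 ≤ ε := (abs_nonneg _).trans (hε (1 / 2) (by norm_num) le_rfl)
  rcases Nat.lt_or_ge D j with hj | hj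
  · rw [coeff_eq_zero_of_natDegree_lt (by omega), abs_zero]
    positivity
  · have hdeg : p.degree < (Finset.range (D + 1)).card := by
      rw [Finset.card_range]
      exact (degree_le_of_natDegree_le hp).trans_lt (by exact_mod_cast Nat.lt_succ_self D)
    have hint := Lagrange.eq_interpolate hinj hdeg
    rw [Lagrange.interpolate_apply] at hint
    rw [hint, finsetSum_coeff, Finset.sum_mul]
    refine (Finset.abs_sum_le_sum_abs _ _).trans (Finset.sum_le_sum fun i _ => ?_)
    rw [coeff_C_mul, abs_mul, mul_comm]
    refine mul_le_mul ?_ (hε _ (hpos i) (hle i)) (abs_nonneg _) (by positivity)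
    exact Finset.single_le_sum (f := fun j =>
      |(Lagrange.basis (Finset.range (D + 1)) v i).coeff j|) (fun _ _ => abs_nonneg _)
      (Finset.mem_range.2 (by omega))

/-- Every small real `u` is the diagonal Green's function of the tree at some real spectral
parameter. -/
theorem exists_treeParams {t : ℝ} (ht : 0 < t) (ht2 : t ^ 2 ≤ 1 / 2) {u : ℝ} (hu : 0 < u)
    (hu2 : u ≤ 1 / 2) :
    ∃ s : ℝ, 0 < s ∧ s ≤ u ∧ u * (1 - t ^ 2 * s ^ 2) = s ∧ TreeParams t s u := by
  set r := Real.sqrt (1 + 4 * t ^ 2 * u ^ 2) with hr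
  have hr2 : r ^ 2 = 1 + 4 * t ^ 2 * u ^ 2 := Real.sq_sqrt (by positivity)
  have hr0 : 0 ≤ r := Real.sqrt_nonneg _
  have hr1 : 1 ≤ r := by
    rw [hr, Real.one_le_sqrt]
    have : 0 ≤ 4 * t ^ 2 * u ^ 2 := by positivity
    linarith
  have hs : 0 < 2 * u / (1 + r) := by positivity
  have hsu : 2 * u / (1 + r) ≤ u := by
    rw [div_le_iff₀ (by positivity)]
    nlinarith
  have heq : u * (1 - t ^ 2 * (2 * u / (1 + r)) ^ 2) = 2 * u / (1 + r) := by
    have : (1 + r) ≠ 0 := by positivity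
    field_simp
    linear_combination hr2
  refine ⟨2 * u / (1 + r), hs, hsu, heq, ht, ht2, ?_, ?_, ?_⟩
  · exact_mod_cast hs.ne'
  · rw [Complex.norm_real, Real.norm_of_nonneg hs.le]
    linarith
  · exact_mod_cast heq

/-- The truncation of the limiting series, as a polynomial. -/
def limitPoly (d J : ℕ) : ℝ[X] :=
  C (1 + hop d ^ 2) * X ^ 2 * (1 - (catalanPoly J).comp (C (-hop d ^ 2) * X ^ 2))

theorem limitPoly_eq_sum (d J : ℕ) : limitPoly d J = ∑ n ∈ Finset.range J,
    C ((1 + hop d ^ 2) * (-1) ^ (n + 2) * catalan (n + 1) * (hop d ^ 2) ^ (n + 1)) *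
      X ^ (2 * (n + 2)) := by
  rw [limitPoly, catalanPoly, Polynomial.sum_comp, Finset.sum_range_succ']
  simp only [mul_comp, C_comp, X_pow_comp, catalan_zero, Nat.cast_one, map_one, pow_zero, one_mul,
    one_comp]
  rw [sub_add_cancel_right, mul_neg, Finset.mul_sum, ← Finset.sum_neg_distrib]
  refine Finset.sum_congr rfl fun n _ => ?_
  rw [mul_pow, ← C_pow, ← pow_mul]
  simp only [neg_pow (hop d ^ 2)]
  simp only [map_mul, map_pow, map_add, map_neg, map_one, map_natCast]
  ring

theorem coeff_limitPoly (d J j : ℕ) :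
    (limitPoly d J).coeff j = if j ≤ 2 * J + 2 then limitCoeff d j else 0 := by
  rw [limitPoly_eq_sum, finsetSum_coeff]
  simp only [coeff_C_mul, coeff_X_pow, limitCoeff]
  by_cases h : Even j ∧ 4 ≤ j ∧ j ≤ 2 * J + 2
  · obtain ⟨he, h4, hJ⟩ := h
    obtain ⟨n, rfl⟩ : ∃ n, j = 2 * (n + 2) := by
      obtain ⟨k, rfl⟩ := he
      exact ⟨k - 2, by omega⟩
    rw [Finset.sum_eq_single n, if_pos rfl, if_pos hJ, if_pos ⟨he, h4⟩, mul_one]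
    · have h1 : 2 * (n + 2) / 2 = n + 2 := by omega
      have h3 : n + 2 - 1 = n + 1 := by omega
      rw [h1, h3]
    · intro k _ hk
      rw [if_neg (by omega), mul_zero]
    · intro hn
      rw [Finset.mem_range] at hn
      omega
  · rw [Finset.sum_eq_zero]
    · split_ifs with h1 h2
      · exact absurd ⟨h2.1, h2.2, h1⟩ h
      · rfl
      · rfl
    · intro n hn
      rw [Finset.mem_range] at hn
      rw [if_neg, mul_zero]
      rintro rfl
      exact h ⟨⟨n + 2, by ring⟩, by omega, by omega⟩

theorem natDegree_limitPoly_le (d J : ℕ) : (limitPoly d J).natDegree ≤ 2 * J + 2 := by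
  rw [natDegree_le_iff_coeff_eq_zero]
  intro j hj
  rw [coeff_limitPoly, if_neg (by omega)]

theorem abs_limitCoeff_le {d J j : ℕ} (hd : 5 ≤ d) (hj : 2 * J + 2 < j) :
    |limitCoeff d j| ≤ 2 * 4 ^ J * hop d ^ J := by
  have h0 := hop_pos (d := d) (by omega)
  have h1 : hop d ^ 2 ≤ 1 / 4 := by
    have hd' : (5 : ℝ) ≤ d := by exact_mod_cast hd
    rw [hop_sq (by omega), one_div]
    exact inv_anti₀ (by norm_num) (by linarith)
  have h2 : hop d ≤ 1 := by nlinarith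
  rw [limitCoeff]
  split_ifs with h
  · have hn : J ≤ j / 2 - 1 := by omega
    set n := j / 2 - 1
    have hc : (catalan n : ℝ) ≤ 4 ^ n := by exact_mod_cast catalan_le_four_pow n
    rw [abs_mul, abs_mul, abs_mul, abs_pow, abs_neg, abs_one, one_pow, mul_one,
      Nat.abs_cast, abs_of_pos (a := 1 + hop d ^ 2) (by positivity),
      abs_of_pos (a := (hop d ^ 2) ^ n) (by positivity)]
    calc (1 + hop d ^ 2) * (catalan n : ℝ) * (hop d ^ 2) ^ n
        ≤ 2 * 4 ^ n * (hop d ^ 2) ^ n := by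
          gcongr
          linarith
      _ = 2 * (4 * hop d ^ 2) ^ n := by ring
      _ ≤ 2 * (4 * hop d ^ 2) ^ J := by
          refine mul_le_mul_of_nonneg_left ?_ (by norm_num)
          exact pow_le_pow_of_le_one (by positivity) (by linarith) hn
      _ = 2 * 4 ^ J * (hop d ^ J * hop d ^ J) := by ring
      _ ≤ 2 * 4 ^ J * (hop d ^ J * 1) := by
          gcongr
          exact pow_le_one₀ h0.le h2
      _ = _ := by ring
  · rw [abs_zero]
    positivity

/-- The truncated limiting series has the same value at `u` as the initial terms of the expansion,
up to a small error. -/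
theorem exists_limitPoly_bound (J : ℕ) : ∃ B : ℝ, 0 ≤ B ∧ ∀ d : ℕ, 3 ≤ d → ∀ s u : ℝ, 0 < s →
    s ≤ u → u ≤ 1 / 2 → u * (1 - hop d ^ 2 * s ^ 2) = s →
    |(limitPoly d J).eval u - (1 + hop d ^ 2) * (u ^ 2 - u * s)| ≤ B * hop d ^ J := by
  obtain ⟨B, hB0, hB⟩ := exists_abs_eval_catalanPoly_sub_le J
  refine ⟨B, hB0, fun d hd s u hs hsu hu heq => ?_⟩
  have h0 := hop_pos hd
  have h1 := hop_sq_le hd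
  have hu0 : 0 < u := hs.trans_le hsu
  have ht : hop d ≤ 1 := by nlinarith
  have hu2 : u ^ 2 ≤ 1 / 4 := by nlinarith
  have hx : |-hop d ^ 2 * u ^ 2| = hop d ^ 2 * u ^ 2 := by
    rw [neg_mul, abs_neg, abs_of_nonneg (by positivity)]
  have hx8 : hop d ^ 2 * u ^ 2 ≤ 1 / 2 * (1 / 4) := by gcongr
  have hxt : hop d ^ 2 * u ^ 2 ≤ hop d := by nlinarith
  have hg : |s / u| ≤ 1 := by
    rw [abs_of_pos (by positivity)]
    exact div_le_one_of_le₀ hsu hu0.le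
  have hq : s / u = 1 + -hop d ^ 2 * u ^ 2 * (s / u) ^ 2 := by
    field_simp
    linear_combination -heq
  have hb := hB (-hop d ^ 2 * u ^ 2) (s / u) (by rw [hx]; linarith) hg hq
  set h := (catalanPoly J).eval (-hop d ^ 2 * u ^ 2) with hh
  have hval : (limitPoly d J).eval u - (1 + hop d ^ 2) * (u ^ 2 - u * s) =
      -((1 + hop d ^ 2) * u ^ 2) * (h - s / u) := by
    simp only [limitPoly, eval_mul, eval_C, eval_pow, eval_X, eval_sub, eval_one, eval_comp]
    rw [← hh]
    field_simp
    ring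
  rw [hval, abs_mul, abs_neg, abs_of_pos (by positivity)]
  have hc : (1 + hop d ^ 2) * u ^ 2 ≤ 1 := by nlinarith
  calc (1 + hop d ^ 2) * u ^ 2 * |h - s / u| ≤ 1 * (B * |-hop d ^ 2 * u ^ 2| ^ (J + 1)) := by
        gcongr
    _ ≤ 1 * (B * hop d ^ (J + 1)) := by
        rw [hx]
        gcongr
    _ ≤ B * hop d ^ J := by
        rw [one_mul]
        exact mul_le_mul_of_nonneg_left (pow_le_pow_of_le_one h0.le ht (Nat.le_succ J)) hB0

/-- All outcomes of the expansion have nearly the coefficients of the limiting series. -/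
theorem exists_coeff_sub_limitCoeff_bound {K : ℕ} (hK : 1 ≤ K) :
    ∃ B : ℝ, 0 ≤ B ∧ ∀ (d : ℕ) (S : ℝ[X]), 5 ≤ d → Expands K d (initialTerms K d) S →
      ∀ j, |limitCoeff d j - S.coeff j| ≤ B * hop d ^ K := by
  obtain ⟨C₁, D, hC₁, h₁⟩ := exists_expands_initialTerms_bound hK
  obtain ⟨C₂, hC₂, h₂⟩ := exists_limitPoly_bound K
  obtain ⟨B, hB, hcoef⟩ := exists_coeff_bound (max D (2 * K + 2))
  refine ⟨B * (C₁ + C₂) + 2 * 4 ^ K, by positivity, fun d S hd hS j => ?_⟩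
  have hd3 : 3 ≤ d := by omega
  have h0 := hop_pos hd3
  obtain ⟨hdeg, hval⟩ := h₁ d S hd3 hS
  have hp := hcoef (limitPoly d K - S) ((C₁ + C₂) * hop d ^ K)
    ((natDegree_sub_le _ _).trans (max_le ((natDegree_limitPoly_le d K).trans (le_max_right _ _))
      (hdeg.trans (le_max_left _ _)))) (fun u hu hu2 => by
      obtain ⟨s, hs, hsu, heq, htree⟩ := exists_treeParams h0 (hop_sq_le hd3) hu hu2
      have e₁ := hval s u htree
      have e₂ := h₂ d hd3 s u hs hsu hu2 heq
      have e₃ : |S.eval u - (1 + hop d ^ 2) * (u ^ 2 - u * s)| ≤ C₁ * hop d ^ K := by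
        rw [← Real.norm_eq_abs, ← Complex.norm_real]
        refine le_trans (le_of_eq ?_) e₁
        have h4 : aeval (u : ℂ) S = ((S.eval u : ℝ) : ℂ) :=
          (aeval_algebraMap_apply ℂ u S).trans (by rw [coe_aeval_eq_eval]; rfl)
        rw [h4]
        push_cast
        rfl
      have hsplit : (limitPoly d K - S).eval u =
          ((limitPoly d K).eval u - (1 + hop d ^ 2) * (u ^ 2 - u * s)) -
          (S.eval u - (1 + hop d ^ 2) * (u ^ 2 - u * s)) := by
        rw [eval_sub]
        ring
      rw [hsplit]
      refine (abs_sub _ _).trans ((add_le_add e₂ e₃).trans (le_of_eq ?_))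
      ring) j
  rw [coeff_sub, coeff_limitPoly] at hp
  have hsum : (B * (C₁ + C₂) + 2 * 4 ^ K) * hop d ^ K =
      B * ((C₁ + C₂) * hop d ^ K) + 2 * 4 ^ K * hop d ^ K := by ring
  rw [hsum]
  split_ifs at hp with hj
  · have : 0 ≤ 2 * 4 ^ K * hop d ^ K := by positivity
    linarith
  · have h5 := abs_limitCoeff_le hd (not_le.1 hj)
    have h6 : limitCoeff d j - S.coeff j = limitCoeff d j + (0 - S.coeff j) := by ring
    rw [h6]
    refine (abs_add_le _ _).trans ?_
    linarith

/-! ### Conclusion -/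

/-- In the range `N^c ≤ d` with `c K ≥ 2`, the error of the expansion is at most of order `d/N`. -/
theorem hop_pow_le {c : ℝ} {K N d : ℕ} (hK : 2 ≤ c * (K : ℝ)) (hd : 3 ≤ d) (hN : 1 ≤ N)
    (hNd : (N : ℝ) ^ c ≤ (d : ℝ)) : hop d ^ K ≤ 2 ^ K * ((d : ℝ) / (N : ℝ)) := by
  have hd' : (3 : ℝ) ≤ d := by exact_mod_cast hd
  have hN' : (1 : ℝ) ≤ N := by exact_mod_cast hN
  have h0 := hop_pos hd
  have h1 : (N : ℝ) ^ 2 ≤ (d : ℝ) ^ K := by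
    calc (N : ℝ) ^ 2 = (N : ℝ) ^ (2 : ℝ) := by norm_cast
      _ ≤ (N : ℝ) ^ (c * K) := Real.rpow_le_rpow_of_exponent_le hN' hK
      _ = ((N : ℝ) ^ c) ^ K := by rw [Real.rpow_mul (by linarith), Real.rpow_natCast]
      _ ≤ (d : ℝ) ^ K := by gcongr
  have h2 : hop d ^ 2 * d ≤ 2 ^ 2 := by
    rw [hop_sq hd, inv_mul_le_iff₀ (by linarith)]
    linarith
  have h3 : (hop d ^ K * N) ^ 2 ≤ (2 ^ K) ^ 2 := by
    calc (hop d ^ K * N) ^ 2 = (hop d ^ 2) ^ K * (N : ℝ) ^ 2 := by ring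
      _ ≤ (hop d ^ 2) ^ K * (d : ℝ) ^ K := by gcongr
      _ = (hop d ^ 2 * d) ^ K := by rw [mul_pow]
      _ ≤ (2 ^ 2) ^ K := by gcongr
      _ = (2 ^ K) ^ 2 := by rw [← pow_mul, ← pow_mul, mul_comm]
  have h4 : hop d ^ K * N ≤ 2 ^ K := le_of_sq_le_sq h3 (by positivity)
  rw [mul_div_assoc', le_div_iff₀ (by linarith)]
  have h5 : (0 : ℝ) < 2 ^ K := by positivity
  nlinarith

end RegularGraphExpansion

end

theorem proposition5p1 (c : ℝ) (hc : 0 < c) (K : ℕ) (hK : 2 ≤ c * (K : ℝ)) :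
    (∀ d : ℕ, 3 ≤ d → ∃ Q : Polynomial ℝ, RegularGraphExpansion.IsConstructed K d Q) ∧
    (∃ B : ℝ, ∀ (N d : ℕ) (Q : Polynomial ℝ), 3 ≤ d →
      (N : ℝ) ^ c ≤ (d : ℝ) → (d : ℝ) ≤ (N : ℝ) ^ (1 / 3 - c) →
      RegularGraphExpansion.IsConstructed K d Q →
      ∀ z : ℂ, 0 < z.im →
        ‖(RegularGraphExpansion.selfConsistentPoly Q z).eval
          (RegularGraphExpansion.kestenMcKayStieltjes d z)‖ ≤ B * ((d : ℝ) / (N : ℝ))) ∧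
    (∃ (B : ℝ) (N₀ : ℕ), ∀ (N d : ℕ) (Q : Polynomial ℝ), N₀ ≤ N →
      (N : ℝ) ^ c ≤ (d : ℝ) → (d : ℝ) ≤ (N : ℝ) ^ (1 / 3 - c) →
      RegularGraphExpansion.IsConstructed K d Q →
      ∀ (z : ℂ) (j : ℕ),
        ‖(RegularGraphExpansion.selfConsistentPoly Q z).coeff j
          - PowerSeries.coeff j (RegularGraphExpansion.limitSeries d z)‖
            ≤ B * ((d : ℝ) / (N : ℝ))) := by
  open RegularGraphExpansion in
  have hK1 : 1 ≤ K := by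
    rcases Nat.eq_zero_or_pos K with rfl | h
    · norm_num at hK
    · exact h
  refine ⟨fun d _ => ?_, ?_, ?_⟩
  · obtain ⟨S, hS⟩ := exists_expands K d (initialTerms K d)
      fun σ hσ => Term.WellFormed.of_mem_initialTerms hσ
    exact ⟨_, S, hS, rfl⟩
  · obtain ⟨C, D, hC, h⟩ := exists_expands_initialTerms_bound hK1
    refine ⟨C * 2 ^ K, ?_⟩
    rintro N d _ hd hNd hdN ⟨S, hS, rfl⟩ z hz
    have hd' : (3 : ℝ) ≤ d := by exact_mod_cast hd
    -- for `N = 0` the power `N ^ (1 / 3 - c)` is at most `1`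
    have hN : 1 ≤ N := by
      rcases Nat.eq_zero_or_pos N with rfl | hN
      · have := Real.zero_rpow_le_one (1 / 3 - c)
        rw [Nat.cast_zero] at hdN
        linarith
      · exact hN
    obtain ⟨s, hs0, hs, rfl⟩ := exists_eq_neg_sub_inv hz
    rw [kestenMcKayStieltjes_eq hd hs0 hs]
    have hts : 1 - (hop d : ℂ) ^ 2 * s ^ 2 ≠ 0 := by
      have h1 : ‖-((hop d : ℂ) ^ 2 * s)‖ < 1 := by
        rw [norm_neg, norm_mul, norm_pow, Complex.norm_real, Real.norm_eq_abs, sq_abs]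
        nlinarith [norm_nonneg s, sq_nonneg (hop d), hop_sq_le hd]
      have := one_add_mul_ne_zero h1 hs.le
      convert this using 1
      ring
    set u : ℂ := s / (1 - (hop d : ℂ) ^ 2 * s ^ 2) with hu
    have htree : TreeParams (hop d) s u :=
      ⟨hop_pos hd, hop_sq_le hd, hs0, hs.le, div_mul_cancel₀ s hts⟩
    have hb := (h d S hd hS).2 s u htree
    have hsqc : (1 : ℂ) / ((d : ℂ) - 1) = (hop d : ℂ) ^ 2 := by
      rw [← Complex.ofReal_pow, hop_sq hd, one_div]
      push_cast
      rfl
    have hval : (selfConsistentPoly (Polynomial.C (1 / ((d : ℝ) - 1)) * Polynomial.X ^ 2 - S)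
        (-s - s⁻¹)).eval u =
        -(Polynomial.aeval u S - (1 + (hop d : ℂ) ^ 2) * (u ^ 2 - u * s)) := by
      simp only [selfConsistentPoly, Polynomial.map_sub, Polynomial.map_mul, Polynomial.map_C,
        Polynomial.map_pow, Polynomial.map_X, Polynomial.eval_add, Polynomial.eval_sub,
        Polynomial.eval_mul, Polynomial.eval_C, Polynomial.eval_pow, Polynomial.eval_X,
        Polynomial.eval_one, Polynomial.eval_map_algebraMap, Complex.coe_algebraMap]
      push_cast
      rw [hsqc]
      have h1 : s⁻¹ * s = 1 := inv_mul_cancel₀ hs0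
      have h2 := htree.mul_eq
      linear_combination (-s⁻¹) * h2 - (1 + u * (hop d : ℂ) ^ 2 * s) * h1
    rw [hval, norm_neg, mul_assoc]
    exact hb.trans (mul_le_mul_of_nonneg_left (hop_pow_le hK hd hN hNd) hC)
  · obtain ⟨B, hB, h⟩ := exists_coeff_sub_limitCoeff_bound hK1
    -- for `N ≥ 5 ^ (1 / c)` the lower bound on `d` gives `d ≥ 5`
    refine ⟨B * 2 ^ K, ⌈(5 : ℝ) ^ (1 / c)⌉₊, ?_⟩
    rintro N d _ hN₀ hNd hdN ⟨S, hS, rfl⟩ z j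
    have hN5 : (5 : ℝ) ^ (1 / c) ≤ N := Nat.ceil_le.1 hN₀
    have h5 : (5 : ℝ) ≤ d := by
      calc (5 : ℝ) = ((5 : ℝ) ^ (1 / c)) ^ c := by
            rw [← Real.rpow_mul (by norm_num), one_div_mul_cancel hc.ne', Real.rpow_one]
        _ ≤ (N : ℝ) ^ c := Real.rpow_le_rpow (by positivity) hN5 hc.le
        _ ≤ d := hNd
    have hd : 5 ≤ d := by exact_mod_cast h5
    have hN : 1 ≤ N := by
      have : (0 : ℝ) < N := lt_of_lt_of_le (by positivity) hN5
      exact_mod_cast this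
    rw [coeff_sub_coeff_limitSeries (by omega), Complex.norm_real, Real.norm_eq_abs, mul_assoc]
    exact (h d S hd hS j).trans
      (mul_le_mul_of_nonneg_left (hop_pow_le hK (by omega) hN hNd) hB)
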